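/- For $N\ge 0$ let $\Omega_N\subset\mathbf{R}^N$ be the set of coefficient vectors of monic real polynomials of degree $N$ all of whose complex roots have absolute value at most $1$. A random polynomial $P\in\Omega_N$ is one chosen uniformly with respect to Lebesgue measure on $\Omega_N$. Put $$D_{2m}=\prod_{k=0}^{m-1}\left(\frac{k!^2\,2^{2k+1}}{(2k+1)!}\right)^2,\qquad D_{2m+1}=\frac{m!^2\,2^{2m+1}}{(2m+1)!}\,D_{2m},$$ $$D^+_N=\prod_{k=0}^{N-1}\frac{2^{k+1}k!^2}{(2k+1)!},\qquad D^-_{2N}=\frac{2^{2N(N-1)}(2N)!}{N!^2}\,D^+_{2N}.$$ For every $N\ge 0$, the probability that a random polynomial in $\Omega_N$ has only real roots equals $D^+_N/D_N$, and the probability that a random polynomial in $\Omega_{2N}$ has no real roots equals $D^-_{2N}/D_{2N}$; moreover, $P\in\Omega_{2N}$ has no real roots if and only if $P(x)>0$ for all real $x$. There is a constant $C>0$ such that, as $N\to\infty$, $$\frac{D^+_N}{D_N}\sim\frac{C\cdot N^{1/8}}{2^{N^2/2}}\qquad\text{and}\qquad\frac{D^-_{2N}}{D_{2N}}\sim\frac{2C}{\sqrt{2\pi}\,(2N)^{3/8}}.$$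 -/

import Mathlib

open Filter Asymptotics MeasureTheory

noncomputable section

namespace RootRegion

/-- The monic real polynomial `x ^ N + a_{N-1} x ^ (N-1) + ⋯ + a_1 x + a_0` of degree `N` whose
lower coefficients are the coordinates of `a`. -/
def monicPoly {N : ℕ} (a : Fin N → ℝ) : Polynomial ℝ :=
  Polynomial.X ^ N + ∑ i : Fin N, Polynomial.C (a i) * Polynomial.X ^ (i : ℕ)

/-- `Ω_N`: the monic real polynomials of degree `N` all of whose complex roots have absolute value
at most `1`, as a region of coefficient vectors in `ℝ ^ N`. -/
def Omega (N : ℕ) : Set (Fin N → ℝ) :=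
  {a | ∀ z : ℂ, Polynomial.aeval z (monicPoly a) = 0 → ‖z‖ ≤ 1}

/-- The coefficient vectors of polynomials all of whose complex roots are real. -/
def onlyRealRoots (N : ℕ) : Set (Fin N → ℝ) :=
  {a | ∀ z : ℂ, Polynomial.aeval z (monicPoly a) = 0 → z.im = 0}

/-- The coefficient vectors of polynomials without real roots. -/
def noRealRoots (N : ℕ) : Set (Fin N → ℝ) :=
  {a | ∀ x : ℝ, (monicPoly a).eval x ≠ 0}

/-- The probability of the event `E` for a random element of `Ω_N`, distributed uniformly with
respect to Lebesgue measure on the coefficients. -/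
def prob (N : ℕ) (E : Set (Fin N → ℝ)) : ℝ :=
  (ProbabilityTheory.cond (volume : Measure (Fin N → ℝ)) (Omega N)).real E

/-- The factor `k!² 2^(2k+1) / (2k+1)!`. -/
def factorD (k : ℕ) : ℝ :=
  (k.factorial : ℝ) ^ 2 * 2 ^ (2 * k + 1) / ((2 * k + 1).factorial : ℝ)

/-- `D_N`: equal to `∏_{k<m} factorD k ^ 2` if `N = 2m`, with an additional
factor `factorD m` if `N = 2m + 1`. -/
def D (N : ℕ) : ℝ :=
  (if Even N then 1 else factorD (N / 2)) * ∏ k ∈ Finset.range (N / 2), factorD k ^ 2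

/-- `D⁺_N = ∏_{k<N} 2^(k+1) k!² / (2k+1)!`. -/
def DPlus (N : ℕ) : ℝ :=
  ∏ k ∈ Finset.range N,
    (2 : ℝ) ^ (k + 1) * (k.factorial : ℝ) ^ 2 / ((2 * k + 1).factorial : ℝ)

/-- `DMinus N` is `D⁻_{2N} = 2^(2N(N-1)) (2N)! / N!² · D⁺_{2N}`; the truncated subtraction in the
exponent is harmless, as `N * (N - 1) = 0` for `N = 0`. -/
def DMinus (N : ℕ) : ℝ :=
  (2 : ℝ) ^ (2 * N * (N - 1)) * ((2 * N).factorial : ℝ) / (N.factorial : ℝ) ^ 2 * DPlus (2 * N)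

end RootRegion

end

/-! The three volumes are computed exactly; the asymptotics then concern explicit products.

Volume of `Omega N`. Write a polynomial of degree n+1 with constant term k as P = zQ + kQ*, where Q
is monic of degree n and Q*(z) = zⁿQ(1/z). Since |Q*| ≤ |Q| outside the unit disk when the roots of
Q lie in it, for |k| < 1 the roots of P lie in the closed disk exactly when those of Q do
(`cons_schurStep_mem_Omega`). For fixed k the map from Q to the remaining coefficients of P is
linear with determinant (1 - k²)^m (1 + k)^r, n = 2m + r, and integration over k gives `factorD m`.

The other two regions are parametrized by roots. The Jacobian is the modulus of the Vandermonde
determinant, times 2^m for the real and imaginary parts of m conjugate pairs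
(`abs_det_fderiv_coeff`). On a convex domain of ordered parameters this determinant has constant
argument, so the modulus can be taken after integrating. The integral is of de Bruijn type: the
nodes are grouped into pairs, and expanding the determinant gives an alternating sum of products of
two-variable moments (`integral_vandermondeDet_pair`). Only the antisymmetric part of the moments
matters, and it vanishes between exponents of equal parity; the sum, a Pfaffian in disguise, thus
collapses to m! times a determinant coupling even with odd exponents (`pairSum_eq_det`). The factor
m! cancels against the count of the ordered chambers, which for real roots is a signed count
(`pairSum_lt`).

Both determinants are of Cauchy type, with denominators (2i+1) + (2j+2) for real roots (bordered by
a column of ones in odd degree) and (2i+1)² - (2j+2)² for conjugate pairs. Their recursions match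
those of `DPlus` and `DMinus`.

For the asymptotics, passing from N to N+1 multiplies `DPlus` by `factorD N / 2 ^ N` and `D` by
`factorD (N / 2)`. As `factorD n` is very nearly a constant times (n + 3/4)^(-1/2), the logarithm of
the normalized ratio has increments O(m⁻²) along even N = 2m and O(1/m) from even to odd N, so it
converges to some c, and C = exp c. The second ratio is the first one at 2N times 2^(2N(N-1)) and a
central binomial coefficient, which Stirling's formula evaluates. -/

namespace RootRegion

open Equiv Equiv.Perm

/-! ### Alternating sums over paired indices -/

section PairSum

variable {κ ρ R : Type*} [Fintype κ] [DecidableEq κ] [Fintype ρ] [DecidableEq ρ] [Field R]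

/-- The alternating sum `∑ σ, sign σ ∏ᵢ Aᵢ(σ(i), σ(i')) ∏ᵣ bᵣ(σ(r))` over all permutations of an
index set that is split into the pairs `(i, i')`, `i ∈ κ`, and the singletons `r ∈ ρ`. -/
def pairSum (A : κ → (κ ⊕ ρ) ⊕ κ → (κ ⊕ ρ) ⊕ κ → R) (b : ρ → (κ ⊕ ρ) ⊕ κ → R) : R :=
  ∑ σ : Perm ((κ ⊕ ρ) ⊕ κ), ((sign σ : ℤ) : R) *
    ((∏ i, A i (σ (.inl (.inl i))) (σ (.inr i))) * ∏ r, b r (σ (.inl (.inr r))))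

/-- Composing σ with the transposition of the two members of pair `k` reverses the sign and keeps
every weight, so the sum equals its own negative. -/
theorem pairSum_eq_zero_of_symm [CharZero R]
    (A : κ → (κ ⊕ ρ) ⊕ κ → (κ ⊕ ρ) ⊕ κ → R) (b : ρ → (κ ⊕ ρ) ⊕ κ → R) (k : κ)
    (h : ∀ x y, A k x y = A k y x) : pairSum A b = 0 := by
  rw [← self_eq_neg]
  conv_lhs =>
    rw [pairSum, ← Equiv.sum_comp (Equiv.mulRight (swap (.inl (.inl k)) (.inr k)))]
  rw [pairSum, ← Finset.sum_neg_distrib]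
  refine Finset.sum_congr rfl fun σ _ => ?_
  have hne : (Sum.inl (Sum.inl k) : (κ ⊕ ρ) ⊕ κ) ≠ Sum.inr k := by simp
  have h1 : ∀ r, swap (Sum.inl (Sum.inl k) : (κ ⊕ ρ) ⊕ κ) (.inr k) (.inl (.inr r))
      = .inl (.inr r) := fun r => swap_apply_of_ne_of_ne (by simp) (by simp)
  simp only [coe_mulRight, Perm.mul_apply, Perm.sign_mul, sign_swap hne, h1]
  have h2 : ∀ i, A i (σ (swap (.inl (.inl k)) (.inr k) (.inl (.inl i))))
      (σ (swap (.inl (.inl k)) (.inr k) (.inr i))) = A i (σ (.inl (.inl i))) (σ (.inr i)) := by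
    intro i
    by_cases hi : i = k
    · subst hi
      rw [swap_apply_left, swap_apply_right, h]
    · rw [swap_apply_of_ne_of_ne (by simpa using hi) (by simp),
        swap_apply_of_ne_of_ne (by simp) (by simpa using hi)]
  simp [h2]

theorem pairSum_update_sub (A : κ → (κ ⊕ ρ) ⊕ κ → (κ ⊕ ρ) ⊕ κ → R)
    (b : ρ → (κ ⊕ ρ) ⊕ κ → R) (k : κ) (M M' : (κ ⊕ ρ) ⊕ κ → (κ ⊕ ρ) ⊕ κ → R) :
    pairSum (Function.update A k M) b - pairSum (Function.update A k M') b
      = pairSum (Function.update A k (M - M')) b := by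
  simp only [pairSum, ← Finset.sum_sub_distrib]
  refine Finset.sum_congr rfl fun σ _ => ?_
  have key : ∀ Q : (κ ⊕ ρ) ⊕ κ → (κ ⊕ ρ) ⊕ κ → R,
      ∏ i, Function.update A k Q i (σ (.inl (.inl i))) (σ (.inr i))
        = Q (σ (.inl (.inl k))) (σ (.inr k))
          * ∏ i ∈ Finset.univ.erase k, A i (σ (.inl (.inl i))) (σ (.inr i)) := by
    intro Q
    rw [← Finset.mul_prod_erase _ _ (Finset.mem_univ k), Function.update_self]
    congr 1
    refine Finset.prod_congr rfl fun i hi => ?_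
    rw [Function.update_of_ne (Finset.ne_of_mem_erase hi)]
  rw [key, key, key]
  simp only [Pi.sub_apply]
  ring

/-- The alternating sum only depends on the antisymmetrization of the pair weights. -/
theorem pairSum_congr_antisymm [CharZero R]
    (A A' : κ → (κ ⊕ ρ) ⊕ κ → (κ ⊕ ρ) ⊕ κ → R) (b : ρ → (κ ⊕ ρ) ⊕ κ → R)
    (h : ∀ i x y, A i x y - A i y x = A' i x y - A' i y x) : pairSum A b = pairSum A' b := by
  -- The weights are exchanged one pair at a time; each exchange changes the sum by a sum with the
  -- symmetric weight `A' k - A k`.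
  have key : ∀ s : Finset κ, pairSum (fun i => if i ∈ s then A' i else A i) b = pairSum A b := by
    intro s
    induction s using Finset.induction_on with
    | empty => simp
    | insert k s hk ih =>
      rw [← ih]
      have e1 : (fun i => if i ∈ insert k s then A' i else A i)
          = Function.update (fun i => if i ∈ s then A' i else A i) k (A' k) := by
        funext i
        by_cases hi : i = k
        · subst hi; simp
        · simp [hi]
      have e2 : (fun i => if i ∈ s then A' i else A i)
          = Function.update (fun i => if i ∈ s then A' i else A i) k (A k) := by
        funext i
        by_cases hi : i = k
        · subst hi; simp [hk]
        · simp [hi]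
      conv_rhs => rw [e2]
      rw [e1, ← sub_eq_zero, pairSum_update_sub]
      refine pairSum_eq_zero_of_symm _ _ k fun x y => ?_
      simp only [Function.update_self, Pi.sub_apply]
      linear_combination -h k x y
  simpa using (key Finset.univ).symm

/-- If the antisymmetrized pair weight couples only the two sides of the index set and the
singleton weights live on the left side, then the alternating sum is a determinant. -/
theorem pairSum_eq_det [CharZero R]
    (A : (κ ⊕ ρ) ⊕ κ → (κ ⊕ ρ) ⊕ κ → R) (b : (κ ⊕ ρ) ⊕ κ → R)
    (hl : ∀ x y, A (.inl x) (.inl y) = A (.inl y) (.inl x))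
    (hr : ∀ x y, A (.inr x) (.inr y) = A (.inr y) (.inr x))
    (hb : ρ → ∀ x, b (.inr x) = 0) :
    pairSum (fun _ : κ => A) (fun _ : ρ => b) = (Fintype.card κ).factorial *
      (Matrix.of fun (x : κ ⊕ ρ) (y : κ ⊕ ρ) => Sum.elim
        (fun k => A (.inl x) (.inr k) - A (.inr k) (.inl x)) (fun _ => b (.inl x)) y).det := by
  set B : (κ ⊕ ρ) → κ → R := fun x k => A (.inl x) (.inr k) - A (.inr k) (.inl x) with hB
  -- `A'` has the antisymmetrization of `A` but is supported on (left, right) arguments, so only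
  -- permutations preserving the two sides contribute.
  let A' : (κ ⊕ ρ) ⊕ κ → (κ ⊕ ρ) ⊕ κ → R := fun x y =>
    Sum.elim (fun l => Sum.elim (fun _ => 0) (fun k => B l k) y) (fun _ => 0) x
  rw [pairSum_congr_antisymm _ (fun _ => A')]
  · have hsub : pairSum (fun _ : κ => A') (fun _ : ρ => b)
        = ∑ p : Perm (κ ⊕ ρ) × Perm κ, ((sign p.1 : ℤ) : R) * ((sign p.2 : ℤ) : R) *
          ((∏ i, B (p.1 (.inl i)) (p.2 i)) * ∏ r, b (.inl (p.1 (.inr r)))) := by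
      symm
      rw [pairSum]
      refine Finset.sum_of_injOn (fun p => Perm.sumCongr p.1 p.2) ?_ ?_ ?_ ?_
      · intro p _ p' _ h
        exact Perm.sumCongrHom_injective (a₁ := p) (a₂ := p') h
      · intro p _
        simp
      · intro σ _ hσ
        have h1 : ¬ Set.MapsTo σ (Set.range Sum.inl) (Set.range Sum.inl) := by
          intro hm
          obtain ⟨p, hp⟩ := mem_sumCongrHom_range_of_perm_mapsTo_inl hm
          exact hσ ⟨p, by simp, hp⟩
        have h2 : ∃ x, ∀ y, σ (.inl x) ≠ .inl y := by
          by_contra hcon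
          push Not at hcon
          refine h1 ?_
          rintro _ ⟨x, rfl⟩
          obtain ⟨y, hy⟩ := hcon x
          exact ⟨y, hy.symm⟩
        obtain ⟨x, hx⟩ := h2
        rcases hs : σ (.inl x) with y | y
        · exact absurd hs (hx y)
        rcases x with i | r
        · rw [Finset.prod_eq_zero (Finset.mem_univ i)]
          · simp
          · rw [hs]; rfl
        · rw [Finset.prod_eq_zero (i := r) (s := Finset.univ) (f := fun r => b _)
            (Finset.mem_univ r)]
          · simp
          · rw [hs]; exact hb r _
      · rintro ⟨p, q⟩ _
        simp [A', Perm.sign_sumCongr]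
    rw [hsub, Fintype.sum_prod_type_right]
    -- Precomposing `p` with `q` on the pairs absorbs the permutation of the right side; the signs
    -- cancel, and every `q` yields the same determinant.
    have hq : ∀ q : Perm κ, ∑ p : Perm (κ ⊕ ρ), ((sign p : ℤ) : R) * ((sign q : ℤ) : R) *
          ((∏ i, B (p (.inl i)) (q i)) * ∏ r, b (.inl (p (.inr r))))
        = (Matrix.of fun (x : κ ⊕ ρ) (y : κ ⊕ ρ) =>
          Sum.elim (fun k => B x k) (fun _ => b (.inl x)) y).det := by
      intro q
      rw [Matrix.det_apply', ← Equiv.sum_comp (Equiv.mulRight (Perm.sumCongr q (1 : Perm ρ)))]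
      refine Finset.sum_congr rfl fun p _ => ?_
      have hs : ((sign q : ℤ) : R) * ((sign q : ℤ) : R) = 1 := by
        rcases Int.units_eq_one_or (sign q) with h | h <;> simp [h]
      rw [Fintype.prod_sum_type]
      simp only [coe_mulRight, Perm.mul_apply, Perm.sign_mul, Perm.sign_sumCongr, Units.val_mul,
        Int.cast_mul, Matrix.of_apply, Sum.elim_inl, Sum.elim_inr, Perm.sumCongr_apply,
        Sum.map_inl, Sum.map_inr, Perm.one_apply, Perm.sign_one, mul_one]
      rw [mul_assoc ((sign p : ℤ) : R), hs, mul_one]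
      congr 2
      exact Equiv.prod_comp q (fun k => B (p (.inl k)) k)
    simp only [hq, Finset.sum_const, Finset.card_univ, Fintype.card_perm, nsmul_eq_mul]
    rfl
  · intro _ x y
    rcases x with x | x <;> rcases y with y | y
    · simp [A', hl x y]
    · simp [A', hB]
    · simp [A', hB]
    · simp [A', hr x y]

/-- Congruence transformations of the weights multiply the alternating sum by the determinant. -/
theorem pairSum_congruence {n : Type*} [Fintype n] [DecidableEq n] (e : (κ ⊕ ρ) ⊕ κ ≃ n)
    (A : n → n → R) (b : n → R) (B : Matrix n n R) :
    pairSum (fun _ : κ => fun x y => ∑ s, ∑ t, B (e x) s * B (e y) t * A s t)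
      (fun _ : ρ => fun x => ∑ s, B (e x) s * b s)
      = B.det * pairSum (fun _ : κ => fun x y => A (e x) (e y)) (fun _ : ρ => fun x => b (e x)) := by
  let F : (n → R) →ₗ[R] (n → R) →ₗ[R] R := Matrix.toLinearMap₂' R (Matrix.of A)
  let G : (n → R) →ₗ[R] R := ∑ s, b s • LinearMap.proj s
  have hF : ∀ v w, F v w = ∑ s, ∑ t, v s * w t * A s t := by
    intro v w
    simp [F, Matrix.toLinearMap₂'_apply, mul_assoc]
  have hG : ∀ v, G v = ∑ s, v s * b s := by
    intro v
    simp [G, mul_comm]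
  -- Every index enters exactly one factor, so the product is linear in each vector. Its
  -- alternatization is then an alternating form of top degree, hence a multiple of the determinant.
  have hlin : ∀ (inst : DecidableEq ((κ ⊕ ρ) ⊕ κ)) (v : (κ ⊕ ρ) ⊕ κ → n → R) (p : (κ ⊕ ρ) ⊕ κ), ∃ ℓ : (n → R) →ₗ[R] R, ∀ x,
      (∏ i, F (Function.update v p x (.inl (.inl i))) (Function.update v p x (.inr i)))
        * ∏ r, G (Function.update v p x (.inl (.inr r))) = ℓ x := by
    rintro inst v ((k | r) | k)
    · refine ⟨((∏ i ∈ Finset.univ.erase k, F (v (.inl (.inl i))) (v (.inr i)))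
        * ∏ r, G (v (.inl (.inr r)))) • F.flip (v (.inr k)), fun x => ?_⟩
      rw [← Finset.mul_prod_erase _ _ (Finset.mem_univ k),
        Finset.prod_congr rfl (g := fun i => F (v (.inl (.inl i))) (v (.inr i)))]
      · simp
        ring
      · intro i hi
        rw [Function.update_of_ne (by simpa using hi), Function.update_of_ne (by simp)]
    · refine ⟨((∏ i, F (v (.inl (.inl i))) (v (.inr i)))
        * ∏ r ∈ Finset.univ.erase r, G (v (.inl (.inr r)))) • G, fun x => ?_⟩
      rw [← Finset.mul_prod_erase (a := r) (s := Finset.univ) (f := fun r => G _)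
        (h := Finset.mem_univ r), Finset.prod_congr rfl (s₁ := Finset.univ.erase r)
        (g := fun i => G (v (.inl (.inr i))))]
      · simp
        ring
      · intro i hi
        rw [Function.update_of_ne (by simpa using hi)]
    · refine ⟨((∏ i ∈ Finset.univ.erase k, F (v (.inl (.inl i))) (v (.inr i)))
        * ∏ r, G (v (.inl (.inr r)))) • F (v (.inl (.inl k))), fun x => ?_⟩
      rw [← Finset.mul_prod_erase _ _ (Finset.mem_univ k),
        Finset.prod_congr rfl (g := fun i => F (v (.inl (.inl i))) (v (.inr i)))]
      · simp
        ring
      · intro i hi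
        rw [Function.update_of_ne (by simp), Function.update_of_ne (by simpa using hi)]
  let Mul : MultilinearMap R (fun _ : (κ ⊕ ρ) ⊕ κ => n → R) R :=
    { toFun := fun v => (∏ i, F (v (.inl (.inl i))) (v (.inr i))) * ∏ r, G (v (.inl (.inr r)))
      map_update_add' := by
        intro inst v p x y
        obtain ⟨ℓ, hℓ⟩ := hlin inst v p
        rw [hℓ, hℓ, hℓ, map_add]
      map_update_smul' := by
        intro inst v p c x
        obtain ⟨ℓ, hℓ⟩ := hlin inst v p
        rw [hℓ, hℓ, map_smul] }
  let Alt := MultilinearMap.alternatization Mul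
  have hAlt : ∀ v, Alt v = pairSum (fun _ : κ => fun x y => F (v x) (v y))
      (fun _ : ρ => fun x => G (v x)) := by
    intro v
    simp only [Alt, MultilinearMap.alternatization_apply, pairSum]
    refine Finset.sum_congr rfl fun σ _ => ?_
    rw [Units.smul_def, zsmul_eq_mul]
    rfl
  have hdet := Alt.eq_smul_basis_det ((Pi.basisFun R n).reindex e.symm)
  have h1 := congrArg (fun f => f (fun x => B (e x))) hdet
  simp only [AlternatingMap.smul_apply, hAlt, hF, hG] at h1
  rw [h1, smul_eq_mul, mul_comm]
  congr 1
  · rw [Module.Basis.det_apply, ← Matrix.det_reindex_self e, ← Matrix.det_transpose B]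
    congr 1
    ext i j
    simp [Module.Basis.toMatrix_apply, Matrix.reindex_apply]
  · simp [Pi.single_apply]

end PairSum

end RootRegion

/-! ### The parity pairing and the signed count of chambers -/

namespace RootRegion

open Equiv Equiv.Perm

/-- Pairs consist of the consecutive indices `2k`, `2k+1`; the singletons come last. -/
def parityIndex (m r : ℕ) : (Fin m ⊕ Fin r) ⊕ Fin m → Fin (2 * m + r)
  | .inl (.inl k) => ⟨2 * k, by omega⟩
  | .inl (.inr s) => ⟨2 * m + s, by omega⟩
  | .inr k => ⟨2 * k + 1, by omega⟩

theorem parityIndex_injective (m r : ℕ) : Function.Injective (parityIndex m r) := by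
  rintro ((k | s) | k) ((k' | s') | k') h <;> simp only [parityIndex, Fin.mk.injEq] at h <;>
    first
    | (exfalso; omega)
    | (congr 2; ext; omega)

noncomputable def parityEquiv (m r : ℕ) : (Fin m ⊕ Fin r) ⊕ Fin m ≃ Fin (2 * m + r) :=
  Equiv.ofBijective (parityIndex m r) <|
    (Fintype.bijective_iff_injective_and_card _).2 ⟨parityIndex_injective m r, by simp; ring⟩

@[simp] theorem parityEquiv_pair_fst (m r : ℕ) (k : Fin m) :
    (parityEquiv m r (.inl (.inl k)) : ℕ) = 2 * k := by
  simp [parityEquiv, parityIndex]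

@[simp] theorem parityEquiv_single (m r : ℕ) (s : Fin r) :
    (parityEquiv m r (.inl (.inr s)) : ℕ) = 2 * m + s := by
  simp [parityEquiv, parityIndex]

@[simp] theorem parityEquiv_pair_snd (m r : ℕ) (k : Fin m) :
    (parityEquiv m r (.inr k) : ℕ) = 2 * k + 1 := by
  simp [parityEquiv, parityIndex]

/-- The left side of the index set carries the even exponents, the right side the odd ones; parity
of the moments then verifies the hypotheses of `pairSum_eq_det`. -/
theorem parityEquiv_inl_even {m r : ℕ} (hr : r ≤ 1) (x : Fin m ⊕ Fin r) :
    Even (parityEquiv m r (.inl x) : ℕ) := by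
  rcases x with k | s
  · simp
  · have : (s : ℕ) = 0 := by omega
    simp [this]

/-- The matrix passing from the standard basis to the differences of successive basis vectors. -/
def differenceMatrix (N : ℕ) : Matrix (Fin N) (Fin N) ℂ :=
  Matrix.of fun j s => (if s = j then 1 else 0) - (if (s : ℕ) = j + 1 then 1 else 0)

theorem det_differenceMatrix (N : ℕ) : (differenceMatrix N).det = 1 := by
  rw [Matrix.det_of_isUpperTriangular]
  · simp [differenceMatrix]
  · intro i j hij
    have h1 : j ≠ i := ne_of_lt hij
    have h2 : (j : ℕ) ≠ i + 1 := by
      have : (j : ℕ) < i := hij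
      omega
    simp [differenceMatrix, h1, h2]

/-- The boundary value `f N = 0` lets the last row, which has only one nonzero entry, obey the same
formula as the others. -/
theorem sum_differenceMatrix_mul {N : ℕ} (j : Fin N) (f : ℕ → ℂ) (hf : f N = 0) :
    ∑ s, differenceMatrix N j s * f s = f j - f (j + 1) := by
  simp only [differenceMatrix, Matrix.of_apply, sub_mul, Finset.sum_sub_distrib, ite_mul, one_mul,
    zero_mul]
  congr 1
  · simp
  · by_cases h : (j : ℕ) + 1 < N
    · rw [Finset.sum_eq_single ⟨j + 1, h⟩]
      · simp
      · intro s _ hs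
        rw [if_neg]
        intro h'
        exact hs (Fin.ext h')
      · simp
    · have : (j : ℕ) + 1 = N := by omega
      rw [this, hf]
      refine Finset.sum_eq_zero fun s _ => ?_
      rw [if_neg]
      omega

/-- The signed number of permutations that are increasing on each pair. -/
theorem pairSum_lt (m r : ℕ) (hr : r ≤ 1) :
    pairSum (fun _ : Fin m => fun x y =>
        if parityEquiv m r x < parityEquiv m r y then (1 : ℂ) else 0)
      (fun _ : Fin r => fun _ => 1) = m.factorial := by
  set e := parityEquiv m r with he
  -- Passing to successive differences has determinant 1 and turns the order relation into a
  -- neighbour relation: apart from a diagonal part, only indices differing by 1, hence of opposite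
  -- parity, stay coupled. The resulting determinant is lower triangular with ones on the diagonal.
  have h := pairSum_congruence e (fun s t => if s < t then (1 : ℂ) else 0) (fun _ => 1)
    (differenceMatrix (2 * m + r))
  rw [det_differenceMatrix, one_mul] at h
  rw [← h]
  have hb : ∀ x, ∑ s, differenceMatrix (2 * m + r) (e x) s * (1 : ℂ) = if (e x : ℕ) + 1 < 2 * m + r then 0 else 1 := by
    intro x
    -- The constant weight is cut off at N to meet the boundary condition; only the last difference
    -- sees the cut.
    have := sum_differenceMatrix_mul (e x) (fun s => if s < 2 * m + r then (1 : ℂ) else 0) (by simp)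
    simp only [Fin.is_lt, if_true] at this
    rw [this]
    split_ifs <;> simp
  have hA : ∀ x y, ∑ s, ∑ t, differenceMatrix (2 * m + r) (e x) s * differenceMatrix (2 * m + r) (e y) t *
      (if s < t then (1 : ℂ) else 0) = (if (e y : ℕ) = e x + 1 then 1 else 0)
        - (if (e y : ℕ) = e x ∧ (e y : ℕ) + 1 < 2 * m + r then 1 else 0) := by
    intro x y
    have h1 : ∀ s : Fin (2 * m + r), ∑ t, differenceMatrix (2 * m + r) (e y) t * (if s < t then (1 : ℂ) else 0)
        = (if (s : ℕ) < e y then 1 else 0)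
          - (if (s : ℕ) < e y + 1 ∧ (e y : ℕ) + 1 < 2 * m + r then 1 else 0) := by
      intro s
      have := sum_differenceMatrix_mul (e y) (fun t => if (s : ℕ) < t ∧ t < 2 * m + r then (1 : ℂ) else 0)
        (by simp)
      simpa only [Fin.is_lt, and_true, Fin.lt_def] using this
    have h2 := sum_differenceMatrix_mul (e x) (fun s => (if s < (e y : ℕ) then (1 : ℂ) else 0)
          - (if s < (e y : ℕ) + 1 ∧ (e y : ℕ) + 1 < 2 * m + r then 1 else 0)) (by
            have := (e y).is_lt
            rw [if_neg (by omega), if_neg (by omega), sub_zero])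
    simp only [mul_assoc, ← Finset.mul_sum, h1]
    rw [h2]
    split_ifs <;> first | (exfalso; omega) | norm_num
  simp only [hA, hb]
  rw [pairSum_eq_det (κ := Fin m) (ρ := Fin r)]
  · rw [Fintype.card_fin]
    convert mul_one _
    rw [← Matrix.fromBlocks_toBlocks (Matrix.of _)]
    have h12 : ∀ M : Matrix (Fin m ⊕ Fin r) (Fin m ⊕ Fin r) ℂ, M.toBlocks₁₂ = 0 →
        M.toBlocks₂₂ = 1 → M.toBlocks₁₁.det = 1 →
        (Matrix.fromBlocks M.toBlocks₁₁ M.toBlocks₁₂ M.toBlocks₂₁ M.toBlocks₂₂).det = 1 := by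
      intro M h1 h2 h3
      rw [h1, h2, Matrix.det_fromBlocks_zero₁₂, h3, Matrix.det_one, one_mul]
    apply h12
    · ext a s
      have := s.is_lt
      have := a.is_lt
      simp only [Matrix.toBlocks₁₂, Matrix.of_apply, Sum.elim_inr, he, parityEquiv_pair_fst,
        Matrix.zero_apply]
      rw [if_pos]
      omega
    · ext s t
      have : s = t := by ext; omega
      subst this
      have := s.is_lt
      simp only [Matrix.toBlocks₂₂, Matrix.of_apply, Sum.elim_inr, he, parityEquiv_single,
        Matrix.one_apply_eq]
      rw [if_neg]
      omega
    · rw [Matrix.det_of_isLowerTriangular]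
      · refine Finset.prod_eq_one fun i _ => ?_
        simp only [Matrix.toBlocks₁₁, Matrix.of_apply, Sum.elim_inl, he, parityEquiv_pair_fst,
          parityEquiv_pair_snd]
        rw [if_pos trivial, if_neg, if_neg, if_neg] <;> first | omega | norm_num
      · intro i j hij
        have hij : (i : ℕ) < j := hij
        simp only [Matrix.toBlocks₁₁, Matrix.of_apply, Sum.elim_inl, he, parityEquiv_pair_fst,
          parityEquiv_pair_snd]
        rw [if_neg, if_neg, if_neg, if_neg] <;> first | omega | norm_num
  · intro x y
    obtain ⟨a, ha⟩ := parityEquiv_inl_even hr x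
    obtain ⟨b, hb⟩ := parityEquiv_inl_even hr y
    rw [he, ha, hb]
    split_ifs <;> first | (exfalso; omega) | norm_num
  · intro x y
    simp only [he, parityEquiv_pair_snd]
    split_ifs <;> first | (exfalso; omega) | norm_num
  · intro s x
    simp only [he, parityEquiv_pair_snd]
    rw [if_pos]
    have := s.is_lt
    omega

end RootRegion

/-! ### Monic real polynomials and their complex roots -/

namespace RootRegion

open Polynomial

section Basic

variable {N : ℕ}

theorem degree_lower_lt (a : Fin N → ℝ) :
    (∑ i : Fin N, C (a i) * X ^ (i : ℕ)).degree < (N : WithBot ℕ) := by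
  rw [Polynomial.degree_lt_iff_coeff_zero]
  intro k hk
  rw [Polynomial.finsetSum_coeff]
  refine Finset.sum_eq_zero fun i _ => ?_
  rw [Polynomial.coeff_C_mul, Polynomial.coeff_X_pow, if_neg (by have := i.is_lt; omega), mul_zero]

theorem monicPoly_monic (a : Fin N → ℝ) : (monicPoly a).Monic :=
  monic_X_pow_add (degree_lower_lt a)

theorem natDegree_monicPoly (a : Fin N → ℝ) : (monicPoly a).natDegree = N := by
  rw [Polynomial.natDegree_eq_of_degree_eq_some]
  rw [monicPoly, Polynomial.degree_add_eq_left_of_degree_lt, Polynomial.degree_X_pow]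
  rw [Polynomial.degree_X_pow]
  exact degree_lower_lt a

theorem aeval_monicPoly (a : Fin N → ℝ) (z : ℂ) :
    aeval z (monicPoly a) = z ^ N + ∑ i, (a i : ℂ) * z ^ (i : ℕ) := by
  simp [monicPoly, map_sum]

theorem coeff_monicPoly (a : Fin N → ℝ) (i : Fin N) : (monicPoly a).coeff i = a i := by
  have hi := i.is_lt
  rw [monicPoly, Polynomial.coeff_add, Polynomial.coeff_X_pow, if_neg (by omega), zero_add,
    Polynomial.finsetSum_coeff, Finset.sum_eq_single i]
  · simp
  · intro j _ hj
    rw [Polynomial.coeff_C_mul, Polynomial.coeff_X_pow, if_neg, mul_zero]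
    intro h
    exact hj (Fin.ext h.symm)
  · simp

theorem monicPoly_coeff {p : ℝ[X]} (hp : p.Monic) (hN : p.natDegree = N) :
    monicPoly (fun i : Fin N => p.coeff i) = p := by
  conv_rhs => rw [hp.as_sum, hN]
  rw [monicPoly, Fin.sum_univ_eq_sum_range (fun i => C (p.coeff i) * X ^ i)]

/-- The complex roots of `monicPoly a`, with multiplicity. -/
noncomputable def complexRoots (a : Fin N → ℝ) : Multiset ℂ :=
  ((monicPoly a).map (algebraMap ℝ ℂ)).roots

theorem card_complexRoots (a : Fin N → ℝ) : (complexRoots a).card = N := by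
  rw [complexRoots, IsAlgClosed.card_roots_eq_natDegree, (monicPoly_monic a).natDegree_map,
    natDegree_monicPoly]

theorem mem_complexRoots {a : Fin N → ℝ} {z : ℂ} :
    z ∈ complexRoots a ↔ aeval z (monicPoly a) = 0 := by
  rw [complexRoots, mem_roots ((monicPoly_monic a).map _).ne_zero, IsRoot.def, eval_map_algebraMap]

theorem map_monicPoly_eq_prod (a : Fin N → ℝ) :
    (monicPoly a).map (algebraMap ℝ ℂ) = ((complexRoots a).map (fun z => X - C z)).prod :=
  (IsAlgClosed.splits _).eq_prod_roots_of_monic ((monicPoly_monic a).map _)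

theorem aeval_eq_prod_complexRoots (a : Fin N → ℝ) (z : ℂ) :
    aeval z (monicPoly a) = ((complexRoots a).map (fun α => z - α)).prod := by
  rw [← eval_map_algebraMap]
  exact (IsAlgClosed.splits _).eval_eq_prod_roots_of_monic ((monicPoly_monic a).map _) z

theorem mem_Omega_iff {a : Fin N → ℝ} : a ∈ Omega N ↔ ∀ z ∈ complexRoots a, ‖z‖ ≤ 1 := by
  simp only [Omega, Set.mem_ofPred_eq, mem_complexRoots]

theorem aeval_conj_monicPoly (a : Fin N → ℝ) (z : ℂ) :
    aeval (starRingEnd ℂ z) (monicPoly a) = starRingEnd ℂ (aeval z (monicPoly a)) := by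
  simp [aeval_monicPoly]

/-- The complement is a countable union of projections of compact sets of pairs (coefficients,
root), the root being bounded and outside the disk by a margin 1/(n+1). No continuity of roots is
needed. -/
theorem measurableSet_Omega (N : ℕ) : MeasurableSet (Omega N) := by
  rw [← MeasurableSet.compl_iff]
  have hcont : Continuous fun p : (Fin N → ℝ) × ℂ => aeval p.2 (monicPoly p.1) := by
    simp only [aeval_monicPoly]
    fun_prop
  let K : ℕ → Set ((Fin N → ℝ) × ℂ) := fun n =>
    (Metric.closedBall 0 (n : ℝ) ×ˢ Metric.closedBall 0 (n : ℝ)) ∩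
      ({p | 1 + 1 / ((n : ℝ) + 1) ≤ ‖p.2‖} ∩ {p | aeval p.2 (monicPoly p.1) = 0})
  have hK : ∀ n, IsCompact (K n) := by
    intro n
    refine ((isCompact_closedBall _ _).prod (isCompact_closedBall _ _)).inter_right ?_
    exact (isClosed_le continuous_const (by fun_prop)).inter
      (isClosed_eq hcont continuous_const)
  have hU : (Omega N)ᶜ = ⋃ n, Prod.fst '' K n := by
    ext a
    simp only [Omega, Set.mem_compl_iff, Set.mem_ofPred_eq, not_forall, not_le, Set.mem_iUnion,
      Set.mem_image, Prod.exists, exists_and_right, exists_eq_right, exists_prop]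
    constructor
    · rintro ⟨z, hz, hz1⟩
      obtain ⟨n1, h1⟩ := exists_nat_ge ‖a‖
      obtain ⟨n2, h2⟩ := exists_nat_ge ‖z‖
      obtain ⟨n3, h3⟩ := exists_nat_one_div_lt (sub_pos.2 hz1)
      refine ⟨n1 + n2 + n3, z, ⟨⟨?_, ?_⟩, ?_, hz⟩⟩
      · simp only [mem_closedBall_zero_iff]
        push_cast
        have : (0 : ℝ) ≤ n2 := by positivity
        have : (0 : ℝ) ≤ n3 := by positivity
        linarith
      · simp only [mem_closedBall_zero_iff]
        push_cast
        have : (0 : ℝ) ≤ n1 := by positivity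
        have : (0 : ℝ) ≤ n3 := by positivity
        linarith
      · have : 1 / (((n1 + n2 + n3 : ℕ) : ℝ) + 1) ≤ 1 / ((n3 : ℝ) + 1) := by
          apply one_div_le_one_div_of_le
          · positivity
          · push_cast
            have : (0 : ℝ) ≤ n1 := by positivity
            have : (0 : ℝ) ≤ n2 := by positivity
            linarith
        show 1 + 1 / (((n1 + n2 + n3 : ℕ) : ℝ) + 1) ≤ ‖z‖
        linarith
    · rintro ⟨n, z, -, h1, h2⟩
      refine ⟨z, h2, lt_of_lt_of_le ?_ h1⟩
      have : (0 : ℝ) < 1 / ((n : ℝ) + 1) := by positivity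
      linarith
  rw [hU]
  exact MeasurableSet.iUnion fun n => ((hK n).image continuous_fst).measurableSet

end Basic

/-! ### The Schur–Cohn recursion -/

section SchurCohn

variable {n : ℕ}

/-- The value of the reciprocal polynomial. -/
def reverseEval (a : Fin n → ℝ) (z : ℂ) : ℂ := 1 + ∑ i, (a i : ℂ) * z ^ (n - (i : ℕ))

/-- Here `w` is the reflection of `z` in the unit circle. Factor by factor, it rests on |z - α|² -
|1 - αz̄|² = (|z|² - 1)(1 - |α|²). -/
theorem norm_conj_prod_le {z w : ℂ} (hz : 1 ≤ ‖z‖) (hw : w * starRingEnd ℂ z = 1)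
    (s : Multiset ℂ) (hs : ∀ α ∈ s, ‖α‖ ≤ 1) :
    ‖z‖ ^ s.card * ‖(s.map (fun α => w - α)).prod‖ ≤ ‖(s.map (fun α => z - α)).prod‖ := by
  induction s using Multiset.induction_on with
  | empty => simp
  | cons α s ih =>
    have hα := hs α (Multiset.mem_cons_self α s)
    have ih := ih fun β hβ => hs β (Multiset.mem_cons_of_mem hβ)
    simp only [Multiset.card_cons, Multiset.map_cons, Multiset.prod_cons, norm_mul]
    have h1 : ‖z‖ * ‖w - α‖ ≤ ‖z - α‖ := by
      have e : ‖z‖ * ‖w - α‖ = ‖1 - α * starRingEnd ℂ z‖ := by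
        rw [← hw, ← sub_mul, norm_mul, RCLike.norm_conj, mul_comm]
      rw [e]
      apply le_of_sq_le_sq _ (norm_nonneg _)
      rw [← Complex.normSq_eq_norm_sq, ← Complex.normSq_eq_norm_sq]
      have hz2 : 1 ≤ Complex.normSq z := by
        rw [Complex.normSq_eq_norm_sq]; nlinarith
      have hα2 : Complex.normSq α ≤ 1 := by
        rw [Complex.normSq_eq_norm_sq]; nlinarith [norm_nonneg α]
      simp only [Complex.normSq_apply, Complex.sub_re, Complex.sub_im, Complex.mul_re,
        Complex.mul_im, Complex.conj_re, Complex.conj_im, Complex.one_re, Complex.one_im] at *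
      nlinarith [mul_nonneg (sub_nonneg.2 hz2) (sub_nonneg.2 hα2)]
    calc ‖z‖ ^ (s.card + 1) * (‖w - α‖ * ‖(s.map (fun α => w - α)).prod‖)
        = (‖z‖ * ‖w - α‖) * (‖z‖ ^ s.card * ‖(s.map (fun α => w - α)).prod‖) := by ring
      _ ≤ _ := by gcongr

/-- The reciprocal polynomial at z is zⁿP(1/z), and as the coefficients are real, 1/z may be
replaced by the reflected point 1/z̄ without changing the modulus. -/
theorem norm_reverseEval_le {a : Fin n → ℝ} (ha : a ∈ Omega n) {z : ℂ} (hz : 1 ≤ ‖z‖) :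
    ‖reverseEval a z‖ ≤ ‖aeval z (monicPoly a)‖ := by
  have hz0 : z ≠ 0 := by
    rintro rfl
    norm_num at hz
  have h1 : reverseEval a z = z ^ n * aeval z⁻¹ (monicPoly a) := by
    rw [reverseEval, aeval_monicPoly, mul_add, ← mul_pow, mul_inv_cancel₀ hz0, one_pow,
      Finset.mul_sum]
    congr 1
    refine Finset.sum_congr rfl fun i _ => ?_
    have hi : (i : ℕ) ≤ n := i.is_lt.le
    rw [pow_sub₀ z hz0 hi, inv_pow]
    ring
  have h2 : ‖aeval z⁻¹ (monicPoly a)‖ = ‖aeval (starRingEnd ℂ z⁻¹) (monicPoly a)‖ := by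
    rw [aeval_conj_monicPoly, RCLike.norm_conj]
  rw [h1, norm_mul, norm_pow, h2, aeval_eq_prod_complexRoots, aeval_eq_prod_complexRoots]
  have := norm_conj_prod_le (w := starRingEnd ℂ z⁻¹) hz
    (by rw [← map_mul, inv_mul_cancel₀ hz0, map_one]) (complexRoots a) (mem_Omega_iff.1 ha)
  rwa [card_complexRoots] at this

/-- One step of the Schur–Cohn recursion on the coefficients. -/
def schurStep (k : ℝ) : (Fin n → ℝ) →ₗ[ℝ] (Fin n → ℝ) :=
  LinearMap.id + k • LinearMap.funLeft ℝ ℝ Fin.rev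

theorem schurStep_apply (k : ℝ) (q : Fin n → ℝ) (i : Fin n) :
    schurStep k q i = q i + k * q i.rev := by
  simp [schurStep, LinearMap.funLeft_apply]

theorem sum_rev_pow_succ (q : Fin n → ℝ) (z : ℂ) :
    ∑ i : Fin n, (q i.rev : ℂ) * z ^ ((i : ℕ) + 1) = ∑ i : Fin n, (q i : ℂ) * z ^ (n - (i : ℕ)) := by
  rw [← Equiv.sum_comp Fin.revPerm]
  refine Finset.sum_congr rfl fun i _ => ?_
  simp only [Fin.revPerm_apply, Fin.rev_rev, Fin.val_rev]
  congr 2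
  omega

theorem sum_rev_pow_sub (q : Fin n → ℝ) (z : ℂ) :
    ∑ i : Fin n, (q i.rev : ℂ) * z ^ (n - (i : ℕ)) = ∑ i : Fin n, (q i : ℂ) * z ^ ((i : ℕ) + 1) := by
  rw [← sum_rev_pow_succ (fun i => q i.rev)]
  simp

/-- The pair (zQ, Q*) is transformed by the matrix with rows (1, k) and (k, 1); this lemma and the
next are its two rows. -/
theorem aeval_cons_schurStep (k : ℝ) (q : Fin n → ℝ) (z : ℂ) :
    aeval z (monicPoly (Fin.cons k (schurStep k q) : Fin (n + 1) → ℝ))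
      = z * aeval z (monicPoly q) + k * reverseEval q z := by
  rw [aeval_monicPoly, aeval_monicPoly, Fin.sum_univ_succ, reverseEval]
  simp only [Fin.cons_zero, Fin.cons_succ, Fin.val_zero, Fin.val_succ, schurStep_apply,
    Complex.ofReal_add, Complex.ofReal_mul, add_mul, Finset.sum_add_distrib]
  rw [← sum_rev_pow_succ, mul_add, mul_add, Finset.mul_sum, Finset.mul_sum]
  simp only [mul_assoc]
  have : ∑ i : Fin n, (q i : ℂ) * z ^ ((i : ℕ) + 1) = ∑ i : Fin n, z * ((q i : ℂ) * z ^ (i : ℕ)) :=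
    Finset.sum_congr rfl fun i _ => by ring
  rw [this]
  ring

theorem reverseEval_cons_schurStep (k : ℝ) (q : Fin n → ℝ) (z : ℂ) :
    reverseEval (Fin.cons k (schurStep k q) : Fin (n + 1) → ℝ) z
      = reverseEval q z + k * (z * aeval z (monicPoly q)) := by
  rw [aeval_monicPoly, reverseEval, Fin.sum_univ_succ, reverseEval]
  simp only [Fin.cons_zero, Fin.cons_succ, Fin.val_zero, Fin.val_succ, schurStep_apply,
    Complex.ofReal_add, Complex.ofReal_mul, add_mul, Finset.sum_add_distrib, Nat.add_sub_add_right]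
  simp only [mul_assoc, ← Finset.mul_sum]
  rw [sum_rev_pow_sub]
  have : ∑ i : Fin n, (q i : ℂ) * z ^ ((i : ℕ) + 1) = z * ∑ i : Fin n, ((q i : ℂ) * z ^ (i : ℕ)) := by
    rw [Finset.mul_sum]
    exact Finset.sum_congr rfl fun i _ => by ring
  rw [this, Nat.sub_zero]
  ring

/-- Outside the disk zQ dominates kQ*, so P has no zero there. Conversely, at a zero of Q outside
the disk P = kQ* and P* = Q*; as |P*| ≤ |P| and |k| < 1, Q* vanishes there, and with it P, which is
excluded. -/
theorem cons_schurStep_mem_Omega {k : ℝ} (hk : |k| < 1) (q : Fin n → ℝ) :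
    (Fin.cons k (schurStep k q) : Fin (n + 1) → ℝ) ∈ Omega (n + 1) ↔ q ∈ Omega n := by
  have hkn : ‖(k : ℂ)‖ < 1 := by simpa using hk
  constructor
  · intro h z hz
    by_contra hz1
    push Not at hz1
    have h1 := norm_reverseEval_le h hz1.le
    rw [reverseEval_cons_schurStep, aeval_cons_schurStep, hz, mul_zero, mul_zero, zero_add,
      add_zero, norm_mul] at h1
    have h2 : reverseEval q z = 0 := by
      rw [← norm_eq_zero]
      nlinarith [norm_nonneg (reverseEval q z)]
    have h3 : aeval z (monicPoly (Fin.cons k (schurStep k q) : Fin (n + 1) → ℝ)) = 0 := by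
      rw [aeval_cons_schurStep, hz, h2]
      simp
    exact absurd (h z h3) (not_le.2 hz1)
  · intro h z hz
    by_contra hz1
    push Not at hz1
    have h1 := norm_reverseEval_le h hz1.le
    rw [aeval_cons_schurStep] at hz
    have h2 : aeval z (monicPoly q) ≠ 0 := fun h0 => absurd (h z h0) (not_le.2 hz1)
    have h3 : ‖z‖ * ‖aeval z (monicPoly q)‖ = ‖(k : ℂ)‖ * ‖reverseEval q z‖ := by
      rw [← norm_mul, ← norm_mul, eq_neg_of_add_eq_zero_left hz, norm_neg]
    have h4 : 0 < ‖aeval z (monicPoly q)‖ := norm_pos_iff.2 h2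
    nlinarith [norm_nonneg (reverseEval q z), norm_nonneg (k : ℂ)]

theorem abs_zero_le_of_mem_Omega {a : Fin (n + 1) → ℝ} (ha : a ∈ Omega (n + 1)) : |a 0| ≤ 1 := by
  have h1 : aeval (0 : ℂ) (monicPoly a) = a 0 := by
    rw [aeval_monicPoly, Fin.sum_univ_succ]
    simp
  have h2 : ∀ s : Multiset ℂ, (∀ z ∈ s, ‖z‖ ≤ 1) → ‖(s.map (fun α => 0 - α)).prod‖ ≤ 1 := by
    intro s
    induction s using Multiset.induction_on with
    | empty => simp
    | cons α s ih =>
      intro hs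
      simp only [Multiset.map_cons, Multiset.prod_cons, norm_mul, zero_sub, norm_neg]
      simp only [zero_sub] at ih
      exact mul_le_one₀ (hs α (Multiset.mem_cons_self α s)) (norm_nonneg _)
        (ih fun β hβ => hs β (Multiset.mem_cons_of_mem hβ))
  have h3 := h2 _ (mem_Omega_iff.1 ha)
  rw [← aeval_eq_prod_complexRoots, h1] at h3
  simpa using h3

theorem slice_Omega {k : ℝ} (hk : |k| < 1) :
    {q : Fin n → ℝ | (Fin.cons k q : Fin (n + 1) → ℝ) ∈ Omega (n + 1)}
      = schurStep k '' Omega n := by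
  have hk2 : 1 - k ^ 2 ≠ 0 := by
    have := abs_lt.1 hk
    nlinarith
  ext q
  simp only [Set.mem_ofPred_eq, Set.mem_image]
  constructor
  · intro h
    -- The inverse comes from (1 + kR)(1 - kR) = 1 - k², where R reverses the coordinates.
    have hq : schurStep k (fun i => (q i - k * q i.rev) / (1 - k ^ 2)) = q := by
      funext i
      rw [schurStep_apply, Fin.rev_rev]
      field_simp
      ring
    refine ⟨_, ?_, hq⟩
    rw [← cons_schurStep_mem_Omega hk, hq]
    exact h
  · rintro ⟨q', hq', rfl⟩
    exact (cons_schurStep_mem_Omega hk q').2 hq'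

end SchurCohn

end RootRegion

/-! ### The volume of `Omega N` -/

namespace RootRegion

/-- Pairs consist of an index and its mirror image. -/
def mirrorIndex (m r : ℕ) : (Fin m ⊕ Fin r) ⊕ Fin m → Fin (2 * m + r)
  | .inl (.inl k) => ⟨k, by omega⟩
  | .inl (.inr s) => ⟨m + s, by omega⟩
  | .inr k => ⟨2 * m + r - 1 - k, by omega⟩

theorem mirrorIndex_injective (m r : ℕ) : Function.Injective (mirrorIndex m r) := by
  rintro ((k | s) | k) ((k' | s') | k') h <;> simp only [mirrorIndex, Fin.mk.injEq] at h <;>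
    first
    | (exfalso; omega)
    | (congr 2; ext; omega)

noncomputable def mirrorEquiv (m r : ℕ) : (Fin m ⊕ Fin r) ⊕ Fin m ≃ Fin (2 * m + r) :=
  Equiv.ofBijective (mirrorIndex m r) <|
    (Fintype.bijective_iff_injective_and_card _).2 ⟨mirrorIndex_injective m r, by simp; ring⟩

theorem rev_mirrorEquiv_inl_inl (m r : ℕ) (k : Fin m) :
    (mirrorEquiv m r (.inl (.inl k))).rev = mirrorEquiv m r (.inr k) := by
  ext
  simp [mirrorEquiv, mirrorIndex]
  omega

theorem rev_mirrorEquiv_inr (m r : ℕ) (k : Fin m) :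
    (mirrorEquiv m r (.inr k)).rev = mirrorEquiv m r (.inl (.inl k)) := by
  rw [← rev_mirrorEquiv_inl_inl, Fin.rev_rev]

theorem rev_mirrorEquiv_inl_inr {m r : ℕ} (hr : r ≤ 1) (s : Fin r) :
    (mirrorEquiv m r (.inl (.inr s))).rev = mirrorEquiv m r (.inl (.inr s)) := by
  ext
  simp [mirrorEquiv, mirrorIndex]
  omega

/-- Reversal couples each coordinate with its mirror image: m blocks with rows (1, k) and (k, 1),
and in odd dimension a fixed middle coordinate contributing 1 + k. -/
theorem det_schurStep (m : ℕ) {r : ℕ} (hr : r ≤ 1) (k : ℝ) :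
    LinearMap.det (schurStep (n := 2 * m + r) k) = (1 - k ^ 2) ^ m * (1 + k) ^ r := by
  classical
  rw [← LinearMap.det_toMatrix', ← Matrix.det_reindex_self (mirrorEquiv m r).symm]
  have hM : Matrix.reindex (mirrorEquiv m r).symm (mirrorEquiv m r).symm
      (LinearMap.toMatrix' (schurStep (n := 2 * m + r) k))
      = Matrix.fromBlocks (Matrix.diagonal (Sum.elim (fun _ => 1) (fun _ => 1 + k)))
        (Matrix.of fun x j => if x = .inl j then k else 0)
        (Matrix.of fun j x => if x = .inl j then k else 0) 1 := by
    have hent : ∀ x y, (LinearMap.toMatrix' (schurStep (n := 2 * m + r) k)) x y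
        = (if x = y then 1 else 0) + k * (if x.rev = y then 1 else 0) := by
      intro x y
      rw [LinearMap.toMatrix'_apply, schurStep_apply]
      simp only [Pi.single_apply]
    ext ((x | x) | x) ((y | y) | y) <;>
    simp [hent, rev_mirrorEquiv_inl_inl, rev_mirrorEquiv_inr, rev_mirrorEquiv_inl_inr hr,
      Matrix.diagonal_apply, Matrix.one_apply, eq_comm]
    split_ifs <;> ring
  rw [hM, Matrix.det_fromBlocks_one₂₂]
  have hD : Matrix.diagonal (Sum.elim (fun _ => 1) (fun _ => 1 + k))
      - (Matrix.of fun (x : Fin m ⊕ Fin r) j => if x = .inl j then k else 0)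
        * (Matrix.of fun j (x : Fin m ⊕ Fin r) => if x = .inl j then k else 0)
      = Matrix.diagonal (Sum.elim (fun _ => 1 - k ^ 2) (fun _ => 1 + k)) := by
    ext (x | x) (y | y) <;> simp [Matrix.mul_apply, Matrix.diagonal_apply]
    split_ifs <;> ring
  rw [hD, Matrix.det_diagonal, Fintype.prod_sum_type]
  simp

/-- Integrate the derivative of x(1 - x²)^(m+1), which vanishes at both endpoints. -/
theorem integral_one_sub_sq_pow_succ (m : ℕ) :
    (2 * (m : ℝ) + 3) * ∫ x in (-1 : ℝ)..1, (1 - x ^ 2) ^ (m + 1)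
      = (2 * (m : ℝ) + 2) * ∫ x in (-1 : ℝ)..1, (1 - x ^ 2) ^ m := by
  have h : ∀ x ∈ Set.uIcc (-1 : ℝ) 1, HasDerivAt (fun x : ℝ => x * (1 - x ^ 2) ^ (m + 1))
      ((2 * (m : ℝ) + 3) * (1 - x ^ 2) ^ (m + 1) - (2 * (m : ℝ) + 2) * (1 - x ^ 2) ^ m) x := by
    intro x _
    have h1 := (hasDerivAt_id x).mul (((hasDerivAt_pow 2 x).const_sub 1).pow (m + 1))
    refine h1.congr_deriv ?_
    simp
    ring
  have h2 := intervalIntegral.integral_eq_sub_of_hasDerivAt h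
    (Continuous.intervalIntegrable (by fun_prop) _ _)
  rw [intervalIntegral.integral_sub (Continuous.intervalIntegrable (by fun_prop) _ _)
    (Continuous.intervalIntegrable (by fun_prop) _ _), intervalIntegral.integral_const_mul,
    intervalIntegral.integral_const_mul] at h2
  norm_num at h2
  linarith

theorem factorD_succ (m : ℕ) : (2 * (m : ℝ) + 3) * factorD (m + 1) = (2 * (m : ℝ) + 2) * factorD m := by
  have h1 : ((2 * (m + 1) + 1).factorial : ℝ) = (2 * m + 3) * ((2 * m + 2) * (2 * m + 1).factorial) := by
    rw [show 2 * (m + 1) + 1 = (2 * m + 1 + 1) + 1 by ring, Nat.factorial_succ, Nat.factorial_succ]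
    push_cast
    ring
  have h2 : ((2 * m + 1).factorial : ℝ) ≠ 0 := by positivity
  rw [factorD, factorD, h1, Nat.factorial_succ]
  push_cast
  field_simp
  ring

theorem factorD_pos (m : ℕ) : 0 < factorD m := by
  unfold factorD
  positivity

theorem integral_one_sub_sq_pow (m : ℕ) :
    ∫ x in (-1 : ℝ)..1, (1 - x ^ 2) ^ m = factorD m := by
  induction m with
  | zero => norm_num [factorD]
  | succ m ih =>
    have h1 := integral_one_sub_sq_pow_succ m
    rw [ih, ← factorD_succ] at h1
    exact mul_left_cancel₀ (by positivity) h1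

/-- The additional summand for r = 1 is odd in x, so both parities give the same value; this is why
each factor enters `D` twice. -/
theorem integral_jacobian_schurStep (m : ℕ) {r : ℕ} (hr : r ≤ 1) :
    ∫ x in (-1 : ℝ)..1, (1 - x ^ 2) ^ m * (1 + x) ^ r = factorD m := by
  interval_cases r
  · simpa using integral_one_sub_sq_pow m
  · have h : ∀ x ∈ Set.uIcc (-1 : ℝ) 1, HasDerivAt
        (fun x : ℝ => -(1 - x ^ 2) ^ (m + 1) / (2 * (m + 1))) ((1 - x ^ 2) ^ m * x) x := by
      intro x _
      have h1 := ((((hasDerivAt_pow 2 x).const_sub 1).pow (m + 1)).neg).div_const (2 * ((m : ℝ) + 1))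
      refine h1.congr_deriv ?_
      simp
      field_simp
    have h2 := intervalIntegral.integral_eq_sub_of_hasDerivAt h
      (Continuous.intervalIntegrable (by fun_prop) _ _)
    simp only [pow_one, mul_add, mul_one]
    rw [intervalIntegral.integral_add (Continuous.intervalIntegrable (by fun_prop) _ _)
      (Continuous.intervalIntegrable (by fun_prop) _ _), h2, integral_one_sub_sq_pow]
    norm_num

theorem volume_Omega_succ (m : ℕ) {r : ℕ} (hr : r ≤ 1) :
    volume (Omega (2 * m + r + 1)) = ENNReal.ofReal (factorD m) * volume (Omega (2 * m + r)) := by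
  have hmp := (volume_preserving_piFinSuccAbove (fun _ : Fin (2 * m + r + 1) => ℝ) 0).symm
  rw [← hmp.measure_preimage (measurableSet_Omega _).nullMeasurableSet]
  have hmeas := hmp.measurable (measurableSet_Omega (2 * m + r + 1))
  rw [Measure.volume_eq_prod, Measure.prod_apply hmeas]
  have hslice : ∀ᵐ k : ℝ, volume (Prod.mk k ⁻¹'
      ((MeasurableEquiv.piFinSuccAbove (fun _ : Fin (2 * m + r + 1) => ℝ) 0).symm ⁻¹'
        Omega (2 * m + r + 1)))
      = (Set.Ioc (-1 : ℝ) 1).indicator (fun k => ENNReal.ofReal ((1 - k ^ 2) ^ m * (1 + k) ^ r)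
        * volume (Omega (2 * m + r))) k := by
    -- At k = ±1 the description of the slice by the Schur step breaks down; these two values are
    -- negligible.
    have hne : ∀ᵐ k : ℝ, k ≠ 1 ∧ k ≠ -1 := by
      rw [eventually_and]
      exact ⟨by simp [ae_iff, measure_singleton], by simp [ae_iff, measure_singleton]⟩
    filter_upwards [hne] with k hk
    have hs : Prod.mk k ⁻¹' ((MeasurableEquiv.piFinSuccAbove
        (fun _ : Fin (2 * m + r + 1) => ℝ) 0).symm ⁻¹' Omega (2 * m + r + 1))
        = {q : Fin (2 * m + r) → ℝ | (Fin.cons k q : Fin (2 * m + r + 1) → ℝ) ∈ Omega _} := by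
      ext q
      simp only [MeasurableEquiv.piFinSuccAbove, Fin.insertNthEquiv_zero]
      rfl
    rw [hs]
    by_cases hk1 : k ∈ Set.Ioc (-1 : ℝ) 1
    · have hk2 : |k| < 1 := abs_lt.2 ⟨hk1.1, lt_of_le_of_ne hk1.2 hk.1⟩
      rw [Set.indicator_of_mem hk1, slice_Omega hk2, Measure.addHaar_image_linearMap,
        det_schurStep m hr, abs_of_nonneg]
      have := hk1.1
      have := hk1.2
      have : 0 ≤ 1 - k ^ 2 := by nlinarith
      have : 0 ≤ 1 + k := by linarith
      positivity
    · rw [Set.indicator_of_notMem hk1]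
      convert measure_empty (μ := volume)
      ext q
      simp only [Set.mem_ofPred_eq, Set.mem_empty_iff_false, iff_false]
      intro h
      have := abs_le.1 (abs_zero_le_of_mem_Omega h)
      simp only [Fin.cons_zero] at this
      exact hk1 ⟨lt_of_le_of_ne this.1 hk.2.symm, this.2⟩
  rw [lintegral_congr_ae hslice, lintegral_indicator measurableSet_Ioc, lintegral_mul_const]
  · congr 1
    rw [← ofReal_integral_eq_lintegral_ofReal, ← intervalIntegral.integral_of_le (by norm_num),
      integral_jacobian_schurStep m hr]
    · exact (Continuous.integrableOn_Icc (by fun_prop)).mono_set Set.Ioc_subset_Icc_self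
    · refine (ae_restrict_iff' measurableSet_Ioc).2 (Eventually.of_forall fun x hx => ?_)
      have := hx.1
      have := hx.2
      have : 0 ≤ 1 - x ^ 2 := by nlinarith
      have : 0 ≤ 1 + x := by linarith
      simp only [Pi.zero_apply]
      positivity
  · fun_prop

theorem D_pos (N : ℕ) : 0 < D N := by
  unfold D
  refine mul_pos ?_ (Finset.prod_pos fun k _ => pow_pos (factorD_pos k) 2)
  split_ifs
  · exact one_pos
  · exact factorD_pos _

theorem D_two_mul (m : ℕ) : D (2 * m) = ∏ k ∈ Finset.range m, factorD k ^ 2 := by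
  simp [D]

theorem D_two_mul_add_one (m : ℕ) : D (2 * m + 1) = factorD m * D (2 * m) := by
  rw [D_two_mul]
  have h : (2 * m + 1) / 2 = m := by omega
  simp [D, h]

theorem D_two_mul_add_two (m : ℕ) : D (2 * m + 2) = factorD m * D (2 * m + 1) := by
  rw [D_two_mul_add_one, D_two_mul, show 2 * m + 2 = 2 * (m + 1) by ring, D_two_mul,
    Finset.prod_range_succ]
  ring

theorem volume_Omega (N : ℕ) : volume (Omega N) = ENNReal.ofReal (D N) := by
  induction N with
  | zero =>
    have : Omega 0 = Set.univ := by
      ext a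
      simp [Omega, aeval_monicPoly]
    rw [this, volume_pi, Measure.pi_of_empty]
    simp [D]
  | succ n ih =>
    rcases Nat.even_or_odd' n with ⟨m, rfl | rfl⟩
    · have := volume_Omega_succ m (r := 0) (by norm_num)
      rw [add_zero] at this
      rw [this, ih, D_two_mul_add_one, ENNReal.ofReal_mul (factorD_pos m).le]
    · rw [volume_Omega_succ m (r := 1) le_rfl, ih, D_two_mul_add_two,
        ENNReal.ofReal_mul (factorD_pos m).le]

theorem prob_eq_of_volume_inter {N : ℕ} {E : Set (Fin N → ℝ)} {v : ℝ} (hv : 0 ≤ v)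
    (h : volume (Omega N ∩ E) = ENNReal.ofReal v) : prob N E = v / D N := by
  rw [prob, Measure.real, ProbabilityTheory.cond_apply (measurableSet_Omega N), h, volume_Omega,
    ENNReal.toReal_mul, ENNReal.toReal_inv, ENNReal.toReal_ofReal hv,
    ENNReal.toReal_ofReal (D_pos N).le]
  field_simp

end RootRegion

/-! ### Change of variables from roots to coefficients -/

namespace RootRegion

open Polynomial

section ChangeOfVariables

/-- A continuous nonvanishing function on a preconnected set whose values lie on one real line
through the origin has constant argument. -/
theorem exists_phase {X : Type*} [TopologicalSpace X] {T : Set X} (hT : IsPreconnected T)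
    {F : X → ℂ} (hF : ContinuousOn F T) (h0 : ∀ x ∈ T, F x ≠ 0) {c : ℂ}
    (hc : ∀ x ∈ T, starRingEnd ℂ (F x) = c * F x) :
    ∃ ω : ℂ, ‖ω‖ = 1 ∧ ∀ x ∈ T, (‖F x‖ : ℂ) = ω * F x := by
  rcases T.eq_empty_or_nonempty with rfl | ⟨y, hy⟩
  · exact ⟨1, by simp, by simp⟩
  have hy0 := h0 y hy
  have hreal : ∀ x ∈ T, (((F x / F y).re : ℝ) : ℂ) = F x / F y := by
    intro x hx
    rw [← Complex.conj_eq_iff_re, map_div₀, hc x hx, hc y hy]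
    have hc0 : c ≠ 0 := by
      rintro rfl
      have := hc y hy
      rw [zero_mul] at this
      exact hy0 ((map_eq_zero _).1 this)
    field_simp
  have hpos : ∀ x ∈ T, 0 < (F x / F y).re := by
    intro x hx
    by_contra hneg
    push Not at hneg
    have hcont : ContinuousOn (fun x => (F x / F y).re) T :=
      Complex.continuous_re.comp_continuousOn (hF.div_const _)
    have h1 : (0 : ℝ) ∈ Set.Icc (F x / F y).re (F y / F y).re :=
      ⟨hneg, by rw [div_self hy0]; norm_num⟩
    obtain ⟨z, hz, hz0⟩ := hT.intermediate_value hx hy hcont h1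
    have h2 := hreal z hz
    simp only at hz0
    rw [hz0] at h2
    exact h0 z hz ((div_eq_zero_iff.1 h2.symm).resolve_right hy0)
  have hn : (‖F y‖ : ℂ) ≠ 0 := by
    exact_mod_cast (norm_pos_iff.2 hy0).ne'
  refine ⟨‖F y‖ / F y, ?_, fun x hx => ?_⟩
  · rw [norm_div, Complex.norm_real, norm_norm, div_self (norm_pos_iff.2 hy0).ne']
  · have h1 : F x = ((F x / F y).re : ℝ) * F y := by
      rw [hreal x hx]
      field_simp
    have h2 : ‖F x‖ = (F x / F y).re * ‖F y‖ := by
      conv_lhs => rw [h1, norm_mul, Complex.norm_real, Real.norm_of_nonneg (hpos x hx).le]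
    rw [h2]
    push_cast
    rw [hreal x hx]
    field_simp

theorem volume_image_comp {ι : Type*} [Fintype ι] {N : ℕ} (e : ι ≃ Fin N) (S : Set (Fin N → ℝ)) :
    volume ((fun w : Fin N → ℝ => w ∘ e) '' S) = volume S := by
  have h := volume_preserving_arrowCongr' e (MeasurableEquiv.refl ℝ) (MeasurePreserving.id volume)
  have h2 : ((fun w : Fin N → ℝ => w ∘ e) '' S)
      = (MeasurableEquiv.arrowCongr' e (MeasurableEquiv.refl ℝ)) ⁻¹' S := by
    ext w
    simp only [Set.mem_image, Set.mem_preimage]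
    constructor
    · rintro ⟨v, hv, rfl⟩
      convert hv
      ext i
      simp [MeasurableEquiv.arrowCongr', Equiv.arrowCongr']
    · intro hw
      refine ⟨_, hw, ?_⟩
      ext i
      simp [MeasurableEquiv.arrowCongr', Equiv.arrowCongr']
  rw [h2, h.measure_preimage_equiv]

/-- Reading off the coefficients of a family of polynomials. -/
def coeffVec (N : ℕ) {X : Type*} (Pol : X → ℝ[X]) (x : X) : Fin N → ℝ := fun i => (Pol x).coeff i

/-- Used to discard parameter vectors with coinciding coordinates. -/
theorem volume_image_coeffVec_eq_zero {ι : Type*} [Fintype ι] {N : ℕ} (e : ι ≃ Fin N) {Pol : (ι → ℝ) → ℝ[X]}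
    (hdiff : ∀ k, Differentiable ℝ fun x => (Pol x).coeff k) {S : Set (ι → ℝ)}
    (hS : volume S = 0) : volume (coeffVec N Pol '' S) = 0 := by
  rw [← volume_image_comp e, Set.image_image]
  refine addHaar_image_eq_zero_of_differentiableOn_of_addHaar_eq_zero _ ?_ hS
  exact (differentiable_pi.2 fun j => hdiff (e j)).differentiableOn

variable {ι : Type*} [Fintype ι] [DecidableEq ι] {N : ℕ}

/-- The Vandermonde determinant of the points `t p`, the exponents being enumerated by `e`. -/
noncomputable def vandermondeDet (e : ι ≃ Fin N) (t : ι → ℂ) : ℂ :=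
  (Matrix.of fun p j => t p ^ (e j : ℕ)).det

theorem vandermondeDet_eq (e : ι ≃ Fin N) (t : ι → ℂ) :
    vandermondeDet e t = (Matrix.vandermonde (t ∘ e.symm)).det := by
  rw [vandermondeDet, ← Matrix.det_reindex_self e]
  congr 1
  ext i j
  simp [Matrix.vandermonde_apply]

theorem vandermondeDet_ne_zero (e : ι ≃ Fin N) {t : ι → ℂ} (ht : Function.Injective t) :
    vandermondeDet e t ≠ 0 := by
  rw [vandermondeDet_eq, Matrix.det_vandermonde_ne_zero_iff]
  exact ht.comp e.symm.injective

/-- The right side is the product of |P'| over the roots of P, which is what differentiating the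
coefficients produces. -/
theorem norm_vandermondeDet_sq (e : ι ≃ Fin N) (t : ι → ℂ) :
    ‖vandermondeDet e t‖ ^ 2 = ∏ p, ∏ q ∈ Finset.univ.erase p, ‖t p - t q‖ := by
  rw [vandermondeDet_eq, Matrix.det_vandermonde, norm_prod, sq, ← Finset.prod_mul_distrib]
  have h1 : ∀ i : Fin N, ‖∏ j ∈ Finset.Ioi i, ((t ∘ e.symm) j - (t ∘ e.symm) i)‖
      * ‖∏ j ∈ Finset.Ioi i, ((t ∘ e.symm) j - (t ∘ e.symm) i)‖
      = ∏ j ∈ Finset.Ioi i, ‖(t ∘ e.symm) i - (t ∘ e.symm) j‖ * ‖(t ∘ e.symm) j - (t ∘ e.symm) i‖ := by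
    intro i
    rw [norm_prod, ← Finset.prod_mul_distrib]
    exact Finset.prod_congr rfl fun j _ => by rw [norm_sub_rev ((t ∘ e.symm) i)]
  simp only [h1]
  rw [Finset.prod_prod_Ioi_mul_eq_prod_prod_off_diag
    (f := fun j i => ‖(t ∘ e.symm) i - (t ∘ e.symm) j‖), ← e.prod_comp]
  refine Finset.prod_congr rfl fun p _ => ?_
  refine (Finset.prod_equiv e (fun q => ?_) fun q _ => by simp).symm
  simp [e.injective.eq_iff]

/-- The Jacobian of the passage from roots to coefficients, for roots depending linearly on real
parameters. -/
theorem abs_det_fderiv_coeff (e : ι ≃ Fin N) (W : (ι → ℝ) →L[ℝ] (ι → ℂ))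
    {Φ : (ι → ℝ) → ι → ℝ} {x : ι → ℝ} {L : (ι → ℝ) →L[ℝ] (ι → ℝ)} (hL : HasFDerivAt Φ L x)
    (hΦ : ∀ y, ∀ z : ℂ, z ^ N + ∑ j, (Φ y j : ℂ) * z ^ (e j : ℕ) = ∏ p, (z - W y p))
    (hinj : Function.Injective (W x)) :
    |L.det| = ‖(Matrix.of fun p q => W (Pi.single q 1) p).det‖ * ‖vandermondeDet e (W x)‖ := by
  -- Differentiate the factorization with z held fixed at the root `W x p`: every term of the
  -- product rule that retains the vanishing factor drops out. In matrix form this reads VL =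
  -- -diag(∏ (t p - t q))W, and the diagonal matrix has determinant of modulus |det V|².
  have hrow : ∀ p h, ∑ j, W x p ^ (e j : ℕ) * (L h j : ℂ)
      = -(∏ q ∈ Finset.univ.erase p, (W x p - W x q)) * W h p := by
    intro p h
    set z := W x p with hz
    have h1 : HasFDerivAt (fun y => z ^ N + ∑ j, (Φ y j : ℂ) * z ^ (e j : ℕ))
        (∑ j, (z ^ (e j : ℕ)) • (Complex.ofRealCLM.comp ((ContinuousLinearMap.proj j).comp L))) x := by
      refine HasFDerivAt.const_add _ (HasFDerivAt.fun_sum fun j _ => ?_)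
      refine HasFDerivAt.mul_const ?_ _
      exact Complex.ofRealCLM.hasFDerivAt.comp x (hasFDerivAt_pi'.1 hL j)
    have hW : ∀ q, HasFDerivAt (fun y => W y q) ((ContinuousLinearMap.proj q).comp W) x := fun q =>
      ((ContinuousLinearMap.proj q).comp W).hasFDerivAt
    have hd : DifferentiableAt ℝ (fun y => ∏ q ∈ Finset.univ.erase p, (z - W y q)) x :=
      (HasFDerivAt.finsetProd fun q _ => (hW q).const_sub z).differentiableAt
    have h2 := ((hW p).const_sub z).mul hd.hasFDerivAt
    have h3 : (fun y => z ^ N + ∑ j, (Φ y j : ℂ) * z ^ (e j : ℕ))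
        = fun y => (z - W y p) * ∏ q ∈ Finset.univ.erase p, (z - W y q) := by
      funext y
      rw [hΦ, Finset.mul_prod_erase _ (fun q => z - W y q) (Finset.mem_univ p)]
    rw [h3] at h1
    have h4 := congrArg (fun A => A h) (h1.unique h2)
    simp only [← hz, sub_self] at h4
    simpa using h4
  have hmat : (Matrix.of fun p j => W x p ^ (e j : ℕ))
      * (LinearMap.toMatrix' (L : (ι → ℝ) →ₗ[ℝ] (ι → ℝ))).map (algebraMap ℝ ℂ)
      = Matrix.diagonal (fun p => -(∏ q ∈ Finset.univ.erase p, (W x p - W x q)))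
        * (Matrix.of fun p q => W (Pi.single q 1) p) := by
    ext p s
    rw [Matrix.diagonal_mul, Matrix.mul_apply]
    simp only [Matrix.of_apply, Matrix.map_apply, LinearMap.toMatrix'_apply]
    exact hrow p _
  have hdet := congrArg (fun A => ‖Matrix.det A‖) hmat
  simp only [Matrix.det_mul, norm_mul, Matrix.det_diagonal, norm_prod, norm_neg] at hdet
  rw [← norm_vandermondeDet_sq e] at hdet
  have h5 : ‖((LinearMap.toMatrix' (L : (ι → ℝ) →ₗ[ℝ] (ι → ℝ))).map (algebraMap ℝ ℂ)).det‖
      = |L.det| := by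
    rw [← RingHom.mapMatrix_apply, ← RingHom.map_det, LinearMap.det_toMatrix']
    simp [ContinuousLinearMap.det]
  rw [h5, ← vandermondeDet] at hdet
  have h6 : 0 < ‖vandermondeDet e (W x)‖ := norm_pos_iff.2 (vandermondeDet_ne_zero e hinj)
  have h7 : ‖vandermondeDet e (W x)‖ * |L.det| = ‖vandermondeDet e (W x)‖ *
      (‖(Matrix.of fun p q => W (Pi.single q 1) p).det‖ * ‖vandermondeDet e (W x)‖) := by
    rw [hdet]; ring
  exact mul_left_cancel₀ h6.ne' h7

/-- The volume of a set of coefficient vectors parametrized by the roots. -/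
theorem volume_image_coeffVec (e : ι ≃ Fin N) (W : (ι → ℝ) →L[ℝ] (ι → ℂ))
    {Pol : (ι → ℝ) → ℝ[X]} (hdiff : ∀ k, Differentiable ℝ fun x => (Pol x).coeff k)
    (hmap : ∀ x, (Pol x).map (algebraMap ℝ ℂ) = ∏ p, (X - C (W x p)))
    {T : Set (ι → ℝ)} (hTm : MeasurableSet T) (hTc : Convex ℝ T) (hTb : Bornology.IsBounded T)
    (hinj : Set.InjOn Pol T) (hWinj : ∀ x ∈ T, Function.Injective (W x)) {c : ℂ}
    (hc : ∀ x, starRingEnd ℂ (vandermondeDet e (W x)) = c * vandermondeDet e (W x)) :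
    volume (coeffVec N Pol '' T) = ENNReal.ofReal
      (‖(Matrix.of fun p q => W (Pi.single q 1) p).det‖ *
        ‖∫ x in T, vandermondeDet e (W x)‖) := by
  have hmon : ∀ x, (Pol x).Monic := by
    intro x
    have h : ((Pol x).map (algebraMap ℝ ℂ)).Monic := by
      rw [hmap]
      exact monic_prod_of_monic _ _ fun p _ => monic_X_sub_C _
    exact Polynomial.monic_of_injective (algebraMap ℝ ℂ).injective h
  have hcard : Fintype.card ι = N := by
    rw [Fintype.card_congr e, Fintype.card_fin]
  have hdeg : ∀ x, (Pol x).natDegree = N := by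
    intro x
    rw [← (hmon x).natDegree_map (algebraMap ℝ ℂ), hmap, natDegree_finsetProd_X_sub_C_eq_card,
      Finset.card_univ, hcard]
  have hpoly : ∀ x, monicPoly (coeffVec N Pol x) = Pol x := fun x =>
    monicPoly_coeff (hmon x) (hdeg x)
  set Φ : (ι → ℝ) → ι → ℝ := fun x j => (Pol x).coeff (e j) with hΦdef
  have hΦd : Differentiable ℝ Φ := differentiable_pi.2 fun j => hdiff (e j)
  have hΦ : ∀ y, ∀ z : ℂ, z ^ N + ∑ j, (Φ y j : ℂ) * z ^ (e j : ℕ) = ∏ p, (z - W y p) := by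
    intro y z
    have h1 : aeval z (monicPoly (coeffVec N Pol y)) = ∏ p, (z - W y p) := by
      rw [hpoly, ← eval_map_algebraMap, hmap, eval_prod]
      simp
    rw [← h1, aeval_monicPoly, ← e.sum_comp]
    rfl
  rw [← volume_image_comp e, Set.image_image]
  change volume (Φ '' T) = _
  have hΦinj : Set.InjOn Φ T := by
    intro x hx y hy hxy
    apply hinj hx hy
    rw [← hpoly x, ← hpoly y]
    congr 1
    funext i
    have := congrFun hxy (e.symm i)
    simpa [hΦdef, coeffVec] using this
  rw [← lintegral_abs_det_fderiv_eq_addHaar_image volume hTm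
    (fun x _ => (hΦd x).hasFDerivAt.hasFDerivWithinAt) hΦinj]
  have hFcont : Continuous fun x => vandermondeDet e (W x) := by
    unfold vandermondeDet
    fun_prop
  -- On the convex set `T` the Vandermonde determinant has no zero and is a fixed multiple of its
  -- conjugate, so its argument is constant and the norm can be moved outside the integral.
  obtain ⟨ω, hω, hphase⟩ := exists_phase hTc.isPreconnected hFcont.continuousOn
    (fun x hx => vandermondeDet_ne_zero e (hWinj x hx)) fun x _ => hc x
  have hint : IntegrableOn (fun x => vandermondeDet e (W x)) T :=
    (hFcont.continuousOn.integrableOn_compact hTb.isCompact_closure).mono_set subset_closure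
  rw [setLIntegral_congr_fun hTm (fun x hx => by
    rw [abs_det_fderiv_coeff e W (hΦd x).hasFDerivAt hΦ (hWinj x hx)]),
    ← ofReal_integral_eq_lintegral_ofReal (hint.norm.const_mul _)
      (Eventually.of_forall fun x => by positivity), integral_const_mul]
  congr 2
  have h1 : ((∫ x in T, ‖vandermondeDet e (W x)‖ : ℝ) : ℂ)
      = ω * ∫ x in T, vandermondeDet e (W x) := by
    rw [← integral_const_mul, ← integral_complex_ofReal]
    exact setIntegral_congr_fun hTm hphase
  have h2 := congrArg norm h1
  rwa [norm_mul, hω, one_mul, Complex.norm_real, Real.norm_of_nonneg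
    (integral_nonneg fun x => norm_nonneg _)] at h2

end ChangeOfVariables

end RootRegion

/-! ### Integrals of Vandermonde determinants with paired nodes -/

namespace RootRegion

open Equiv Equiv.Perm

section Factorization

variable {κ ρ : Type*} [Fintype κ] [Fintype ρ]

/-- Grouping the coordinates into pairs and singletons. -/
def pairEquiv (κ ρ : Type*) : ((κ → ℝ × ℝ) × (ρ → ℝ)) ≃ᵐ ((κ ⊕ ρ) ⊕ κ → ℝ) where
  toFun w := Sum.elim (Sum.elim (fun k => (w.1 k).1) w.2) (fun k => (w.1 k).2)
  invFun x := (fun k => (x (.inl (.inl k)), x (.inr k)), fun r => x (.inl (.inr r)))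
  left_inv w := rfl
  right_inv x := by
    funext p
    rcases p with (k | r) | k <;> rfl
  measurable_toFun := by
    refine measurable_pi_iff.2 ?_
    rintro ((k | r) | k)
    · exact ((measurable_pi_apply k).comp measurable_fst).fst
    · exact (measurable_pi_apply r).comp measurable_snd
    · exact ((measurable_pi_apply k).comp measurable_fst).snd
  measurable_invFun := by
    refine Measurable.prodMk (measurable_pi_iff.2 fun k => ?_) (measurable_pi_iff.2 fun r => ?_)
    · exact (measurable_pi_apply _).prodMk (measurable_pi_apply _)
    · exact measurable_pi_apply _

theorem measurePreserving_pairEquiv :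
    MeasurePreserving (pairEquiv κ ρ) volume volume := by
  refine ⟨(pairEquiv κ ρ).measurable, ?_⟩
  rw [volume_pi]
  symm
  refine Measure.pi_eq fun s hs => ?_
  rw [(pairEquiv κ ρ).map_apply]
  have h : pairEquiv κ ρ ⁻¹' Set.univ.pi s
      = (Set.univ.pi fun k => s (.inl (.inl k)) ×ˢ s (.inr k))
        ×ˢ (Set.univ.pi fun r => s (.inl (.inr r))) := by
    ext w
    simp only [Set.mem_preimage, Set.mem_pi, Set.mem_univ, forall_true_left, Set.mem_prod,
      Sum.forall]
    constructor
    · rintro ⟨⟨h1, h2⟩, h3⟩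
      exact ⟨fun k => ⟨h1 k, h3 k⟩, h2⟩
    · rintro ⟨h1, h2⟩
      exact ⟨⟨fun k => (h1 k).1, h2⟩, fun k => (h1 k).2⟩
  rw [h, Measure.volume_eq_prod, Measure.prod_prod, volume_pi_pi, volume_pi_pi,
    Fintype.prod_sum_type, Fintype.prod_sum_type]
  simp only [Measure.volume_eq_prod, Measure.prod_prod, Finset.prod_mul_distrib]
  ring

theorem integral_pair_prod (g : κ → ℝ × ℝ → ℂ) (h : ρ → ℝ → ℂ) :
    ∫ x : (κ ⊕ ρ) ⊕ κ → ℝ, (∏ k, g k (x (.inl (.inl k)), x (.inr k))) * ∏ r, h r (x (.inl (.inr r)))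
      = (∏ k, ∫ p, g k p) * ∏ r, ∫ y, h r y := by
  rw [← measurePreserving_pairEquiv.integral_comp (pairEquiv κ ρ).measurableEmbedding]
  change ∫ w : (κ → ℝ × ℝ) × (ρ → ℝ), (∏ k, g k (w.1 k)) * ∏ r, h r (w.2 r) = _
  rw [Measure.volume_eq_prod, integral_prod_mul (fun w : κ → ℝ × ℝ => ∏ k, g k (w k))
    (fun w : ρ → ℝ => ∏ r, h r (w r)), integral_fintype_prod_volume_eq_prod,
    integral_fintype_prod_volume_eq_prod]

theorem integrable_pair_prod {g : κ → ℝ × ℝ → ℂ} {h : ρ → ℝ → ℂ} (hg : ∀ k, Integrable (g k))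
    (hh : ∀ r, Integrable (h r)) : Integrable fun x : (κ ⊕ ρ) ⊕ κ → ℝ =>
      (∏ k, g k (x (.inl (.inl k)), x (.inr k))) * ∏ r, h r (x (.inl (.inr r))) := by
  rw [← measurePreserving_pairEquiv.integrable_comp_emb (pairEquiv κ ρ).measurableEmbedding]
  exact (Integrable.fintype_prod hg).mul_prod (Integrable.fintype_prod hh)

variable [DecidableEq κ] [DecidableEq ρ]

/-- Expanding over permutations makes each term a product of functions of separate pairs and
singletons, so that its integral factorizes. -/
theorem vandermondeDet_mul_weight {N : ℕ} (e : (κ ⊕ ρ) ⊕ κ ≃ Fin N)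
    {t : ((κ ⊕ ρ) ⊕ κ → ℝ) → (κ ⊕ ρ) ⊕ κ → ℂ} {α β : ℝ × ℝ → ℂ} {γ : ℝ → ℂ}
    (hα : ∀ x k, t x (.inl (.inl k)) = α (x (.inl (.inl k)), x (.inr k)))
    (hβ : ∀ x k, t x (.inr k) = β (x (.inl (.inl k)), x (.inr k)))
    (hγ : ∀ x r, t x (.inl (.inr r)) = γ (x (.inl (.inr r)))) (χ : ℝ × ℝ → ℂ) (η : ℝ → ℂ)
    (x : (κ ⊕ ρ) ⊕ κ → ℝ) :
    vandermondeDet e (t x) *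
        ((∏ k, χ (x (.inl (.inl k)), x (.inr k))) * ∏ r, η (x (.inl (.inr r))))
      = ∑ σ : Perm ((κ ⊕ ρ) ⊕ κ), ((sign σ : ℤ) : ℂ) *
        ((∏ k, (fun p => χ p * (α p ^ (e (σ (.inl (.inl k))) : ℕ) * β p ^ (e (σ (.inr k)) : ℕ)))
          (x (.inl (.inl k)), x (.inr k)))
        * ∏ r, (fun y => η y * γ y ^ (e (σ (.inl (.inr r))) : ℕ)) (x (.inl (.inr r)))) := by
  rw [vandermondeDet, ← Matrix.det_transpose, Matrix.det_apply', Finset.sum_mul]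
  refine Finset.sum_congr rfl fun σ _ => ?_
  rw [Fintype.prod_sum_type, Fintype.prod_sum_type]
  simp only [Matrix.transpose_apply, Matrix.of_apply, hα, hβ, hγ, Finset.prod_mul_distrib]
  ring

theorem integrable_vandermondeDet_pair {N : ℕ} (e : (κ ⊕ ρ) ⊕ κ ≃ Fin N)
    {t : ((κ ⊕ ρ) ⊕ κ → ℝ) → (κ ⊕ ρ) ⊕ κ → ℂ} {α β χ : ℝ × ℝ → ℂ} {γ η : ℝ → ℂ}
    (hα : ∀ x k, t x (.inl (.inl k)) = α (x (.inl (.inl k)), x (.inr k)))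
    (hβ : ∀ x k, t x (.inr k) = β (x (.inl (.inl k)), x (.inr k)))
    (hγ : ∀ x r, t x (.inl (.inr r)) = γ (x (.inl (.inr r))))
    (hχ : ∀ i j : ℕ, Integrable fun p => χ p * (α p ^ i * β p ^ j))
    (hη : ∀ i : ℕ, Integrable fun y => η y * γ y ^ i) :
    Integrable fun x : (κ ⊕ ρ) ⊕ κ → ℝ => vandermondeDet e (t x) *
        ((∏ k, χ (x (.inl (.inl k)), x (.inr k))) * ∏ r, η (x (.inl (.inr r)))) := by
  simp only [vandermondeDet_mul_weight e hα hβ hγ]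
  exact integrable_finsetSum _ fun σ _ =>
    (integrable_pair_prod (fun k => hχ _ _) (fun r => hη _)).const_mul _

/-- Integrating a Vandermonde determinant whose nodes come in pairs against a product weight. -/
theorem integral_vandermondeDet_pair {N : ℕ} (e : (κ ⊕ ρ) ⊕ κ ≃ Fin N)
    {t : ((κ ⊕ ρ) ⊕ κ → ℝ) → (κ ⊕ ρ) ⊕ κ → ℂ} {α β χ : ℝ × ℝ → ℂ} {γ η : ℝ → ℂ}
    (hα : ∀ x k, t x (.inl (.inl k)) = α (x (.inl (.inl k)), x (.inr k)))
    (hβ : ∀ x k, t x (.inr k) = β (x (.inl (.inl k)), x (.inr k)))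
    (hγ : ∀ x r, t x (.inl (.inr r)) = γ (x (.inl (.inr r))))
    (hχ : ∀ i j : ℕ, Integrable fun p => χ p * (α p ^ i * β p ^ j))
    (hη : ∀ i : ℕ, Integrable fun y => η y * γ y ^ i) :
    ∫ x : (κ ⊕ ρ) ⊕ κ → ℝ, vandermondeDet e (t x) *
        ((∏ k, χ (x (.inl (.inl k)), x (.inr k))) * ∏ r, η (x (.inl (.inr r))))
      = pairSum (fun _ : κ => fun x y => ∫ p, χ p * (α p ^ (e x : ℕ) * β p ^ (e y : ℕ)))
        (fun _ : ρ => fun x => ∫ y, η y * γ y ^ (e x : ℕ)) := by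
  simp only [vandermondeDet_mul_weight e hα hβ hγ]
  rw [integral_finsetSum, pairSum]
  · refine Finset.sum_congr rfl fun σ _ => ?_
    rw [integral_const_mul, integral_pair_prod
      (fun k p => χ p * (α p ^ (e (σ (.inl (.inl k))) : ℕ) * β p ^ (e (σ (.inr k)) : ℕ)))
      (fun r y => η y * γ y ^ (e (σ (.inl (.inr r))) : ℕ))]
  · intro σ _
    exact (integrable_pair_prod (fun k => hχ _ _) (fun r => hη _)).const_mul _

end Factorization

/-! ### Symmetrization over chambers -/

section Symmetrization

/-- Unfolding an integral along a fundamental domain of a finite family of symmetries. -/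
theorem integral_eq_sum_fundamental {X G : Type*} [MeasurableSpace X] {μ : Measure X} [Fintype G]
    (a : G → X ≃ᵐ X) (ha : ∀ g, MeasurePreserving (a g) μ μ) {T : Set X} (hT : MeasurableSet T)
    (huniq : ∀ᵐ x ∂μ, ∃! g, a g x ∈ T) {f : X → ℂ} (hf : Integrable f μ) :
    ∫ x, f x ∂μ = ∑ g, ∫ x in T, f ((a g).symm x) ∂μ := by
  classical
  have h1 : ∀ᵐ x ∂μ, f x = ∑ g, (a g ⁻¹' T).indicator f x := by
    filter_upwards [huniq] with x hx
    obtain ⟨g, hg, hu⟩ := hx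
    rw [Finset.sum_eq_single g]
    · rw [Set.indicator_of_mem (show x ∈ a g ⁻¹' T from hg)]
    · intro g' _ hne
      rw [Set.indicator_of_notMem]
      intro h
      exact hne (hu g' h)
    · simp
  rw [integral_congr_ae h1, integral_finsetSum]
  · refine Finset.sum_congr rfl fun g _ => ?_
    rw [integral_indicator ((a g).measurable hT)]
    have := (ha g).setIntegral_preimage_emb (a g).measurableEmbedding
      (fun x => f ((a g).symm x)) T
    simpa only [MeasurableEquiv.symm_apply_apply] using this
  · intro g _
    exact hf.indicator ((a g).measurable hT)

theorem volume_setOf_apply_eq {ι : Type*} [Fintype ι] {p q : ι} (h : p ≠ q) :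
    volume {x : ι → ℝ | x p = x q} = 0 := by
  classical
  have h1 : {x : ι → ℝ | x p = x q}
      = (LinearMap.ker (LinearMap.proj (R := ℝ) (φ := fun _ : ι => ℝ) p - LinearMap.proj q) :
        Set (ι → ℝ)) := by
    ext x
    simp [sub_eq_zero]
  rw [h1]
  refine Measure.addHaar_submodule _ _ fun htop => ?_
  have h2 : Pi.single p (1 : ℝ) ∈ LinearMap.ker
      (LinearMap.proj (R := ℝ) (φ := fun _ : ι => ℝ) p - LinearMap.proj q) := by
    rw [htop]; trivial
  simp [h.symm] at h2

theorem volume_not_injective_comp {ι κ : Type*} [Fintype ι] [Fintype κ] {s : κ → ι}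
    (hs : Function.Injective s) : volume {x : ι → ℝ | ¬ Function.Injective (x ∘ s)} = 0 := by
  have h : {x : ι → ℝ | ¬ Function.Injective (x ∘ s)}
      ⊆ ⋃ (i : κ) (j : κ) (_ : i ≠ j), {x | x (s i) = x (s j)} := by
    intro x hx
    simp only [Set.mem_ofPred_eq, Function.Injective, Function.comp_apply, not_forall] at hx
    obtain ⟨i, j, h1, h2⟩ := hx
    simp only [Set.mem_iUnion]
    exact ⟨i, j, h2, h1⟩
  refine measure_mono_null h ?_
  simp only [measure_iUnion_null_iff]
  intro i j hij
  exact volume_setOf_apply_eq fun h => hij (hs h)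

theorem existsUnique_strictMono {n : ℕ} {y : Fin n → ℝ} (hy : Function.Injective y) :
    ∃! π : Perm (Fin n), StrictMono (y ∘ π) := by
  refine ⟨Tuple.sort y, (Tuple.monotone_sort y).strictMono_of_injective
    (hy.comp (Tuple.sort y).injective), fun π hπ => ?_⟩
  have h1 : StrictMono (y ∘ Tuple.sort y) := (Tuple.monotone_sort y).strictMono_of_injective
    (hy.comp (Tuple.sort y).injective)
  have h2 : y ∘ π = y ∘ Tuple.sort y := by
    rw [← hπ.range_inj h1, Set.range_comp, Set.range_comp, π.range_eq_univ,
      (Tuple.sort y).range_eq_univ]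
  ext i
  exact congrArg _ (hy (congrFun h2 i))

theorem measurableSet_strictMono_comp {ι : Type*} [Fintype ι] {n : ℕ} (s : Fin n → ι) :
    MeasurableSet {x : ι → ℝ | StrictMono (x ∘ s)} := by
  have h : {x : ι → ℝ | StrictMono (x ∘ s)}
      = ⋂ (i : Fin n) (j : Fin n) (_ : i < j), {x | x (s i) < x (s j)} := by
    ext x
    simp [StrictMono]
  rw [h]
  exact MeasurableSet.iInter fun i => MeasurableSet.iInter fun j => MeasurableSet.iInter fun _ =>
    measurableSet_lt (measurable_pi_apply _) (measurable_pi_apply _)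

theorem convex_strictMono_comp {ι : Type*} {n : ℕ} (s : Fin n → ι) :
    Convex ℝ {x : ι → ℝ | StrictMono (x ∘ s)} := by
  intro x hx y hy a b ha hb hab i j hij
  have h1 := hx hij
  have h2 := hy hij
  simp only [Function.comp_apply, Pi.add_apply, Pi.smul_apply, smul_eq_mul] at *
  rcases ha.eq_or_lt with rfl | ha
  · simp only [zero_add] at hab
    subst hab
    simpa using h2
  · nlinarith [mul_lt_mul_of_pos_left h1 ha, mul_le_mul_of_nonneg_left h2.le hb]

/-- Permutation of the coordinates. -/
def permCoord {ι : Type*} (π : Perm ι) : (ι → ℝ) ≃ᵐ (ι → ℝ) :=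
  MeasurableEquiv.arrowCongr' π.symm (MeasurableEquiv.refl ℝ)

theorem permCoord_apply {ι : Type*} (π : Perm ι) (x : ι → ℝ) : permCoord π x = x ∘ π := by
  ext i
  simp [permCoord, MeasurableEquiv.arrowCongr', Equiv.arrowCongr']

theorem permCoord_symm_apply {ι : Type*} (π : Perm ι) (x : ι → ℝ) :
    (permCoord π).symm x = x ∘ π.symm := by
  rw [MeasurableEquiv.symm_apply_eq, permCoord_apply]
  ext i
  simp

theorem measurePreserving_permCoord {ι : Type*} [Fintype ι] (π : Perm ι) :
    MeasurePreserving (permCoord π) volume volume :=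
  volume_preserving_arrowCongr' _ _ (MeasurePreserving.id volume)

end Symmetrization

theorem vandermondeDet_comp {ι : Type*} [Fintype ι] [DecidableEq ι] {N : ℕ} (e : ι ≃ Fin N)
    (t : ι → ℂ) (π : Perm ι) :
    vandermondeDet e (t ∘ π) = ((sign π : ℤ) : ℂ) * vandermondeDet e t := by
  unfold vandermondeDet
  rw [← Matrix.det_permute]
  rfl

end RootRegion

/-! ### Moments and the ordered integral for real roots -/

namespace RootRegion

open Equiv Equiv.Perm Polynomial

section RealMoments

theorem integral_pow_symm_interval (n : ℕ) :
    ∫ y in (-1 : ℝ)..1, y ^ n = (1 + (-1) ^ n) / (n + 1) := by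
  rw [integral_pow]
  simp [pow_succ]

/-- The weight selecting increasing pairs in `[-1, 1]`. -/
noncomputable def ltWeight : ℝ × ℝ → ℂ :=
  {p : ℝ × ℝ | -1 ≤ p.1 ∧ p.1 < p.2 ∧ p.2 ≤ 1}.indicator 1

/-- The weight selecting points of `[-1, 1]`. -/
noncomputable def unitWeight : ℝ → ℂ := (Set.Icc (-1 : ℝ) 1).indicator 1

theorem measurableSet_lt_pairs : MeasurableSet {p : ℝ × ℝ | -1 ≤ p.1 ∧ p.1 < p.2 ∧ p.2 ≤ 1} :=
  (measurableSet_le measurable_const measurable_fst).inter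
    ((measurableSet_lt measurable_fst measurable_snd).inter
      (measurableSet_le measurable_snd measurable_const))

theorem integrable_ltWeight_mul {f : ℝ × ℝ → ℂ} (hf : Continuous f) :
    Integrable fun p => ltWeight p * f p := by
  have h : (fun p => ltWeight p * f p)
      = {p : ℝ × ℝ | -1 ≤ p.1 ∧ p.1 < p.2 ∧ p.2 ≤ 1}.indicator f := by
    funext p
    simp only [ltWeight, Set.indicator_apply, Pi.one_apply]
    split_ifs <;> simp
  rw [h, integrable_indicator_iff measurableSet_lt_pairs]
  refine (hf.continuousOn.integrableOn_compact
    ((isCompact_Icc (a := (-1 : ℝ)) (b := 1)).prod (isCompact_Icc (a := (-1 : ℝ)) (b := 1)))).mono_set ?_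
  rintro ⟨x, y⟩ ⟨h1, h2, h3⟩
  simp only at h1 h2 h3
  exact ⟨⟨h1, by linarith⟩, ⟨by linarith, h3⟩⟩

theorem integrable_unitWeight_mul {f : ℝ → ℂ} (hf : Continuous f) :
    Integrable fun y => unitWeight y * f y := by
  have h : (fun p => unitWeight p * f p) = (Set.Icc (-1 : ℝ) 1).indicator f := by
    funext p
    simp only [unitWeight, Set.indicator_apply, Pi.one_apply]
    split_ifs <;> simp
  rw [h, integrable_indicator_iff measurableSet_Icc]
  exact hf.continuousOn.integrableOn_compact isCompact_Icc

theorem integral_unitWeight_mul (j : ℕ) :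
    ∫ y : ℝ, unitWeight y * (y : ℂ) ^ j = (1 + (-1) ^ j) / (j + 1) := by
  have h : (fun y : ℝ => unitWeight y * (y : ℂ) ^ j)
      = (Set.Icc (-1 : ℝ) 1).indicator fun y : ℝ => ((y ^ j : ℝ) : ℂ) := by
    funext p
    simp only [unitWeight, Set.indicator_apply, Pi.one_apply]
    split_ifs <;> simp
  rw [h, integral_indicator measurableSet_Icc, integral_complex_ofReal, integral_Icc_eq_integral_Ioc,
    ← intervalIntegral.integral_of_le (by norm_num), integral_pow_symm_interval]
  push_cast
  rfl

theorem integral_ltWeight_mul (j k : ℕ) :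
    ∫ p : ℝ × ℝ, ltWeight p * ((p.1 : ℂ) ^ j * (p.2 : ℂ) ^ k)
      = ((1 + (-1) ^ (j + k + 1)) / (j + k + 2) + (-1) ^ j * ((1 + (-1) ^ k) / (k + 1)))
        / (j + 1) := by
  have hint := integrable_ltWeight_mul (f := fun p : ℝ × ℝ => (p.1 : ℂ) ^ j * (p.2 : ℂ) ^ k)
    (by fun_prop)
  rw [Measure.volume_eq_prod] at hint ⊢
  rw [integral_prod_symm _ hint]
  have hinner : ∀ y : ℝ, ∫ x : ℝ, ltWeight (x, y) * ((x : ℂ) ^ j * (y : ℂ) ^ k)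
      = (Set.Icc (-1 : ℝ) 1).indicator
        (fun y : ℝ => (((y ^ (j + k + 1) + (-1) ^ j * y ^ k) / (j + 1) : ℝ) : ℂ)) y := by
    intro y
    by_cases hy : y ∈ Set.Icc (-1 : ℝ) 1
    · rw [Set.indicator_of_mem hy]
      have h : (fun x : ℝ => ltWeight (x, y) * ((x : ℂ) ^ j * (y : ℂ) ^ k))
          = (Set.Ico (-1 : ℝ) y).indicator fun x : ℝ => ((x ^ j * y ^ k : ℝ) : ℂ) := by
        funext x
        simp only [ltWeight, Set.indicator_apply, Pi.one_apply, Set.mem_ofPred_eq, Set.mem_Ico, hy.2,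
          and_true]
        split_ifs <;> simp
      rw [h, integral_indicator measurableSet_Ico, integral_complex_ofReal,
        integral_Ico_eq_integral_Ioo, ← integral_Ioc_eq_integral_Ioo,
        ← intervalIntegral.integral_of_le hy.1, intervalIntegral.integral_mul_const, integral_pow]
      congr 1
      rw [pow_succ (-1 : ℝ)]
      ring
    · rw [Set.indicator_of_notMem hy]
      have h : (fun x : ℝ => ltWeight (x, y) * ((x : ℂ) ^ j * (y : ℂ) ^ k)) = fun _ => 0 := by
        funext x
        rw [ltWeight, Set.indicator_of_notMem, zero_mul]
        rintro ⟨h1, h2, h3⟩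
        simp only at h1 h2 h3
        exact hy ⟨by linarith, h3⟩
      rw [h, integral_zero]
  simp only [hinner]
  rw [integral_indicator measurableSet_Icc, integral_complex_ofReal, integral_Icc_eq_integral_Ioc,
    ← intervalIntegral.integral_of_le (by norm_num), intervalIntegral.integral_div,
    intervalIntegral.integral_add (Continuous.intervalIntegrable (by fun_prop) _ _)
      (Continuous.intervalIntegrable (by fun_prop) _ _), intervalIntegral.integral_const_mul,
    integral_pow_symm_interval, integral_pow_symm_interval]
  push_cast
  ring

end RealMoments

section RealRoots

variable {m r : ℕ}

/-- Real roots as complex numbers. -/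
noncomputable def realNodes (ι : Type*) : (ι → ℝ) →L[ℝ] (ι → ℂ) :=
  ContinuousLinearMap.pi fun p => Complex.ofRealCLM.comp (ContinuousLinearMap.proj p)

@[simp] theorem realNodes_apply {ι : Type*} (x : ι → ℝ) (p : ι) : realNodes ι x p = (x p : ℂ) := by
  simp [realNodes]

/-- The ordered root vectors in `[-1, 1]`. -/
def orderedCube (m r : ℕ) : Set ((Fin m ⊕ Fin r) ⊕ Fin m → ℝ) :=
  {x | StrictMono (x ∘ (parityEquiv m r).symm)} ∩ Set.univ.pi fun _ => Set.Icc (-1) 1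

theorem measurableSet_orderedCube : MeasurableSet (orderedCube m r) :=
  (measurableSet_strictMono_comp _).inter
    (MeasurableSet.univ_pi fun _ => measurableSet_Icc)

theorem convex_orderedCube : Convex ℝ (orderedCube m r) :=
  (convex_strictMono_comp _).inter (convex_pi fun _ _ => convex_Icc _ _)

theorem isBounded_orderedCube : Bornology.IsBounded (orderedCube m r) :=
  (Bornology.IsBounded.pi fun _ => Metric.isBounded_Icc _ _).subset Set.inter_subset_right

theorem ae_existsUnique_perm : ∀ᵐ x : (Fin m ⊕ Fin r) ⊕ Fin m → ℝ,
    ∃! π : Perm ((Fin m ⊕ Fin r) ⊕ Fin m),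
      permCoord π x ∈ {x | StrictMono (x ∘ (parityEquiv m r).symm)} := by
  have h := volume_not_injective_comp (parityEquiv m r).symm.injective
  filter_upwards [measure_eq_zero_iff_ae_notMem.1 h] with x hx
  simp only [not_not] at hx
  obtain ⟨τ, hτ, hu⟩ := existsUnique_strictMono hx
  simp only [permCoord_apply]
  refine ⟨(parityEquiv m r).symm.permCongr τ, ?_, fun π hπ => ?_⟩
  · convert hτ using 1
    ext i
    simp [Equiv.permCongr_apply]
  · have h1 := hu ((parityEquiv m r).permCongr π) (by
      have h2 : (x ∘ (parityEquiv m r).symm) ∘ ((parityEquiv m r).permCongr π)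
          = (x ∘ π) ∘ (parityEquiv m r).symm := by
        ext i
        simp [Equiv.permCongr_apply]
      change StrictMono _
      rw [h2]
      exact hπ)
    rw [← h1]
    ext i
    simp [Equiv.permCongr_apply]

/-- In the ordered chamber comparing coordinates means comparing indices. As `π` is surjective,
every coordinate occurs in some weight, so together the weights confine the whole vector to the
cube. -/
theorem prod_weight_comp (π : Perm ((Fin m ⊕ Fin r) ⊕ Fin m)) {x : (Fin m ⊕ Fin r) ⊕ Fin m → ℝ}
    (hx : StrictMono (x ∘ (parityEquiv m r).symm)) :
    (∏ k, ltWeight (x (π (.inl (.inl k))), x (π (.inr k))))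
        * ∏ s, unitWeight (x (π (.inl (.inr s))))
      = (Set.univ.pi fun _ => Set.Icc (-1 : ℝ) 1).indicator 1 x *
        ∏ k : Fin m, if parityEquiv m r (π (.inl (.inl k))) < parityEquiv m r (π (.inr k))
          then (1 : ℂ) else 0 := by
  have hlt : ∀ p q, x p < x q ↔ parityEquiv m r p < parityEquiv m r q := by
    intro p q
    simpa using hx.lt_iff_lt (a := parityEquiv m r p) (b := parityEquiv m r q)
  by_cases hc : x ∈ Set.univ.pi fun _ => Set.Icc (-1 : ℝ) 1
  · rw [Set.indicator_of_mem hc, Pi.one_apply, one_mul]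
    have hc' : ∀ p, x p ∈ Set.Icc (-1 : ℝ) 1 := fun p => hc p (Set.mem_univ p)
    rw [Finset.prod_eq_one (s := Finset.univ) (f := fun s : Fin r => unitWeight _), mul_one]
    · refine Finset.prod_congr rfl fun k _ => ?_
      rw [ltWeight, Set.indicator_apply]
      simp [hlt, (hc' _).1, (hc' _).2]
    · intro s _
      rw [unitWeight, Set.indicator_of_mem (hc' _), Pi.one_apply]
  · rw [Set.indicator_of_notMem hc, zero_mul]
    simp only [Set.mem_pi, Set.mem_univ, forall_true_left, not_forall] at hc
    obtain ⟨q, hq⟩ := hc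
    obtain ⟨p, rfl⟩ := π.surjective q
    rcases p with (k | s) | k
    · rw [Finset.prod_eq_zero (Finset.mem_univ k), zero_mul]
      rw [ltWeight, Set.indicator_of_notMem]
      rintro ⟨h1, h2, h3⟩
      simp only at h1 h2 h3
      exact hq ⟨h1, by linarith⟩
    · rw [Finset.prod_eq_zero (s := Finset.univ) (f := fun s : Fin r => unitWeight _)
        (Finset.mem_univ s), mul_zero]
      rw [unitWeight, Set.indicator_of_notMem hq]
    · rw [Finset.prod_eq_zero (Finset.mem_univ k), zero_mul]
      rw [ltWeight, Set.indicator_of_notMem]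
      rintro ⟨h1, h2, h3⟩
      simp only at h1 h2 h3
      exact hq ⟨by linarith, h3⟩

/-- The matrix of moments occurring in the volume of the real-rooted region. -/
noncomputable def realMomentMatrix (m r : ℕ) : Matrix (Fin m ⊕ Fin r) (Fin m ⊕ Fin r) ℂ :=
  Matrix.of fun x y => Sum.elim
    (fun k : Fin m => 4 / (((parityEquiv m r (.inl x) : ℕ) + 2 * (k : ℕ) + 3)
      * ((parityEquiv m r (.inl x) : ℕ) + 1)))
    (fun _ => 2 / ((parityEquiv m r (.inl x) : ℕ) + 1)) y

/-- The Vandermonde determinant with weight x < y on each pair is integrated over the whole space in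
two ways. Cutting into chambers gives the ordered integral times the signed count m!; integrating
termwise gives m! times the moment determinant. -/
theorem integral_orderedCube (hr : r ≤ 1) :
    ∫ x in orderedCube m r, vandermondeDet (parityEquiv m r) (realNodes _ x)
      = (realMomentMatrix m r).det := by
  set e := parityEquiv m r with he
  have hα : ∀ (x : (Fin m ⊕ Fin r) ⊕ Fin m → ℝ) k, realNodes _ x (.inl (.inl k))
      = (fun p : ℝ × ℝ => (p.1 : ℂ)) (x (.inl (.inl k)), x (.inr k)) := by simp
  have hβ : ∀ (x : (Fin m ⊕ Fin r) ⊕ Fin m → ℝ) k, realNodes _ x (.inr k)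
      = (fun p : ℝ × ℝ => (p.2 : ℂ)) (x (.inl (.inl k)), x (.inr k)) := by simp
  have hγ : ∀ (x : (Fin m ⊕ Fin r) ⊕ Fin m → ℝ) s, realNodes _ x (.inl (.inr s))
      = (fun y : ℝ => (y : ℂ)) (x (.inl (.inr s))) := by simp
  have hχ : ∀ i j : ℕ, Integrable fun p : ℝ × ℝ => ltWeight p * ((p.1 : ℂ) ^ i * (p.2 : ℂ) ^ j) :=
    fun i j => integrable_ltWeight_mul (by fun_prop)
  have hη : ∀ i : ℕ, Integrable fun y : ℝ => unitWeight y * (y : ℂ) ^ i :=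
    fun i => integrable_unitWeight_mul (by fun_prop)
  have h1 := integral_vandermondeDet_pair e hα hβ hγ hχ hη
  rw [integral_eq_sum_fundamental permCoord measurePreserving_permCoord
    (measurableSet_strictMono_comp _) ae_existsUnique_perm
    (integrable_vandermondeDet_pair e hα hβ hγ hχ hη)] at h1
  have h2 : ∀ π : Perm ((Fin m ⊕ Fin r) ⊕ Fin m),
      ∫ x in {x | StrictMono (x ∘ (parityEquiv m r).symm)},
        (fun x => vandermondeDet e (realNodes _ x) *
          ((∏ k, ltWeight (x (.inl (.inl k)), x (.inr k))) * ∏ s, unitWeight (x (.inl (.inr s)))))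
        ((permCoord π).symm x)
      = (((sign π.symm : ℤ) : ℂ) *
        ((∏ k : Fin m, if e (π.symm (.inl (.inl k))) < e (π.symm (.inr k)) then (1 : ℂ) else 0)
          * ∏ s : Fin r, (1 : ℂ))) * ∫ x in orderedCube m r, vandermondeDet e (realNodes _ x) := by
    intro π
    rw [orderedCube, Set.inter_comm, ← Measure.restrict_restrict
      (MeasurableSet.univ_pi fun _ => measurableSet_Icc), ← integral_indicator
      (MeasurableSet.univ_pi fun _ => measurableSet_Icc), ← integral_const_mul]
    refine setIntegral_congr_fun (measurableSet_strictMono_comp _) fun x hx => ?_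
    simp only [permCoord_symm_apply]
    have h3 : realNodes _ (x ∘ π.symm) = realNodes _ x ∘ π.symm := by
      funext p; simp
    have h4 := prod_weight_comp π.symm hx
    simp only [Function.comp_apply, h3, vandermondeDet_comp] at h4 ⊢
    rw [h4, ← he]
    by_cases hc : x ∈ Set.univ.pi fun _ => Set.Icc (-1 : ℝ) 1
    · rw [Set.indicator_of_mem hc, Set.indicator_of_mem hc]
      simp
      ring
    · rw [Set.indicator_of_notMem hc, Set.indicator_of_notMem hc]
      simp
  have h5 : ∑ π : Perm ((Fin m ⊕ Fin r) ⊕ Fin m), (((sign π.symm : ℤ) : ℂ) *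
        ((∏ k : Fin m, if e (π.symm (.inl (.inl k))) < e (π.symm (.inr k)) then (1 : ℂ) else 0)
          * ∏ s : Fin r, (1 : ℂ))) = m.factorial :=
    (Equiv.sum_comp (Equiv.inv (Perm ((Fin m ⊕ Fin r) ⊕ Fin m))) (fun π => (((sign π : ℤ) : ℂ) *
        ((∏ k : Fin m, if e (π (.inl (.inl k))) < e (π (.inr k)) then (1 : ℂ) else 0)
          * ∏ s : Fin r, (1 : ℂ))))).trans (pairSum_lt m r hr)
  rw [Finset.sum_congr rfl fun π _ => h2 π, ← Finset.sum_mul, h5] at h1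
  rw [pairSum_eq_det] at h1
  · rw [Fintype.card_fin] at h1
    have h6 := mul_left_cancel₀ (Nat.cast_ne_zero.2 (Nat.factorial_ne_zero m)) h1
    rw [h6]
    congr 1
    ext x y
    rw [realMomentMatrix, Matrix.of_apply, Matrix.of_apply]
    obtain ⟨a, ha⟩ := parityEquiv_inl_even hr x
    rcases y with k | s
    · simp only [Sum.elim_inl, integral_ltWeight_mul, he, parityEquiv_pair_snd, ha]
      have e1 : (-1 : ℂ) ^ (a + a) = 1 := Even.neg_one_pow ⟨a, rfl⟩
      have e2 : (-1 : ℂ) ^ (2 * (k : ℕ) + 1) = -1 := Odd.neg_one_pow ⟨k, rfl⟩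
      have e3 : (-1 : ℂ) ^ (a + a + (2 * (k : ℕ) + 1) + 1) = 1 :=
        Even.neg_one_pow ⟨a + k + 1, by ring⟩
      have e4 : (-1 : ℂ) ^ (2 * (k : ℕ) + 1 + (a + a) + 1) = 1 :=
        Even.neg_one_pow ⟨a + k + 1, by ring⟩
      rw [e1, e2, e3, e4]
      push_cast
      have n3 : (a + a + 1 : ℂ) ≠ 0 := by norm_cast
      have n4 : (2 * k + 1 + 1 : ℂ) ≠ 0 := by norm_cast
      have n5 : (a + a + 2 * k + 3 : ℂ) ≠ 0 := by norm_cast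
      -- Here u and v are the even first and the odd second exponent, each increased by 1.
      have key : ∀ u v : ℂ, u ≠ 0 → v ≠ 0 → u + v ≠ 0 →
          ((1 + 1) / (u + v) + 1 * ((1 + -1) / v)) / u - ((1 + 1) / (u + v) + -1 * ((1 + 1) / u)) / v
            = 4 / ((u + v) * u) := by
        intro u v hu hv huv
        field_simp
        ring
      have h := key (a + a + 1) (2 * k + 1 + 1) n3 n4 (by
        rwa [show (a + a + 1 + (2 * k + 1 + 1) : ℂ) = a + a + 2 * k + 3 by ring])
      rw [show (a + a + 1 + (2 * k + 1 + 1) : ℂ) = a + a + 2 * k + 3 by ring] at h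
      rw [show (a + a + (2 * k + 1) + 2 : ℂ) = a + a + 2 * k + 3 by ring,
        show (2 * k + 1 + (a + a) + 2 : ℂ) = a + a + 2 * k + 3 by ring, h]
    · simp only [Sum.elim_inr, integral_unitWeight_mul, he, ha]
      have e1 : (-1 : ℂ) ^ (a + a) = 1 := Even.neg_one_pow ⟨a, rfl⟩
      rw [e1]
      norm_num
  · intro x y
    obtain ⟨a, ha⟩ := parityEquiv_inl_even hr x
    obtain ⟨b, hb⟩ := parityEquiv_inl_even hr y
    simp only [integral_ltWeight_mul, he, ha, hb]
    have e1 : (-1 : ℂ) ^ (a + a) = 1 := Even.neg_one_pow ⟨a, rfl⟩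
    have e2 : (-1 : ℂ) ^ (b + b) = 1 := Even.neg_one_pow ⟨b, rfl⟩
    have e3 : (-1 : ℂ) ^ (a + a + (b + b) + 1) = -1 := Odd.neg_one_pow ⟨a + b, by ring⟩
    have e4 : (-1 : ℂ) ^ (b + b + (a + a) + 1) = -1 := Odd.neg_one_pow ⟨a + b, by ring⟩
    rw [e1, e2, e3, e4]
    ring
  · intro x y
    simp only [integral_ltWeight_mul, he, parityEquiv_pair_snd]
    have e1 : (-1 : ℂ) ^ (2 * (x : ℕ) + 1) = -1 := Odd.neg_one_pow ⟨x, rfl⟩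
    have e2 : (-1 : ℂ) ^ (2 * (y : ℕ) + 1) = -1 := Odd.neg_one_pow ⟨y, rfl⟩
    have e3 : (-1 : ℂ) ^ (2 * (x : ℕ) + 1 + (2 * (y : ℕ) + 1) + 1) = -1 :=
      Odd.neg_one_pow ⟨x + y + 1, by ring⟩
    have e4 : (-1 : ℂ) ^ (2 * (y : ℕ) + 1 + (2 * (x : ℕ) + 1) + 1) = -1 :=
      Odd.neg_one_pow ⟨x + y + 1, by ring⟩
    rw [e1, e2, e3, e4]
    ring
  · intro _ x
    simp only [integral_unitWeight_mul, he, parityEquiv_pair_snd]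
    have e1 : (-1 : ℂ) ^ (2 * (x : ℕ) + 1) = -1 := Odd.neg_one_pow ⟨x, rfl⟩
    rw [e1]
    simp

end RealRoots

end RootRegion

/-! ### The volume of the region with only real roots -/

namespace RootRegion

open Polynomial

theorem differentiable_coeff_mul {E : Type*} [NormedAddCommGroup E] [NormedSpace ℝ E]
    {p q : E → ℝ[X]} (hp : ∀ k, Differentiable ℝ fun x => (p x).coeff k)
    (hq : ∀ k, Differentiable ℝ fun x => (q x).coeff k) (k : ℕ) :
    Differentiable ℝ fun x => (p x * q x).coeff k := by
  simp only [Polynomial.coeff_mul]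
  exact Differentiable.fun_sum fun i _ => (hp _).mul (hq _)

theorem differentiable_coeff_prod {E ι : Type*} [NormedAddCommGroup E] [NormedSpace ℝ E]
    (s : Finset ι) {p : ι → E → ℝ[X]} (hp : ∀ i k, Differentiable ℝ fun x => (p i x).coeff k)
    (k : ℕ) : Differentiable ℝ fun x => (∏ i ∈ s, p i x).coeff k := by
  classical
  induction s using Finset.induction_on generalizing k with
  | empty => simp
  | insert i s hi ih =>
    simp only [Finset.prod_insert hi]
    exact differentiable_coeff_mul (hp i) ih k

theorem exists_fin_map_eq {α : Type*} {n : ℕ} (s : Multiset α) (hs : s.card = n) :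
    ∃ f : Fin n → α, (Finset.univ : Finset (Fin n)).val.map f = s := by
  have hl : s.toList.length = n := by rw [Multiset.length_toList, hs]
  subst hl
  exact ⟨s.toList.get, by rw [Fin.univ_val_map, List.ofFn_get, Multiset.coe_toList]⟩

section RealRoots

variable {m r : ℕ}

/-- The polynomial with prescribed real roots. -/
noncomputable def realPoly {ι : Type*} [Fintype ι] (x : ι → ℝ) : ℝ[X] := ∏ p, (X - C (x p))

theorem realPoly_comp {ι κ : Type*} [Fintype ι] [Fintype κ] (x : ι → ℝ) (e : κ ≃ ι) :
    realPoly (x ∘ e) = realPoly x :=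
  e.prod_comp fun p => X - C (x p)

theorem map_realPoly {ι : Type*} [Fintype ι] (x : ι → ℝ) :
    (realPoly x).map (algebraMap ℝ ℂ) = ∏ p, (X - C (realNodes ι x p)) := by
  simp [realPoly, Polynomial.map_prod]

theorem monic_realPoly {ι : Type*} [Fintype ι] (x : ι → ℝ) : (realPoly x).Monic :=
  monic_prod_of_monic _ _ fun _ _ => monic_X_sub_C _

theorem natDegree_realPoly {ι : Type*} [Fintype ι] (x : ι → ℝ) :
    (realPoly x).natDegree = Fintype.card ι := by
  rw [realPoly, natDegree_finsetProd_X_sub_C_eq_card, Finset.card_univ]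

theorem differentiable_coeff_realPoly {ι : Type*} [Fintype ι] (k : ℕ) :
    Differentiable ℝ fun x : ι → ℝ => (realPoly x).coeff k := by
  refine differentiable_coeff_prod _ (fun i k => ?_) k
  simp only [coeff_sub, coeff_C]
  split_ifs <;> fun_prop

theorem aeval_realPoly_eq_zero {ι : Type*} [Fintype ι] {x : ι → ℝ} {z : ℂ} :
    aeval z (realPoly x) = 0 ↔ ∃ p, z = x p := by
  rw [← eval_map_algebraMap, map_realPoly, eval_prod, Finset.prod_eq_zero_iff]
  simp [sub_eq_zero]

/-- A strictly increasing vector is determined by its range, here the set of roots. -/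
theorem realPoly_injOn : Set.InjOn (realPoly (ι := (Fin m ⊕ Fin r) ⊕ Fin m)) (orderedCube m r) := by
  intro x hx y hy hxy
  have h1 : ∀ u v : (Fin m ⊕ Fin r) ⊕ Fin m → ℝ, realPoly u = realPoly v →
      Set.range u ⊆ Set.range v := by
    rintro u v huv _ ⟨p, rfl⟩
    have h2 : aeval ((u p : ℝ) : ℂ) (realPoly v) = 0 := by
      rw [← huv, aeval_realPoly_eq_zero]
      exact ⟨p, rfl⟩
    obtain ⟨q, hq⟩ := aeval_realPoly_eq_zero.1 h2
    exact ⟨q, by exact_mod_cast hq.symm⟩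
  have h2 : x ∘ (parityEquiv m r).symm = y ∘ (parityEquiv m r).symm := by
    rw [← StrictMono.range_inj hx.1 hy.1, EquivLike.range_comp, EquivLike.range_comp]
    exact (h1 x y hxy).antisymm (h1 y x hxy.symm)
  funext p
  simpa using congrFun h2 (parityEquiv m r p)

theorem monicPoly_coeffVec_realPoly (x : (Fin m ⊕ Fin r) ⊕ Fin m → ℝ) :
    monicPoly (coeffVec (2 * m + r) realPoly x) = realPoly x :=
  monicPoly_coeff (monic_realPoly x) (by
    rw [natDegree_realPoly]
    simp
    ring)

theorem exists_realPoly_eq {a : Fin (2 * m + r) → ℝ} (ha : a ∈ Omega (2 * m + r))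
    (ha' : a ∈ onlyRealRoots (2 * m + r)) :
    ∃ f : Fin (2 * m + r) → ℝ, (∀ i, f i ∈ Set.Icc (-1) 1) ∧ monicPoly a = realPoly f := by
  obtain ⟨g, hg⟩ := exists_fin_map_eq (complexRoots a) (card_complexRoots a)
  have hmem : ∀ i, aeval (g i) (monicPoly a) = 0 := by
    intro i
    rw [← mem_complexRoots, ← hg]
    exact Multiset.mem_map_of_mem _ (Finset.mem_univ i)
  have hre : ∀ i, ((g i).re : ℂ) = g i := fun i =>
    Complex.ext (by simp) (by simp [ha' (g i) (hmem i)])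
  refine ⟨fun i => (g i).re, fun i => ?_, ?_⟩
  · have h1 := ha (g i) (hmem i)
    exact abs_le.1 ((Complex.abs_re_le_norm _).trans h1)
  · apply Polynomial.map_injective (algebraMap ℝ ℂ) (algebraMap ℝ ℂ).injective
    rw [map_monicPoly_eq_prod, ← hg, map_realPoly]
    simp only [realNodes_apply, hre, Multiset.map_map]
    rfl

theorem volume_real_region (hr : r ≤ 1) :
    volume (Omega (2 * m + r) ∩ onlyRealRoots (2 * m + r))
      = ENNReal.ofReal ‖(realMomentMatrix m r).det‖ := by
  have hvol := volume_image_coeffVec (parityEquiv m r) (realNodes _)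
    (Pol := realPoly) differentiable_coeff_realPoly map_realPoly
    (measurableSet_orderedCube (m := m) (r := r)) convex_orderedCube isBounded_orderedCube
    realPoly_injOn (fun x hx p q hpq => by
      have h1 : x p = x q := by simpa using hpq
      have h2 := hx.1.injective (a₁ := parityEquiv m r p) (a₂ := parityEquiv m r q) (by simpa using h1)
      exact (parityEquiv m r).injective h2) (c := 1) (fun x => by
      rw [one_mul, vandermondeDet, RingHom.map_det]
      congr 1
      ext p j
      simp)
  have hW : (Matrix.of fun p q : (Fin m ⊕ Fin r) ⊕ Fin m =>
      realNodes ((Fin m ⊕ Fin r) ⊕ Fin m) (Pi.single q 1) p) = 1 := by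
    ext p q
    rw [Matrix.of_apply, realNodes_apply, Matrix.one_apply, Pi.single_apply]
    split_ifs <;> simp
  rw [hW, Matrix.det_one, norm_one, one_mul, integral_orderedCube hr] at hvol
  rw [← hvol]
  refine le_antisymm ?_ (measure_mono ?_)
  · have hnull := volume_image_coeffVec_eq_zero (parityEquiv m r) (Pol := realPoly)
      differentiable_coeff_realPoly
      (volume_not_injective_comp (parityEquiv m r).symm.injective)
    -- Sorting the roots lands in the ordered cube unless two of them coincide, and the exceptional
    -- polynomials form a null set.
    have hsub : Omega (2 * m + r) ∩ onlyRealRoots (2 * m + r)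
        ⊆ coeffVec (2 * m + r) realPoly '' orderedCube m r ∪ coeffVec (2 * m + r) realPoly ''
          {x : (Fin m ⊕ Fin r) ⊕ Fin m → ℝ | ¬ Function.Injective (x ∘ (parityEquiv m r).symm)} := by
      rintro a ⟨ha, ha'⟩
      obtain ⟨f, hf, hfa⟩ := exists_realPoly_eq ha ha'
      have hcoeff : ∀ x : (Fin m ⊕ Fin r) ⊕ Fin m → ℝ, realPoly x = realPoly f →
          coeffVec (2 * m + r) realPoly x = a := by
        intro x hx
        funext i
        rw [coeffVec, hx, ← hfa, coeff_monicPoly]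
      by_cases hinj : Function.Injective f
      · left
        refine ⟨(f ∘ Tuple.sort f) ∘ parityEquiv m r, ⟨?_, fun p _ => hf _⟩, hcoeff _ ?_⟩
        · have := (Tuple.monotone_sort f).strictMono_of_injective
            (hinj.comp (Tuple.sort f).injective)
          have h2 : ((f ∘ Tuple.sort f) ∘ parityEquiv m r) ∘ (parityEquiv m r).symm
              = f ∘ Tuple.sort f := by
            ext i; simp
          change StrictMono _
          rwa [h2]
        · rw [realPoly_comp, realPoly_comp]
      · right
        refine ⟨f ∘ parityEquiv m r, ?_, hcoeff _ (realPoly_comp _ _)⟩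
        have h2 : (f ∘ parityEquiv m r) ∘ (parityEquiv m r).symm = f := by
          ext i; simp
        change ¬ Function.Injective _
        rwa [h2]
    calc _ ≤ _ := measure_mono hsub
      _ ≤ _ := measure_union_le _ _
      _ = _ := by rw [hnull, add_zero]
  · rintro _ ⟨x, hx, rfl⟩
    constructor
    · intro z hz
      rw [monicPoly_coeffVec_realPoly, aeval_realPoly_eq_zero] at hz
      obtain ⟨p, rfl⟩ := hz
      rw [Complex.norm_real]
      exact abs_le.2 (hx.2 p (Set.mem_univ p))
    · intro z hz
      rw [monicPoly_coeffVec_realPoly, aeval_realPoly_eq_zero] at hz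
      obtain ⟨p, rfl⟩ := hz
      simp

end RealRoots

end RootRegion

/-! ### Moments of the upper half disk -/

namespace RootRegion

open Equiv Equiv.Perm Polynomial

section HalfDisk

/-- The upper half of the unit disk. -/
def halfDisk : Set (ℝ × ℝ) := {p | 0 < p.2 ∧ p.1 ^ 2 + p.2 ^ 2 ≤ 1}

theorem measurableSet_halfDisk : MeasurableSet halfDisk :=
  (measurableSet_lt measurable_const measurable_snd).inter
    (measurableSet_le (f := fun p : ℝ × ℝ => p.1 ^ 2 + p.2 ^ 2) (g := fun _ => 1) (by fun_prop)
      measurable_const)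

theorem halfDisk_subset : halfDisk ⊆ Set.Icc (-1 : ℝ) 1 ×ˢ Set.Icc (-1 : ℝ) 1 := by
  rintro ⟨u, v⟩ ⟨-, h⟩
  simp only at h
  exact ⟨abs_le.1 (abs_le_one_iff_mul_self_le_one.2 (by nlinarith)),
    abs_le.1 (abs_le_one_iff_mul_self_le_one.2 (by nlinarith))⟩

theorem convex_halfDisk : Convex ℝ halfDisk := by
  rintro ⟨u, v⟩ ⟨h1, h2⟩ ⟨u', v'⟩ ⟨h1', h2'⟩ a b ha hb hab
  simp only [halfDisk, Set.mem_ofPred_eq, Prod.smul_mk, Prod.mk_add_mk, smul_eq_mul] at *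
  constructor
  · rcases ha.eq_or_lt with rfl | ha
    · simp only [zero_add] at hab
      subst hab
      simpa using h1'
    · have := mul_pos ha h1
      have := mul_nonneg hb h1'.le
      linarith
  · obtain rfl : b = 1 - a := by linarith
    nlinarith [mul_nonneg (mul_nonneg ha hb) (sq_nonneg (u - u')),
      mul_nonneg (mul_nonneg ha hb) (sq_nonneg (v - v'))]

noncomputable def halfDiskWeight : ℝ × ℝ → ℂ := halfDisk.indicator 1

theorem integrable_halfDiskWeight_mul {f : ℝ × ℝ → ℂ} (hf : Continuous f) :
    Integrable fun p => halfDiskWeight p * f p := by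
  have h : (fun p => halfDiskWeight p * f p) = halfDisk.indicator f := by
    funext p
    by_cases hp : p ∈ halfDisk <;> simp [halfDiskWeight, hp]
  rw [h, integrable_indicator_iff measurableSet_halfDisk]
  exact (hf.continuousOn.integrableOn_compact
    (isCompact_Icc.prod isCompact_Icc)).mono_set halfDisk_subset

/-- In polar coordinates the radial integral of ρ^(j+k+1) splits off, and the angle runs over a half
turn. -/
theorem integral_halfDiskWeight_mul (j k : ℕ) :
    ∫ p : ℝ × ℝ, halfDiskWeight p *
        ((p.1 + Complex.I * p.2 : ℂ) ^ j * (p.1 - Complex.I * p.2 : ℂ) ^ k)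
      = 1 / (j + k + 2) * ∫ θ in (0 : ℝ)..Real.pi, Complex.exp ((j - k : ℂ) * Complex.I * θ) := by
  rw [← integral_comp_polarCoord_symm]
  have hset : MeasurableSet polarCoord.target :=
    measurableSet_Ioi.prod measurableSet_Ioo
  have hfun : ∀ p ∈ polarCoord.target, p.1 • (halfDiskWeight (polarCoord.symm p) *
      (((polarCoord.symm p).1 + Complex.I * (polarCoord.symm p).2 : ℂ) ^ j *
        ((polarCoord.symm p).1 - Complex.I * (polarCoord.symm p).2 : ℂ) ^ k))
      = (Set.Ioc (0 : ℝ) 1 ×ˢ Set.Ioo 0 Real.pi).indicator (fun p : ℝ × ℝ =>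
        ((p.1 ^ (j + k + 1) : ℝ) : ℂ) * Complex.exp ((j - k : ℂ) * Complex.I * p.2)) p := by
    rintro ⟨ρ, θ⟩ ⟨hρ, hθ⟩
    simp only [Set.mem_Ioi, Set.mem_Ioo] at hρ hθ
    have hmem : polarCoord.symm (ρ, θ) ∈ halfDisk
        ↔ (ρ, θ) ∈ Set.Ioc (0 : ℝ) 1 ×ˢ Set.Ioo 0 Real.pi := by
      simp only [polarCoord_symm_apply, halfDisk, Set.mem_ofPred_eq, Set.mem_prod, Set.mem_Ioc,
        Set.mem_Ioo, hρ, true_and, hθ.2, and_true]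
      have e1 : (ρ * Real.cos θ) ^ 2 + (ρ * Real.sin θ) ^ 2 = ρ ^ 2 := by
        nlinarith [Real.sin_sq_add_cos_sq θ]
      rw [e1, mul_pos_iff_of_pos_left hρ, sq_le_one_iff₀ hρ.le, and_comm]
      refine and_congr_right fun _ => ⟨fun h => ?_, fun h => Real.sin_pos_of_pos_of_lt_pi h hθ.2⟩
      by_contra hneg
      push Not at hneg
      have := Real.sin_nonpos_of_nonpos_of_neg_pi_le hneg hθ.1.le
      linarith
    by_cases h : polarCoord.symm (ρ, θ) ∈ halfDisk
    · rw [halfDiskWeight, Set.indicator_of_mem h, Set.indicator_of_mem (hmem.1 h), Pi.one_apply,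
        one_mul]
      simp only [polarCoord_symm_apply, Complex.ofReal_mul]
      have e1 : (ρ * (Real.cos θ : ℝ) + Complex.I * (ρ * (Real.sin θ : ℝ)) : ℂ)
          = ρ * Complex.exp (θ * Complex.I) := by
        rw [Complex.exp_mul_I, Complex.ofReal_cos, Complex.ofReal_sin]
        ring
      have e2 : (ρ * (Real.cos θ : ℝ) - Complex.I * (ρ * (Real.sin θ : ℝ)) : ℂ)
          = ρ * Complex.exp (-(θ * Complex.I)) := by
        rw [← neg_mul, Complex.exp_mul_I, Complex.cos_neg, Complex.sin_neg, Complex.ofReal_cos,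
          Complex.ofReal_sin]
        ring
      have e3 : Complex.exp ((j - k : ℂ) * Complex.I * θ)
          = Complex.exp (θ * Complex.I) ^ j * Complex.exp (-(θ * Complex.I)) ^ k := by
        rw [← Complex.exp_nat_mul, ← Complex.exp_nat_mul, ← Complex.exp_add]
        congr 1
        ring
      rw [e1, e2, e3, Complex.real_smul]
      push_cast
      ring
    · rw [halfDiskWeight, Set.indicator_of_notMem h, Set.indicator_of_notMem (fun h' => h (hmem.2 h'))]
      simp
  rw [setIntegral_congr_fun hset hfun, setIntegral_indicator (measurableSet_Ioc.prod measurableSet_Ioo)]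
  have hinter : polarCoord.target ∩ Set.Ioc (0 : ℝ) 1 ×ˢ Set.Ioo 0 Real.pi
      = Set.Ioc (0 : ℝ) 1 ×ˢ Set.Ioo 0 Real.pi := by
    rw [Set.inter_eq_right]
    rintro ⟨ρ, θ⟩ ⟨h1, h2⟩
    simp only [Set.mem_Ioc, Set.mem_Ioo] at h1 h2
    exact ⟨h1.1, by simp only; linarith [Real.pi_pos], h2.2⟩
  rw [hinter, Measure.volume_eq_prod, setIntegral_prod_mul (fun ρ : ℝ => ((ρ ^ (j + k + 1) : ℝ) : ℂ))
    (fun θ : ℝ => Complex.exp ((j - k : ℂ) * Complex.I * θ)), ← integral_Ioc_eq_integral_Ioo,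
    ← intervalIntegral.integral_of_le Real.pi_pos.le, integral_complex_ofReal,
    ← intervalIntegral.integral_of_le zero_le_one, integral_pow]
  congr 1
  push_cast
  rw [one_pow, zero_pow (by omega)]
  ring

theorem integral_exp_half_turn {c : ℤ} (hc : c ≠ 0) :
    ∫ θ in (0 : ℝ)..Real.pi, Complex.exp ((c : ℂ) * Complex.I * θ)
      = ((-1) ^ c - 1) / (c * Complex.I) := by
  rw [integral_exp_mul_complex (mul_ne_zero (by exact_mod_cast hc) Complex.I_ne_zero)]
  congr 1
  rw [mul_assoc, Complex.exp_int_mul, mul_comm Complex.I, Complex.exp_pi_mul_I]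
  simp

/-- An exponential of nonzero even frequency integrates to zero over a half turn, so both moments
vanish unless j = k. -/
theorem halfDisk_moment_symm {j k : ℕ} (h : Even (j + k)) :
    ∫ p : ℝ × ℝ, halfDiskWeight p *
        ((p.1 + Complex.I * p.2 : ℂ) ^ j * (p.1 - Complex.I * p.2 : ℂ) ^ k)
      = ∫ p : ℝ × ℝ, halfDiskWeight p *
        ((p.1 + Complex.I * p.2 : ℂ) ^ k * (p.1 - Complex.I * p.2 : ℂ) ^ j) := by
  by_cases hjk : j = k
  · rw [hjk]
  have hz : ∀ a b : ℕ, a ≠ b → Even (a + b) →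
      ∫ θ in (0 : ℝ)..Real.pi, Complex.exp ((a - b : ℂ) * Complex.I * θ) = 0 := by
    intro a b hab he
    have h1 := integral_exp_half_turn (c := (a : ℤ) - b) (by omega)
    push_cast at h1
    rw [h1, Even.neg_one_zpow, sub_self, zero_div]
    rw [Int.even_sub]
    exact_mod_cast Nat.even_add.1 he
  rw [integral_halfDiskWeight_mul, integral_halfDiskWeight_mul, hz j k hjk h,
    hz k j (Ne.symm hjk) (by rwa [add_comm]), mul_zero, mul_zero]

/-- For odd frequency j - k the half turn gives 2i/(j - k), which is odd in the frequency, so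
subtracting doubles it. -/
theorem halfDisk_moment_sub {j k : ℕ} (h : Odd (j + k)) :
    (∫ p : ℝ × ℝ, halfDiskWeight p *
        ((p.1 + Complex.I * p.2 : ℂ) ^ j * (p.1 - Complex.I * p.2 : ℂ) ^ k))
      - ∫ p : ℝ × ℝ, halfDiskWeight p *
        ((p.1 + Complex.I * p.2 : ℂ) ^ k * (p.1 - Complex.I * p.2 : ℂ) ^ j)
      = 4 * Complex.I / ((j + k + 2) * (j - k)) := by
  have hne : (j : ℤ) - k ≠ 0 := by
    intro h0
    have : j = k := by omega
    subst this
    exact (Nat.not_odd_iff_even.2 ⟨j, rfl⟩) h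
  have hz : ∀ a b : ℕ, (a : ℤ) - b ≠ 0 → Odd (a + b) →
      ∫ θ in (0 : ℝ)..Real.pi, Complex.exp ((a - b : ℂ) * Complex.I * θ)
        = 2 * Complex.I / (a - b) := by
    intro a b hab he
    have h1 := integral_exp_half_turn (c := (a : ℤ) - b) hab
    push_cast at h1
    have h2 : (a - b : ℂ) ≠ 0 := by exact_mod_cast hab
    rw [h1, Odd.neg_one_zpow]
    · field_simp
      rw [Complex.I_sq]
      norm_num
    · rw [Int.odd_sub]
      exact_mod_cast Nat.odd_add.1 he
  have h2 : (j - k : ℂ) ≠ 0 := by exact_mod_cast hne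
  have h3 : (j + k + 2 : ℂ) ≠ 0 := by norm_cast
  rw [integral_halfDiskWeight_mul, integral_halfDiskWeight_mul, hz j k hne h,
    hz k j (by omega) (by rwa [add_comm]), ← neg_sub (j : ℂ) k, add_comm (k : ℂ) j]
  field_simp
  ring

end HalfDisk

end RootRegion

/-! ### The ordered integral for conjugate pairs -/

namespace RootRegion

open Equiv Equiv.Perm Polynomial

variable {m : ℕ}

/-- The coordinates of `m` points of the upper half plane: real parts on the left, imaginary parts
on the right. -/
abbrev PairIndex (m : ℕ) : Type := (Fin m ⊕ Fin 0) ⊕ Fin m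

/-- The points of the upper half plane with coordinates `x`, followed by their conjugates. -/
noncomputable def conjNodes (m : ℕ) : (PairIndex m → ℝ) →L[ℝ] (PairIndex m → ℂ) :=
  ContinuousLinearMap.pi (Sum.elim
    (Sum.elim (fun k => Complex.ofRealCLM.comp (ContinuousLinearMap.proj (.inl (.inl k)))
      + Complex.I • Complex.ofRealCLM.comp (ContinuousLinearMap.proj (.inr k))) Fin.elim0)
    (fun k => Complex.ofRealCLM.comp (ContinuousLinearMap.proj (.inl (.inl k)))
      - Complex.I • Complex.ofRealCLM.comp (ContinuousLinearMap.proj (.inr k))))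

theorem conjNodes_inl (x : PairIndex m → ℝ) (k : Fin m) :
    conjNodes m x (.inl (.inl k)) = x (.inl (.inl k)) + Complex.I * x (.inr k) := by
  simp [conjNodes]

theorem conjNodes_inr (x : PairIndex m → ℝ) (k : Fin m) :
    conjNodes m x (.inr k) = x (.inl (.inl k)) - Complex.I * x (.inr k) := by
  simp [conjNodes]

theorem conjNodes_inl_re (x : PairIndex m → ℝ) (k : Fin m) :
    (conjNodes m x (.inl (.inl k))).re = x (.inl (.inl k)) := by
  simp [conjNodes_inl]

theorem conjNodes_inl_im (x : PairIndex m → ℝ) (k : Fin m) :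
    (conjNodes m x (.inl (.inl k))).im = x (.inr k) := by
  simp [conjNodes_inl]

theorem conjNodes_inr_re (x : PairIndex m → ℝ) (k : Fin m) :
    (conjNodes m x (.inr k)).re = x (.inl (.inl k)) := by
  simp [conjNodes_inr]

theorem conjNodes_inr_im (x : PairIndex m → ℝ) (k : Fin m) :
    (conjNodes m x (.inr k)).im = -x (.inr k) := by
  simp [conjNodes_inr]

/-- Exchanging the two members of each pair. -/
def pairSwap (m : ℕ) : Perm (PairIndex m) where
  toFun := Sum.elim (Sum.elim (fun k => .inr k) Fin.elim0) (fun k => .inl (.inl k))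
  invFun := Sum.elim (Sum.elim (fun k => .inr k) Fin.elim0) (fun k => .inl (.inl k))
  left_inv := by rintro ((k | s) | k) <;> first | rfl | exact s.elim0
  right_inv := by rintro ((k | s) | k) <;> first | rfl | exact s.elim0

theorem conj_conjNodes (x : PairIndex m → ℝ) (p : PairIndex m) :
    starRingEnd ℂ (conjNodes m x p) = conjNodes m x (pairSwap m p) := by
  rcases p with (k | s) | k
  · change _ = conjNodes m x (.inr k)
    rw [conjNodes_inl, conjNodes_inr]
    simp [sub_eq_add_neg]
  · exact s.elim0
  · change _ = conjNodes m x (.inl (.inl k))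
    rw [conjNodes_inl, conjNodes_inr]
    simp

/-- Conjugation exchanges the nodes within each pair, a permutation of rows; its sign is the
constant required by `volume_image_coeffVec`. -/
theorem conj_vandermondeDet_conjNodes {N : ℕ} (e : PairIndex m ≃ Fin N) (x : PairIndex m → ℝ) :
    starRingEnd ℂ (vandermondeDet e (conjNodes m x))
      = ((sign (pairSwap m) : ℤ) : ℂ) * vandermondeDet e (conjNodes m x) := by
  rw [← vandermondeDet_comp, vandermondeDet, RingHom.map_det, vandermondeDet]
  congr 1
  ext p j
  simp [conj_conjNodes]

/-- Each pair contributes a block with rows (1, i) and (1, -i), of determinant -2i. -/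
theorem norm_det_conjNodes :
    ‖(Matrix.of fun p q : PairIndex m => conjNodes m (Pi.single q 1) p).det‖ = 2 ^ m := by
  have h : (Matrix.of fun p q : PairIndex m => conjNodes m (Pi.single q 1) p)
      = Matrix.fromBlocks 1 (Matrix.of fun x j => if x = .inl j then Complex.I else 0)
        (Matrix.of fun j x => if x = .inl j then 1 else 0) (Matrix.diagonal fun _ => -Complex.I) := by
    ext p q
    rcases p with (k | s) | k
    · rcases q with (l | s) | l
      · simp [conjNodes_inl, Pi.single_apply, Matrix.one_apply]
        split_ifs <;> simp
      · exact s.elim0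
      · simp [conjNodes_inl, Pi.single_apply]
        split_ifs <;> simp
    · exact s.elim0
    · rcases q with (l | s) | l
      · simp [conjNodes_inr, Pi.single_apply, eq_comm]
        split_ifs <;> simp
      · exact s.elim0
      · simp [conjNodes_inr, Pi.single_apply, Matrix.diagonal_apply]
        split_ifs <;> simp
  rw [h, Matrix.det_fromBlocks_one₁₁]
  have h2 : (Matrix.diagonal fun _ : Fin m => -Complex.I)
      - (Matrix.of fun j (x : Fin m ⊕ Fin 0) => if x = .inl j then (1 : ℂ) else 0)
        * (Matrix.of fun (x : Fin m ⊕ Fin 0) j => if x = .inl j then Complex.I else 0)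
      = Matrix.diagonal fun _ : Fin m => -2 * Complex.I := by
    ext a b
    rcases eq_or_ne a b with rfl | hab
    · simp [Matrix.mul_apply]
      ring
    · simp [Matrix.mul_apply, hab, hab.symm]
  rw [h2, Matrix.det_diagonal]
  simp

/-- Coordinates of points of the upper half disk, ordered by real part. -/
def orderedHalfDisk (m : ℕ) : Set (PairIndex m → ℝ) :=
  {x | StrictMono (x ∘ fun k => .inl (.inl k))} ∩ {x | ∀ k, (x (.inl (.inl k)), x (.inr k)) ∈ halfDisk}

theorem measurableSet_forall_halfDisk :
    MeasurableSet {x : PairIndex m → ℝ | ∀ k, (x (.inl (.inl k)), x (.inr k)) ∈ halfDisk} := by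
  have h : {x : PairIndex m → ℝ | ∀ k, (x (.inl (.inl k)), x (.inr k)) ∈ halfDisk}
      = ⋂ k, (fun x : PairIndex m → ℝ => (x (.inl (.inl k)), x (.inr k))) ⁻¹' halfDisk := by
    ext x
    simp
  rw [h]
  exact MeasurableSet.iInter fun k =>
    ((measurable_pi_apply _).prodMk (measurable_pi_apply _)) measurableSet_halfDisk

theorem measurableSet_orderedHalfDisk : MeasurableSet (orderedHalfDisk m) :=
  (measurableSet_strictMono_comp _).inter measurableSet_forall_halfDisk

theorem convex_orderedHalfDisk : Convex ℝ (orderedHalfDisk m) := by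
  refine (convex_strictMono_comp _).inter ?_
  intro x hx y hy a b ha hb hab k
  exact convex_halfDisk (hx k) (hy k) ha hb hab

theorem isBounded_orderedHalfDisk : Bornology.IsBounded (orderedHalfDisk m) := by
  refine (Bornology.IsBounded.pi fun _ : PairIndex m => Metric.isBounded_Icc (-1 : ℝ) 1).subset ?_
  rintro x ⟨-, hx⟩ p -
  rcases p with (k | s) | k
  · exact (halfDisk_subset (hx k)).1
  · exact s.elim0
  · exact (halfDisk_subset (hx k)).2

theorem conjNodes_injective {x : PairIndex m → ℝ} (hx : x ∈ orderedHalfDisk m) :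
    Function.Injective (conjNodes m x) := by
  have hpos : ∀ k, 0 < x (.inr k) := fun k => (hx.2 k).1
  have hinj : ∀ k l, x (.inl (.inl k)) = x (.inl (.inl l)) → k = l := fun k l h =>
    hx.1.injective h
  rintro ((k | s) | k) ((l | s') | l) h
  all_goals try first | exact s.elim0 | exact s'.elim0
  · have h1 := congrArg Complex.re h
    rw [conjNodes_inl_re, conjNodes_inl_re] at h1
    rw [hinj k l h1]
  · have h1 := congrArg Complex.im h
    rw [conjNodes_inl_im, conjNodes_inr_im] at h1
    linarith [hpos k, hpos l]
  · have h1 := congrArg Complex.im h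
    rw [conjNodes_inl_im, conjNodes_inr_im] at h1
    linarith [hpos k, hpos l]
  · have h1 := congrArg Complex.re h
    rw [conjNodes_inr_re, conjNodes_inr_re] at h1
    rw [hinj k l h1]

/-- A permutation of the pairs, acting on both members. -/
def pairPerm (π : Perm (Fin m)) : Perm (PairIndex m) :=
  Perm.sumCongr (Perm.sumCongr π 1) π

/-- The sign of `π` occurs twice. Hence all m! orderings of the pairs contribute equally to the
integral, without signs. -/
theorem sign_pairPerm (π : Perm (Fin m)) : sign (pairPerm π) = 1 := by
  rw [pairPerm, Perm.sign_sumCongr, Perm.sign_sumCongr, Perm.sign_one, mul_one, ← sq,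
    Int.units_sq]

theorem pairPerm_symm (π : Perm (Fin m)) : (pairPerm π).symm = pairPerm π.symm := by
  ext p
  rcases p with (k | s) | k <;> rfl

theorem ae_existsUnique_pairPerm : ∀ᵐ x : PairIndex m → ℝ, ∃! π : Perm (Fin m),
    permCoord (pairPerm π) x ∈ {x | StrictMono (x ∘ fun k => .inl (.inl k))} := by
  have h := volume_not_injective_comp (ι := PairIndex m) (s := fun k : Fin m => .inl (.inl k))
    (Sum.inl_injective.comp Sum.inl_injective)
  filter_upwards [measure_eq_zero_iff_ae_notMem.1 h] with x hx
  simp only [not_not] at hx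
  simp only [permCoord_apply]
  exact existsUnique_strictMono hx

theorem integral_orderedHalfDisk :
    ∫ x in orderedHalfDisk m, vandermondeDet (parityEquiv m 0) (conjNodes m x)
      = (Matrix.of fun a b : Fin m => 4 * Complex.I /
        ((2 * (a : ℂ) + 2 * b + 3) * (2 * (a : ℂ) - 2 * b - 1))).det := by
  set e := parityEquiv m 0 with he
  have hα : ∀ (x : PairIndex m → ℝ) k, conjNodes m x (.inl (.inl k))
      = (fun p : ℝ × ℝ => (p.1 + Complex.I * p.2 : ℂ)) (x (.inl (.inl k)), x (.inr k)) :=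
    conjNodes_inl
  have hβ : ∀ (x : PairIndex m → ℝ) k, conjNodes m x (.inr k)
      = (fun p : ℝ × ℝ => (p.1 - Complex.I * p.2 : ℂ)) (x (.inl (.inl k)), x (.inr k)) :=
    conjNodes_inr
  -- There are no singletons; their node and weight functions are placeholders.
  have hγ : ∀ (x : PairIndex m → ℝ) s, conjNodes m x (.inl (.inr s))
      = (fun _ : ℝ => (0 : ℂ)) (x (.inl (.inr s))) := fun x s => s.elim0
  have hχ : ∀ i j : ℕ, Integrable fun p : ℝ × ℝ => halfDiskWeight p *
      ((p.1 + Complex.I * p.2 : ℂ) ^ i * (p.1 - Complex.I * p.2 : ℂ) ^ j) :=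
    fun i j => integrable_halfDiskWeight_mul (by fun_prop)
  have hη : ∀ i : ℕ, Integrable fun y : ℝ => (fun _ : ℝ => (0 : ℂ)) y * (0 : ℂ) ^ i := by
    intro i
    simp
  have h1 := integral_vandermondeDet_pair e hα hβ hγ hχ hη
  rw [integral_eq_sum_fundamental (fun π : Perm (Fin m) => permCoord (pairPerm π))
    (fun π => measurePreserving_permCoord _)
    (measurableSet_strictMono_comp _) ae_existsUnique_pairPerm
    (integrable_vandermondeDet_pair e hα hβ hγ hχ hη)] at h1
  have h2 : ∀ π : Perm (Fin m),
      ∫ x in {x : PairIndex m → ℝ | StrictMono (x ∘ fun k => .inl (.inl k))},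
        (fun x => vandermondeDet e (conjNodes m x) *
          ((∏ k, halfDiskWeight (x (.inl (.inl k)), x (.inr k)))
            * ∏ s : Fin 0, (fun _ : ℝ => (0 : ℂ)) (x (.inl (.inr s)))))
        ((permCoord (pairPerm π)).symm x)
      = ∫ x in orderedHalfDisk m, vandermondeDet e (conjNodes m x) := by
    intro π
    rw [orderedHalfDisk, Set.inter_comm, ← Measure.restrict_restrict
      measurableSet_forall_halfDisk, ← integral_indicator measurableSet_forall_halfDisk]
    refine setIntegral_congr_fun (measurableSet_strictMono_comp _) fun x hx => ?_
    simp only [permCoord_symm_apply, pairPerm_symm]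
    have h3 : conjNodes m (x ∘ pairPerm π.symm) = conjNodes m x ∘ pairPerm π.symm := by
      funext p
      rcases p with (k | s) | k
      · rw [conjNodes_inl]
        exact (conjNodes_inl x (π.symm k)).symm
      · exact s.elim0
      · rw [conjNodes_inr]
        exact (conjNodes_inr x (π.symm k)).symm
    have h4 : ∏ k, halfDiskWeight ((x ∘ pairPerm π.symm) (.inl (.inl k)),
        (x ∘ pairPerm π.symm) (.inr k))
        = ∏ k, halfDiskWeight (x (.inl (.inl k)), x (.inr k)) :=
      Equiv.prod_comp π.symm (fun k => halfDiskWeight (x (.inl (.inl k)), x (.inr k)))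
    rw [h4, h3, vandermondeDet_comp, sign_pairPerm]
    simp only [Units.val_one, Int.cast_one, one_mul, Finset.univ_eq_empty, Finset.prod_empty, mul_one]
    by_cases hc : ∀ k, (x (.inl (.inl k)), x (.inr k)) ∈ halfDisk
    · rw [Set.indicator_of_mem (show x ∈
        {x : PairIndex m → ℝ | ∀ k, (x (.inl (.inl k)), x (.inr k)) ∈ halfDisk} from hc), Finset.prod_eq_one, mul_one]
      intro k _
      rw [halfDiskWeight, Set.indicator_of_mem (hc k), Pi.one_apply]
    · rw [Set.indicator_of_notMem (show x ∉
        {x : PairIndex m → ℝ | ∀ k, (x (.inl (.inl k)), x (.inr k)) ∈ halfDisk} from hc)]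
      push Not at hc
      obtain ⟨k, hk⟩ := hc
      rw [Finset.prod_eq_zero (Finset.mem_univ k), mul_zero]
      rw [halfDiskWeight, Set.indicator_of_notMem hk]
  rw [Finset.sum_congr rfl fun π _ => h2 π, Finset.sum_const, Finset.card_univ, Fintype.card_perm,
    nsmul_eq_mul, pairSum_eq_det] at h1
  · have h6 := mul_left_cancel₀ (Nat.cast_ne_zero.2 (Nat.factorial_ne_zero _)) h1
    rw [h6, ← Matrix.det_reindex_self (Equiv.sumEmpty (Fin m) (Fin 0))]
    congr 1
    ext a b
    simp only [Matrix.reindex_apply, Matrix.submatrix_apply, Equiv.sumEmpty_symm_apply,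
      Matrix.of_apply, Sum.elim_inl]
    rw [halfDisk_moment_sub]
    · simp only [he, parityEquiv_pair_fst, parityEquiv_pair_snd]
      push_cast
      congr 2 <;> ring
    · simp only [he, parityEquiv_pair_fst, parityEquiv_pair_snd]
      exact ⟨a + b, by ring⟩
  · intro x y
    exact halfDisk_moment_symm ((parityEquiv_inl_even zero_le_one x).add
      (parityEquiv_inl_even zero_le_one y))
  · intro x y
    refine halfDisk_moment_symm ?_
    simp only [he, parityEquiv_pair_snd]
    exact ⟨x + y + 1, by ring⟩
  · intro s
    exact s.elim0

end RootRegion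

/-! ### The volume of the region without real roots -/

namespace RootRegion

open Polynomial

section ComplexPairs

variable {m : ℕ}

/-- The real polynomial whose roots are the given points of the upper half plane and their
conjugates. -/
noncomputable def conjPoly (x : PairIndex m → ℝ) : ℝ[X] :=
  ∏ k : Fin m, ((X - C (x (.inl (.inl k)))) ^ 2 + C (x (.inr k) ^ 2))

theorem map_conjPoly (x : PairIndex m → ℝ) :
    (conjPoly x).map (algebraMap ℝ ℂ) = ∏ p, (X - C (conjNodes m x p)) := by
  rw [Fintype.prod_sum_type, Fintype.prod_sum_type, Finset.univ_eq_empty (α := Fin 0),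
    Finset.prod_empty, mul_one, ← Finset.prod_mul_distrib, conjPoly, Polynomial.map_prod]
  refine Finset.prod_congr rfl fun k _ => ?_
  have h : (C Complex.I : ℂ[X]) ^ 2 = -1 := by
    rw [← C_pow, Complex.I_sq, C_neg, C_1]
  rw [conjNodes_inl, conjNodes_inr]
  simp only [Polynomial.map_add, Polynomial.map_pow, Polynomial.map_sub, map_X, map_C,
    Complex.coe_algebraMap, C_add, C_sub, C_mul, C_pow]
  linear_combination (C ((x (.inr k) : ℝ) : ℂ)) ^ 2 * h

theorem monic_conjPoly (x : PairIndex m → ℝ) : (conjPoly x).Monic := by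
  apply Polynomial.monic_of_injective (algebraMap ℝ ℂ).injective
  rw [map_conjPoly]
  exact monic_prod_of_monic _ _ fun _ _ => monic_X_sub_C _

theorem natDegree_conjPoly (x : PairIndex m → ℝ) : (conjPoly x).natDegree = 2 * m := by
  rw [← (monic_conjPoly x).natDegree_map (algebraMap ℝ ℂ), map_conjPoly,
    natDegree_finsetProd_X_sub_C_eq_card, Finset.card_univ]
  simp
  ring

theorem differentiable_coeff_conjPoly (k : ℕ) :
    Differentiable ℝ fun x : PairIndex m → ℝ => (conjPoly x).coeff k := by
  have h : ∀ (i : Fin m) (k : ℕ), Differentiable ℝ fun x : PairIndex m → ℝ =>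
      (X - C (x (.inl (.inl i)))).coeff k := by
    intro i k
    simp only [coeff_sub, coeff_C]
    split_ifs <;> fun_prop
  refine differentiable_coeff_prod _ (fun i k => ?_) k
  simp only [coeff_add, sq (X - C _)]
  refine (differentiable_coeff_mul (h i) (h i) k).add ?_
  simp only [coeff_C]
  split_ifs <;> fun_prop

theorem aeval_conjPoly_eq_zero {x : PairIndex m → ℝ} {z : ℂ} :
    aeval z (conjPoly x) = 0 ↔ ∃ p, z = conjNodes m x p := by
  rw [← eval_map_algebraMap, map_conjPoly, eval_prod, Finset.prod_eq_zero_iff]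
  simp [sub_eq_zero]

theorem exists_eq_of_conjPoly_eq {x y : PairIndex m → ℝ} (hx : x ∈ orderedHalfDisk m)
    (hy : y ∈ orderedHalfDisk m) (hxy : conjPoly x = conjPoly y) (k : Fin m) :
    ∃ l, y (.inl (.inl l)) = x (.inl (.inl k)) ∧ y (.inr l) = x (.inr k) := by
  have h2 : aeval (conjNodes m x (.inl (.inl k))) (conjPoly y) = 0 := by
    rw [← hxy, aeval_conjPoly_eq_zero]
    exact ⟨_, rfl⟩
  obtain ⟨(l | s) | l, hl⟩ := aeval_conjPoly_eq_zero.1 h2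
  · have hre := congrArg Complex.re hl
    have him := congrArg Complex.im hl
    rw [conjNodes_inl_re, conjNodes_inl_re] at hre
    rw [conjNodes_inl_im, conjNodes_inl_im] at him
    exact ⟨l, hre.symm, him.symm⟩
  · exact s.elim0
  · have him := congrArg Complex.im hl
    rw [conjNodes_inl_im, conjNodes_inr_im] at him
    have h3 : 0 < x (.inr k) := (hx.2 k).1
    have h4 : 0 < y (.inr l) := (hy.2 l).1
    linarith

/-- The real parts are strictly increasing, hence determined by their range; being distinct, each of
them also determines the imaginary part that goes with it. -/
theorem conjPoly_injOn : Set.InjOn (conjPoly (m := m)) (orderedHalfDisk m) := by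
  intro x hx y hy hxy
  have h1 : (x ∘ fun k => .inl (.inl k)) = y ∘ fun k => .inl (.inl k) := by
    rw [← StrictMono.range_inj hx.1 hy.1]
    apply Set.Subset.antisymm
    · rintro _ ⟨k, rfl⟩
      obtain ⟨l, hl, -⟩ := exists_eq_of_conjPoly_eq hx hy hxy k
      exact ⟨l, hl⟩
    · rintro _ ⟨k, rfl⟩
      obtain ⟨l, hl, -⟩ := exists_eq_of_conjPoly_eq hy hx hxy.symm k
      exact ⟨l, hl⟩
  funext p
  rcases p with (k | s) | k
  · exact congrFun h1 k
  · exact s.elim0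
  · obtain ⟨l, hl, hl'⟩ := exists_eq_of_conjPoly_eq hx hy hxy k
    have h2 : l = k := hy.1.injective (hl.trans (congrFun h1 k))
    rw [← hl', h2]

theorem monicPoly_coeffVec_conjPoly (x : PairIndex m → ℝ) :
    monicPoly (coeffVec (2 * m) conjPoly x) = conjPoly x :=
  monicPoly_coeff (monic_conjPoly x) (natDegree_conjPoly x)

/-- The real and imaginary parts of `m` complex numbers. -/
def pairCoords (z : Fin m → ℂ) : PairIndex m → ℝ :=
  Sum.elim (Sum.elim (fun k => (z k).re) Fin.elim0) (fun k => (z k).im)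

theorem conjPoly_pairCoords_comp (z : Fin m → ℂ) (σ : Equiv.Perm (Fin m)) :
    conjPoly (pairCoords (z ∘ σ)) = conjPoly (pairCoords z) :=
  Equiv.prod_comp σ fun k => (X - C (z k).re) ^ 2 + C ((z k).im ^ 2)

theorem map_conj_complexRoots {N : ℕ} (a : Fin N → ℝ) :
    (complexRoots a).map (starRingEnd ℂ) = complexRoots a := by
  rw [complexRoots, roots_map_of_injective_of_card_eq_natDegree (starRingEnd ℂ).injective
    IsAlgClosed.card_roots_eq_natDegree, Polynomial.map_map]
  congr 2
  ext x
  simp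

theorem exists_conjPoly_eq {a : Fin (2 * m) → ℝ} (ha : a ∈ Omega (2 * m))
    (ha' : a ∈ noRealRoots (2 * m)) :
    ∃ z : Fin m → ℂ, (∀ k, ((z k).re, (z k).im) ∈ halfDisk) ∧
      monicPoly a = conjPoly (pairCoords z) := by
  have him : ∀ z ∈ complexRoots a, z.im ≠ 0 := by
    intro z hz h0
    have hz' : ((z.re : ℝ) : ℂ) = z := Complex.ext (by simp) (by simp [h0])
    rw [mem_complexRoots, ← hz', ← Complex.coe_algebraMap, aeval_algebraMap_apply] at hz
    exact ha' z.re (by simpa using hz)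
  -- Conjugation preserves the multiset of roots and exchanges the open half planes, so exactly m of
  -- the 2m roots lie above the real axis.
  have hneg : (complexRoots a).filter (fun z => ¬ 0 < z.im)
      = ((complexRoots a).filter (fun z => 0 < z.im)).map (starRingEnd ℂ) := by
    conv_lhs => rw [Multiset.filter_congr (q := fun z => z.im < 0) (fun z hz => by
      rw [not_lt, le_iff_lt_or_eq]
      simp [him z hz]), ← map_conj_complexRoots, Multiset.filter_map]
    congr 1
    exact Multiset.filter_congr fun z _ => by simp
  have hsum := Multiset.filter_add_not (fun z : ℂ => 0 < z.im) (complexRoots a)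
  rw [hneg] at hsum
  have hcard := congrArg Multiset.card hsum
  rw [Multiset.card_add, Multiset.card_map, card_complexRoots] at hcard
  obtain ⟨z, hz⟩ := exists_fin_map_eq (n := m) ((complexRoots a).filter (fun z => 0 < z.im))
    (by omega)
  have hmem : ∀ k, z k ∈ (complexRoots a).filter (fun z => 0 < z.im) := by
    intro k
    rw [← hz]
    exact Multiset.mem_map_of_mem _ (Finset.mem_univ k)
  refine ⟨z, fun k => ?_, ?_⟩
  · obtain ⟨h1, h2⟩ := Multiset.mem_filter.1 (hmem k)
    refine ⟨h2, ?_⟩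
    have h3 := mem_Omega_iff.1 ha _ h1
    rw [← sq_le_one_iff₀ (norm_nonneg _), Complex.sq_norm, Complex.normSq_apply] at h3
    simp only
    nlinarith
  · apply Polynomial.map_injective (algebraMap ℝ ℂ) (algebraMap ℝ ℂ).injective
    rw [map_monicPoly_eq_prod, ← hsum, ← hz, map_conjPoly, Fintype.prod_sum_type,
      Fintype.prod_sum_type, Finset.univ_eq_empty (α := Fin 0), Finset.prod_empty, mul_one,
      Multiset.map_add, Multiset.prod_add, Multiset.map_map, Multiset.map_map, Multiset.map_map]
    have hl : ∀ k, conjNodes m (pairCoords z) (.inl (.inl k)) = z k := fun k =>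
      Complex.ext (conjNodes_inl_re _ _) (conjNodes_inl_im _ _)
    have hr : ∀ k, conjNodes m (pairCoords z) (.inr k) = starRingEnd ℂ (z k) := fun k =>
      Complex.ext (conjNodes_inr_re _ _) (conjNodes_inr_im _ _)
    simp only [hl, hr]
    rfl

theorem norm_conjNodes_le_one {x : PairIndex m → ℝ} (hx : x ∈ orderedHalfDisk m)
    (p : PairIndex m) : ‖conjNodes m x p‖ ≤ 1 := by
  rw [← sq_le_one_iff₀ (norm_nonneg _), Complex.sq_norm, Complex.normSq_apply]
  rcases p with (k | s) | k
  · have h := (hx.2 k).2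
    rw [conjNodes_inl_re, conjNodes_inl_im]
    simp only at h
    nlinarith
  · exact s.elim0
  · have h := (hx.2 k).2
    rw [conjNodes_inr_re, conjNodes_inr_im]
    simp only at h
    nlinarith

theorem im_conjNodes_ne_zero {x : PairIndex m → ℝ} (hx : x ∈ orderedHalfDisk m)
    (p : PairIndex m) : (conjNodes m x p).im ≠ 0 := by
  rcases p with (k | s) | k
  · rw [conjNodes_inl_im]
    exact (hx.2 k).1.ne'
  · exact s.elim0
  · rw [conjNodes_inr_im]
    exact neg_ne_zero.2 (hx.2 k).1.ne'

theorem volume_nonreal_region :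
    volume (Omega (2 * m) ∩ noRealRoots (2 * m))
      = ENNReal.ofReal (2 ^ m * ‖(Matrix.of fun a b : Fin m => 4 * Complex.I /
        ((2 * (a : ℂ) + 2 * b + 3) * (2 * (a : ℂ) - 2 * b - 1))).det‖) := by
  have hvol := volume_image_coeffVec (parityEquiv m 0) (conjNodes m)
    (Pol := conjPoly) differentiable_coeff_conjPoly map_conjPoly
    measurableSet_orderedHalfDisk convex_orderedHalfDisk isBounded_orderedHalfDisk
    conjPoly_injOn (fun x hx => conjNodes_injective hx) (conj_vandermondeDet_conjNodes _)
  rw [norm_det_conjNodes, integral_orderedHalfDisk] at hvol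
  change volume (coeffVec (2 * m) conjPoly '' _) = _ at hvol
  rw [← hvol]
  refine le_antisymm ?_ (measure_mono ?_)
  · have hnull := volume_image_coeffVec_eq_zero (parityEquiv m 0) (Pol := conjPoly)
      differentiable_coeff_conjPoly
      (volume_not_injective_comp (s := fun k : Fin m => .inl (.inl k))
        (Sum.inl_injective.comp Sum.inl_injective))
    change volume (coeffVec (2 * m) conjPoly '' _) = _ at hnull
    have hsub : Omega (2 * m) ∩ noRealRoots (2 * m)
        ⊆ coeffVec (2 * m) conjPoly '' orderedHalfDisk m ∪ coeffVec (2 * m) conjPoly ''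
          {x : PairIndex m → ℝ | ¬ Function.Injective (x ∘ fun k => .inl (.inl k))} := by
      rintro a ⟨ha, ha'⟩
      obtain ⟨z, hz, hza⟩ := exists_conjPoly_eq ha ha'
      have hcoeff : ∀ x : PairIndex m → ℝ, conjPoly x = conjPoly (pairCoords z) →
          coeffVec (2 * m) conjPoly x = a := by
        intro x hx
        funext i
        rw [coeffVec, hx, ← hza, coeff_monicPoly]
      set f : Fin m → ℝ := fun k => (z k).re with hf
      by_cases hinj : Function.Injective f
      · left
        refine ⟨pairCoords (z ∘ Tuple.sort f), ⟨?_, fun k => hz _⟩,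
          hcoeff _ (conjPoly_pairCoords_comp _ _)⟩
        exact (Tuple.monotone_sort f).strictMono_of_injective
            (hinj.comp (Tuple.sort f).injective)
      · exact Or.inr ⟨pairCoords z, hinj, hcoeff _ rfl⟩
    calc _ ≤ _ := measure_mono hsub
      _ ≤ _ := measure_union_le _ _
      _ = _ := by rw [hnull, add_zero]
  · rintro _ ⟨x, hx, rfl⟩
    constructor
    · intro z hz
      rw [monicPoly_coeffVec_conjPoly, aeval_conjPoly_eq_zero] at hz
      obtain ⟨p, rfl⟩ := hz
      exact norm_conjNodes_le_one hx p
    · intro t ht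
      rw [monicPoly_coeffVec_conjPoly] at ht
      have h1 : aeval (t : ℂ) (conjPoly x) = 0 := by
        rw [← Complex.coe_algebraMap, aeval_algebraMap_apply]
        simp [ht]
      obtain ⟨p, hp⟩ := aeval_conjPoly_eq_zero.1 h1
      exact im_conjNodes_ne_zero hx p (by rw [← hp, Complex.ofReal_im])

end ComplexPairs

end RootRegion

/-! ### Cauchy determinants -/

namespace RootRegion

section Cauchy

variable {K : Type*} [Field K] {x y : ℕ → K}

/-- The Cauchy determinant `det (1 / (x i + y j))` of size `m`. -/
def cauchyDet (x y : ℕ → K) (m : ℕ) : K := (Matrix.of fun i j : Fin m => (x i + y j)⁻¹).det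

theorem cauchyDet_zero (x y : ℕ → K) : cauchyDet x y 0 = 1 := Matrix.det_isEmpty

theorem det_mul_row_mul_column {ι : Type*} [Fintype ι] [DecidableEq ι] (u v : ι → K)
    (A : Matrix ι ι K) :
    (Matrix.of fun i j => u i * (v j * A i j)).det = (∏ i, u i) * ((∏ j, v j) * A.det) := by
  rw [← Matrix.det_mul_row, ← Matrix.det_mul_column]
  rfl

/-- Scale the last row to make the corner entry 1 and take the Schur complement. Its entries
1/(xᵢ+yⱼ) - (xₘ+yₘ)/((xᵢ+yₘ)(xₘ+yⱼ)) form a Cauchy matrix with rescaled rows and columns. -/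
theorem cauchyDet_succ (h : ∀ i j, x i + y j ≠ 0) (m : ℕ) :
    cauchyDet x y (m + 1) = (x m + y m)⁻¹ * (∏ i ∈ Finset.range m,
      ((x i - x m) / (x i + y m) * ((y i - y m) / (x m + y i)))) * cauchyDet x y m := by
  have h1 : cauchyDet x y (m + 1) = (Matrix.of fun i j : Fin m ⊕ Fin 1 =>
      Sum.elim (fun _ => 1) (fun _ => (x m + y m)⁻¹) i * ((fun _ => 1) j *
      (Matrix.fromBlocks (Matrix.of fun i j : Fin m => (x i + y j)⁻¹)
        (Matrix.of fun i _ => (x i + y m)⁻¹)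
        (Matrix.of fun _ j => (x m + y m) * (x m + y j)⁻¹) 1) i j)).det := by
    rw [cauchyDet, ← Matrix.det_reindex_self finSumFinEquiv.symm]
    congr 1
    ext i j
    rcases i with i | i <;> rcases j with j | j
    · simp
    · simp
    · simp [h m m]
    · have hi := Subsingleton.elim i 0
      have hj := Subsingleton.elim j 0
      subst hi hj
      simp
  rw [h1, det_mul_row_mul_column, Matrix.det_fromBlocks_one₂₂]
  have h2 : (Matrix.of fun i j : Fin m => (x i + y j)⁻¹)
      - (Matrix.of fun (i : Fin m) (_ : Fin 1) => (x i + y m)⁻¹)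
        * (Matrix.of fun (_ : Fin 1) (j : Fin m) => (x m + y m) * (x m + y j)⁻¹)
      = Matrix.of fun i j : Fin m => (x i - x m) / (x i + y m) * ((y j - y m) / (x m + y j)
        * (Matrix.of fun i j : Fin m => (x i + y j)⁻¹) i j) := by
    ext i j
    simp only [Matrix.sub_apply, Matrix.mul_apply, Matrix.of_apply, Finset.univ_unique,
      Finset.sum_singleton]
    have := h i j
    have := h i m
    have := h m j
    field_simp
    ring
  rw [h2, det_mul_row_mul_column, Fin.prod_univ_eq_prod_range (fun i => (x i - x m) / (x i + y m)),
    Fin.prod_univ_eq_prod_range (fun j => (y j - y m) / (x m + y j)), cauchyDet, Finset.prod_mul_distrib]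
  simp
  ring

/-- The column of ones is a rescaled Cauchy column with its y sent to infinity; it stems from the
unpaired root in odd degree. The Schur complement is again a rescaled Cauchy matrix. -/
theorem det_fromBlocks_cauchy (h : ∀ i j, x i + y j ≠ 0) (m : ℕ) :
    (Matrix.fromBlocks (Matrix.of fun i j : Fin m => (x i + y j)⁻¹)
        (Matrix.of fun _ (_ : Fin 1) => 1) (Matrix.of fun _ j => (x m + y j)⁻¹) 1).det
      = (∏ i ∈ Finset.range m, (x m - x i)) * (∏ j ∈ Finset.range m, (x m + y j)⁻¹)
        * cauchyDet x y m := by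
  rw [Matrix.det_fromBlocks_one₂₂]
  have h2 : (Matrix.of fun i j : Fin m => (x i + y j)⁻¹)
      - (Matrix.of fun (_ : Fin m) (_ : Fin 1) => (1 : K))
        * (Matrix.of fun (_ : Fin 1) (j : Fin m) => (x m + y j)⁻¹)
      = Matrix.of fun i j : Fin m => (x m - x i) * ((x m + y j)⁻¹
        * (Matrix.of fun i j : Fin m => (x i + y j)⁻¹) i j) := by
    ext i j
    simp only [Matrix.sub_apply, Matrix.mul_apply, Matrix.of_apply, Finset.univ_unique,
      Finset.sum_singleton]
    have := h i j
    have := h m j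
    field_simp
    ring
  rw [h2, det_mul_row_mul_column, Fin.prod_univ_eq_prod_range (fun i => x m - x i),
    Fin.prod_univ_eq_prod_range (fun j => (x m + y j)⁻¹), cauchyDet]
  ring

end Cauchy

/-! ### Products of arithmetic progressions -/

section Products

open Finset

theorem prod_two_mul_sub (n : ℕ) :
    ∏ i ∈ range n, (2 * (n : ℝ) - 2 * i) = 2 ^ n * n.factorial := by
  induction n with
  | zero => simp
  | succ n ih =>
    rw [prod_range_succ', prod_congr rfl fun i _ => show
      (2 * ((n + 1 : ℕ) : ℝ) - 2 * ((i + 1 : ℕ) : ℝ)) = 2 * (n : ℝ) - 2 * i by push_cast; ring, ih,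
      Nat.factorial_succ]
    push_cast
    ring

theorem prod_two_mul_sub_sub_one (n : ℕ) :
    (∏ i ∈ range n, (2 * (n : ℝ) - 2 * i - 1)) * (2 ^ n * n.factorial) = (2 * n).factorial := by
  induction n with
  | zero => simp
  | succ n ih =>
    rw [prod_range_succ', prod_congr rfl fun i _ => show
      (2 * ((n + 1 : ℕ) : ℝ) - 2 * ((i + 1 : ℕ) : ℝ) - 1) = 2 * (n : ℝ) - 2 * i - 1 by
        push_cast; ring, Nat.factorial_succ, show 2 * (n + 1) = 2 * n + 1 + 1 by ring,
      Nat.factorial_succ, Nat.factorial_succ]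
    push_cast
    rw [← ih]
    ring

theorem prod_two_mul_sub_add_one (n : ℕ) :
    (∏ i ∈ range n, (2 * (n : ℝ) - 2 * i + 1)) * (2 ^ n * n.factorial) = (2 * n + 1).factorial := by
  induction n with
  | zero => simp
  | succ n ih =>
    rw [prod_range_succ', prod_congr rfl fun i _ => show
      (2 * ((n + 1 : ℕ) : ℝ) - 2 * ((i + 1 : ℕ) : ℝ) + 1) = 2 * (n : ℝ) - 2 * i + 1 by
        push_cast; ring, Nat.factorial_succ, show 2 * (n + 1) + 1 = 2 * n + 1 + 1 + 1 by ring,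
      Nat.factorial_succ, Nat.factorial_succ (2 * n + 1)]
    push_cast
    rw [← ih]
    ring

theorem prod_two_mul_add_two (c n : ℕ) :
    (∏ i ∈ range n, (2 * (i : ℝ) + 2 * c + 2)) * c.factorial = 2 ^ n * (c + n).factorial := by
  induction n with
  | zero => simp
  | succ n ih =>
    rw [prod_range_succ, mul_right_comm, ih, ← add_assoc, Nat.factorial_succ]
    push_cast
    ring

theorem prod_two_mul_add_three (c n : ℕ) :
    (∏ i ∈ range n, (2 * (c : ℝ) + 2 * i + 3)) * (2 ^ n * (c + n).factorial * (2 * c + 1).factorial)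
      = (2 * (c + n) + 1).factorial * c.factorial := by
  induction n with
  | zero => simp; ring
  | succ n ih =>
    rw [prod_range_succ, show 2 * (c + (n + 1)) + 1 = 2 * (c + n) + 1 + 1 + 1 by ring, ← add_assoc,
      Nat.factorial_succ (c + n), Nat.factorial_succ (2 * (c + n) + 1 + 1),
      Nat.factorial_succ (2 * (c + n) + 1)]
    push_cast
    linear_combination (2 * ((c : ℝ) + n) + 3) * (2 * ((c : ℝ) + n) + 2) * ih

/-- This product enters both steps of `DPlus` from 2m to 2m+2; its square is the product in the
Cauchy recursion. -/
theorem prod_ratio_eq (m : ℕ) :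
    (∏ i ∈ range m, (2 * (m : ℝ) - 2 * i) / (2 * m + 2 * i + 3))
      = 2 ^ (2 * m) * (2 * m).factorial * (2 * m + 1).factorial / (4 * m + 1).factorial := by
  have h := prod_two_mul_add_three m m
  rw [show 2 * (m + m) + 1 = 4 * m + 1 by ring, ← two_mul] at h
  have hpos : ∏ i ∈ range m, (2 * (m : ℝ) + 2 * i + 3) ≠ 0 :=
    prod_ne_zero_iff.2 fun i _ => by positivity
  rw [prod_div_distrib, prod_two_mul_sub, div_eq_div_iff hpos (by positivity)]
  have h2 : (2 : ℝ) ^ m ≠ 0 := by positivity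
  apply mul_left_cancel₀ h2
  rw [pow_mul' (2 : ℝ) 2 m]
  linear_combination (-(2 ^ m) ^ 2 : ℝ) * h

end Products

/-! ### Evaluation of the determinant for real roots -/

section Real

theorem DPlus_succ (N : ℕ) : DPlus (N + 1)
    = DPlus N * ((2 : ℝ) ^ (N + 1) * (N.factorial : ℝ) ^ 2 / ((2 * N + 1).factorial : ℝ)) := by
  rw [DPlus, Finset.prod_range_succ, DPlus]

theorem DPlus_pos (N : ℕ) : 0 < DPlus N :=
  Finset.prod_pos fun k _ => by positivity

theorem DPlus_two_mul_add_one (m : ℕ) : DPlus (2 * m + 1) = 2 / (2 * m + 1) *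
    (∏ i ∈ Finset.range m, (2 * (m : ℝ) - 2 * i) / (2 * m + 2 * i + 3)) * DPlus (2 * m) := by
  rw [DPlus_succ, prod_ratio_eq, Nat.factorial_succ (2 * m), show 2 * (2 * m) + 1 = 4 * m + 1 by ring]
  push_cast
  field_simp
  ring

theorem DPlus_two_mul_add_two (m : ℕ) : DPlus (2 * m + 2) = 2 / (4 * m + 3) *
    (∏ i ∈ Finset.range m, (2 * (m : ℝ) - 2 * i) / (2 * m + 2 * i + 3)) * DPlus (2 * m + 1) := by
  rw [DPlus_succ, prod_ratio_eq, Nat.factorial_succ (2 * m),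
    show 2 * (2 * m + 1) + 1 = 4 * m + 1 + 1 + 1 by ring, Nat.factorial_succ (4 * m + 1 + 1),
    Nat.factorial_succ (4 * m + 1)]
  push_cast
  field_simp
  ring

theorem DPlus_two_mul_eq_cauchyDet (m : ℕ) : DPlus (2 * m) =
    4 ^ m * (∏ i ∈ Finset.range m, (2 * (i : ℝ) + 1)⁻¹)
      * cauchyDet (fun i => 2 * (i : ℝ) + 1) (fun j => 2 * (j : ℝ) + 2) m := by
  induction m with
  | zero => simp [DPlus, cauchyDet_zero]
  | succ m ih =>
    rw [show 2 * (m + 1) = 2 * m + 2 by ring, DPlus_two_mul_add_two, DPlus_two_mul_add_one, ih,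
      cauchyDet_succ (fun i j => by positivity), Finset.prod_range_succ (fun i : ℕ => (2 * (i : ℝ) + 1)⁻¹)]
    have h1 : ∏ i ∈ Finset.range m, (((2 * (i : ℝ) + 1) - (2 * m + 1)) / ((2 * (i : ℝ) + 1)
        + (2 * m + 2)) * (((2 * (i : ℝ) + 2) - (2 * m + 2)) / ((2 * (m : ℝ) + 1) + (2 * i + 2))))
        = (∏ i ∈ Finset.range m, (2 * (m : ℝ) - 2 * i) / (2 * m + 2 * i + 3)) ^ 2 := by
      rw [← Finset.prod_pow]
      refine Finset.prod_congr rfl fun i _ => ?_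
      rw [show (2 * (i : ℝ) + 1) + (2 * m + 2) = 2 * m + 2 * i + 3 by ring,
        show (2 * (m : ℝ) + 1) + (2 * i + 2) = 2 * m + 2 * i + 3 by ring]
      ring
    rw [h1, show (2 * (m : ℝ) + 1) + (2 * m + 2) = 4 * m + 3 by ring]
    ring

theorem realMomentMatrix_zero_eq_map (m : ℕ) :
    Matrix.reindex (Equiv.sumEmpty (Fin m) (Fin 0)) (Equiv.sumEmpty (Fin m) (Fin 0))
      (realMomentMatrix m 0)
    = (algebraMap ℝ ℂ).mapMatrix (Matrix.of fun i j : Fin m => (2 * (i : ℝ) + 1)⁻¹ *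
      ((fun _ => 4) j * (Matrix.of fun i j : Fin m =>
        ((fun i : ℕ => 2 * (i : ℝ) + 1) i + (fun j : ℕ => 2 * (j : ℝ) + 2) j)⁻¹) i j)) := by
  ext i j
  simp only [realMomentMatrix, Matrix.reindex_apply, Matrix.submatrix_apply,
    Equiv.sumEmpty_symm_apply, Matrix.of_apply, Sum.elim_inl, parityEquiv_pair_fst,
    RingHom.mapMatrix_apply, Matrix.map_apply, Complex.coe_algebraMap]
  push_cast
  rw [show (2 * (i : ℂ) + 1 + (2 * (j : ℂ) + 2)) = 2 * i + 2 * j + 3 by ring, div_eq_mul_inv,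
    mul_inv]
  ring

theorem det_realMomentMatrix_zero (m : ℕ) : (realMomentMatrix m 0).det = DPlus (2 * m) := by
  rw [← Matrix.det_reindex_self (Equiv.sumEmpty (Fin m) (Fin 0)), realMomentMatrix_zero_eq_map,
    ← RingHom.map_det, det_mul_row_mul_column, DPlus_two_mul_eq_cauchyDet, cauchyDet,
    Fin.prod_univ_eq_prod_range (fun i => (2 * (i : ℝ) + 1)⁻¹), Finset.prod_const, Finset.card_univ,
    Fintype.card_fin, Complex.coe_algebraMap]
  congr 1
  ring

theorem realMomentMatrix_one_eq_map (m : ℕ) : realMomentMatrix m 1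
    = (algebraMap ℝ ℂ).mapMatrix (Matrix.of fun i j : Fin m ⊕ Fin 1 =>
      Sum.elim (fun i : Fin m => (2 * (i : ℝ) + 1)⁻¹) (fun _ => (2 * (m : ℝ) + 1)⁻¹) i *
      (Sum.elim (fun _ : Fin m => 4) (fun _ => 2) j *
      (Matrix.fromBlocks (Matrix.of fun i j : Fin m =>
          ((fun i : ℕ => 2 * (i : ℝ) + 1) i + (fun j : ℕ => 2 * (j : ℝ) + 2) j)⁻¹)
        (Matrix.of fun _ (_ : Fin 1) => 1)
        (Matrix.of fun _ (j : Fin m) =>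
          ((fun i : ℕ => 2 * (i : ℝ) + 1) m + (fun j : ℕ => 2 * (j : ℝ) + 2) j)⁻¹) 1) i j)) := by
  have h : ∀ (i j : ℕ) , (2 * (i : ℂ) + 1 + (2 * (j : ℂ) + 2)) = 2 * i + 2 * j + 3 := by
    intro i j
    ring
  ext i j
  rcases i with i | i <;> rcases j with j | j
  · simp [realMomentMatrix, parityEquiv_pair_fst, h, div_eq_mul_inv]
    ring
  · simp [realMomentMatrix, parityEquiv_pair_fst, div_eq_mul_inv]
    ring
  · simp [realMomentMatrix, parityEquiv_single, h, div_eq_mul_inv]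
    ring
  · have hi := Subsingleton.elim i j
    subst hi
    simp [realMomentMatrix, parityEquiv_single, div_eq_mul_inv]
    ring

theorem det_realMomentMatrix_one (m : ℕ) : (realMomentMatrix m 1).det = DPlus (2 * m + 1) := by
  rw [realMomentMatrix_one_eq_map, ← RingHom.map_det, det_mul_row_mul_column,
    det_fromBlocks_cauchy (x := fun i : ℕ => 2 * (i : ℝ) + 1)
      (y := fun j : ℕ => 2 * (j : ℝ) + 2) (fun i j => by positivity), DPlus_two_mul_add_one,
    DPlus_two_mul_eq_cauchyDet, Fintype.prod_sum_type, Fintype.prod_sum_type]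
  simp only [Sum.elim_inl, Sum.elim_inr]
  rw [Fin.prod_univ_eq_prod_range (fun i => (2 * (i : ℝ) + 1)⁻¹), Finset.prod_const,
    Finset.card_univ, Fintype.card_fin, Complex.coe_algebraMap]
  congr 1
  have h : ∏ i ∈ Finset.range m, (2 * (m : ℝ) - 2 * i) / (2 * m + 2 * i + 3)
      = (∏ i ∈ Finset.range m, (2 * (m : ℝ) + 1 - (2 * i + 1)))
        * ∏ i ∈ Finset.range m, (2 * (m : ℝ) + 1 + (2 * i + 2))⁻¹ := by
    rw [← Finset.prod_mul_distrib]
    refine Finset.prod_congr rfl fun i _ => ?_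
    rw [show (2 * (m : ℝ) + 1) + (2 * i + 2) = 2 * m + 2 * i + 3 by ring]
    ring
  rw [h]
  simp
  ring

end Real

/-! ### Evaluation of the determinant for conjugate pairs -/

section Nonreal

theorem odd_sq_sub_even_sq_ne_zero (i j : ℕ) : (2 * (i : ℝ) + 1) ^ 2 + -(2 * (j : ℝ) + 2) ^ 2 ≠ 0 := by
  have h : (2 * (i : ℝ) + 1) ^ 2 + -(2 * (j : ℝ) + 2) ^ 2
      = (2 * i + 2 * j + 3) * (2 * i - 2 * j - 1) := by ring
  rw [h]
  refine mul_ne_zero (by positivity) fun h0 => ?_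
  have h1 : 2 * (i : ℤ) - 2 * j - 1 = 0 := by exact_mod_cast h0
  omega

/-- In absolute value, the product in the Cauchy recursion for (2i+1)² and -(2j+2)² exceeds the one
for 2i+1 and 2j+2 by this factor, the source of the extra power of 2 in `DMinus`. -/
theorem prod_nonreal_ratio (n : ℕ) :
    ∏ i ∈ Finset.range n, ((2 * (i : ℝ) + 2 * n + 2) * (2 * i + 2 * (n + 1 : ℕ) + 2)
        / ((2 * n - 2 * i + 1) * (2 * n - 2 * i - 1))) = 2 ^ (4 * n) / (n + 1) := by
  have h1 := prod_two_mul_add_two n n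
  have h2 := prod_two_mul_add_two (n + 1) n
  have h3 := prod_two_mul_sub_add_one n
  have h4 := prod_two_mul_sub_sub_one n
  have hp : ((2 * n).factorial : ℝ) ≠ 0 := by positivity
  have hq : ((2 * n + 1).factorial : ℝ) ≠ 0 := by positivity
  rw [Finset.prod_div_distrib, Finset.prod_mul_distrib, Finset.prod_mul_distrib]
  generalize ∏ i ∈ Finset.range n, (2 * (i : ℝ) + 2 * n + 2) = A at *
  generalize ∏ i ∈ Finset.range n, (2 * (i : ℝ) + 2 * (n + 1 : ℕ) + 2) = B at *
  generalize ∏ i ∈ Finset.range n, (2 * (n : ℝ) - 2 * i + 1) = E at *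
  generalize ∏ i ∈ Finset.range n, (2 * (n : ℝ) - 2 * i - 1) = F at *
  have hE : E ≠ 0 := by
    rintro rfl
    rw [zero_mul] at h3
    exact hq h3.symm
  have hF : F ≠ 0 := by
    rintro rfl
    rw [zero_mul] at h4
    exact hp h4.symm
  have hf : (n.factorial : ℝ) ≠ 0 := by positivity
  rw [← two_mul, ← h4] at h1
  rw [show n + 1 + n = 2 * n + 1 by ring, ← h3, Nat.factorial_succ] at h2
  have hA : A = (2 ^ n) ^ 2 * F := by
    apply mul_right_cancel₀ hf
    linear_combination h1
  have hB : B * (n + 1) = (2 ^ n) ^ 2 * E := by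
    apply mul_right_cancel₀ hf
    push_cast at h2
    linear_combination h2
  rw [div_eq_div_iff (mul_ne_zero hE hF) (by positivity), pow_mul' (2 : ℝ) 4 n, hA]
  linear_combination ((2 ^ n) ^ 2 * F) * hB

theorem DMinus_succ (N : ℕ) : DMinus (N + 1) = 2 ^ (4 * N) * 8 / ((N + 1) * (4 * N + 3)) *
    (∏ i ∈ Finset.range N, (2 * (N : ℝ) - 2 * i) / (2 * N + 2 * i + 3)) ^ 2 * DMinus N := by
  have h : 2 * (N + 1) * (N + 1 - 1) = 2 * N * (N - 1) + 4 * N := by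
    rcases N with _ | N
    · rfl
    · simp only [Nat.add_sub_cancel]
      ring
  rw [DMinus, DMinus, h, show 2 * (N + 1) = 2 * N + 1 + 1 by ring, DPlus_two_mul_add_two,
    DPlus_two_mul_add_one, Nat.factorial_succ, Nat.factorial_succ, Nat.factorial_succ, pow_add]
  push_cast
  field_simp
  ring

/-- The constant 8^N combines 2^N from the Jacobian with 4^N from the moments. -/
theorem DMinus_eq_cauchyDet (N : ℕ) :
    8 ^ N * |cauchyDet (fun i => (2 * (i : ℝ) + 1) ^ 2) (fun j => -(2 * (j : ℝ) + 2) ^ 2) N|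
      = DMinus N := by
  induction N with
  | zero => simp [DMinus, DPlus, cauchyDet_zero]
  | succ N ih =>
    rw [cauchyDet_succ odd_sq_sub_even_sq_ne_zero, DMinus_succ, ← ih, abs_mul, abs_mul,
      Finset.abs_prod]
    have h1 : ∀ i ∈ Finset.range N, |((2 * (i : ℝ) + 1) ^ 2 - (2 * (N : ℝ) + 1) ^ 2)
        / ((2 * (i : ℝ) + 1) ^ 2 + -(2 * (N : ℝ) + 2) ^ 2) * ((-(2 * (i : ℝ) + 2) ^ 2
          - -(2 * (N : ℝ) + 2) ^ 2) / ((2 * (N : ℝ) + 1) ^ 2 + -(2 * (i : ℝ) + 2) ^ 2))|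
        = ((2 * (N : ℝ) - 2 * i) / (2 * N + 2 * i + 3)) ^ 2 *
          ((2 * (i : ℝ) + 2 * N + 2) * (2 * i + 2 * (N + 1 : ℕ) + 2)
            / ((2 * N - 2 * i + 1) * (2 * N - 2 * i - 1))) := by
      intro i hi
      have hi' : (i : ℝ) + 1 ≤ N := by exact_mod_cast Finset.mem_range.1 hi
      have e1 : (0 : ℝ) < 2 * N - 2 * i - 1 := by linarith
      have e2 : (0 : ℝ) < 2 * N - 2 * i + 1 := by linarith
      have e3 : (0 : ℝ) < 2 * N + 2 * i + 3 := by positivity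
      have e4 : (2 * (i : ℝ) + 1) ^ 2 + -(2 * (N : ℝ) + 2) ^ 2
        = -((2 * N - 2 * i + 1) * (2 * N + 2 * i + 3)) := by ring
      have e5 : (2 * (N : ℝ) + 1) ^ 2 + -(2 * (i : ℝ) + 2) ^ 2
        = (2 * N - 2 * i - 1) * (2 * N + 2 * i + 3) := by ring
      have e6 : 0 ≤ ((2 * (N : ℝ) - 2 * i) / (2 * N + 2 * i + 3)) ^ 2 *
          ((2 * (i : ℝ) + 2 * N + 2) * (2 * i + 2 * (N + 1 : ℕ) + 2)
            / ((2 * N - 2 * i + 1) * (2 * N - 2 * i - 1))) := by positivity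
      rw [← abs_of_nonneg e6, e4, e5]
      congr 1
      push_cast
      field_simp
      ring
    rw [Finset.prod_congr rfl h1, Finset.prod_mul_distrib, prod_nonreal_ratio, Finset.prod_pow]
    have h2 : |((2 * (N : ℝ) + 1) ^ 2 + -(2 * (N : ℝ) + 2) ^ 2)⁻¹| = (4 * (N : ℝ) + 3)⁻¹ := by
      rw [show (2 * (N : ℝ) + 1) ^ 2 + -(2 * (N : ℝ) + 2) ^ 2 = -(4 * N + 3) by ring, abs_inv,
        abs_neg, abs_of_pos (by positivity)]
    rw [h2]
    field_simp
    ring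

theorem norm_det_nonreal (N : ℕ) : 2 ^ N * ‖(Matrix.of fun a b : Fin N => 4 * Complex.I /
    ((2 * (a : ℂ) + 2 * b + 3) * (2 * (a : ℂ) - 2 * b - 1))).det‖ = DMinus N := by
  have h : (Matrix.of fun a b : Fin N => 4 * Complex.I /
      ((2 * (a : ℂ) + 2 * b + 3) * (2 * (a : ℂ) - 2 * b - 1)))
      = (4 * Complex.I) • (algebraMap ℝ ℂ).mapMatrix (Matrix.of fun i j : Fin N =>
        ((fun i : ℕ => (2 * (i : ℝ) + 1) ^ 2) i + (fun j : ℕ => -(2 * (j : ℝ) + 2) ^ 2) j)⁻¹) := by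
    ext a b
    simp only [Matrix.of_apply, Matrix.smul_apply, RingHom.mapMatrix_apply, Matrix.map_apply,
      Complex.coe_algebraMap, smul_eq_mul, div_eq_mul_inv]
    push_cast
    congr 2
    ring
  rw [h, Matrix.det_smul, ← RingHom.map_det, ← DMinus_eq_cauchyDet, cauchyDet, norm_mul,
    Complex.coe_algebraMap, Complex.norm_real, norm_pow, norm_mul, Complex.norm_I,
    Fintype.card_fin, Real.norm_eq_abs, Complex.norm_ofNat, mul_one, ← mul_assoc, ← mul_pow]
  norm_num

theorem DMinus_pos (N : ℕ) : 0 < DMinus N := by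
  have := DPlus_pos (2 * N)
  unfold DMinus
  positivity

end Nonreal

section Probabilities

theorem prob_onlyRealRoots (N : ℕ) : prob N (onlyRealRoots N) = DPlus N / D N := by
  obtain ⟨m, rfl | rfl⟩ := Nat.even_or_odd' N
  · refine prob_eq_of_volume_inter (DPlus_pos _).le ?_
    have h := volume_real_region (m := m) zero_le_one
    rw [det_realMomentMatrix_zero, Complex.norm_real, Real.norm_of_nonneg (DPlus_pos _).le] at h
    exact h
  · refine prob_eq_of_volume_inter (DPlus_pos _).le ?_
    have h := volume_real_region (m := m) le_rfl
    rwa [det_realMomentMatrix_one, Complex.norm_real, Real.norm_of_nonneg (DPlus_pos _).le] at h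

theorem prob_noRealRoots (N : ℕ) : prob (2 * N) (noRealRoots (2 * N)) = DMinus N / D (2 * N) := by
  refine prob_eq_of_volume_inter (DMinus_pos _).le ?_
  rw [volume_nonreal_region, norm_det_nonreal]

end Probabilities

end RootRegion

/-! ### Asymptotics -/

namespace RootRegion

open Topology

section Asymptotics

/-- The logarithm of `factorD n ^ 2 * (n + 3 / 4)`, which converges rapidly. -/
noncomputable def logScaledFactor (n : ℕ) : ℝ := 2 * Real.log (factorD n) + Real.log (n + 3 / 4)

theorem log_factorD (n : ℕ) :
    Real.log (factorD n) = logScaledFactor n / 2 - Real.log (n + 3 / 4) / 2 := by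
  rw [logScaledFactor]
  ring

/-- The shift 3/4 is chosen so that the two cubics differ only in the constant term, which makes the
increments O(n⁻³). -/
theorem logScaledFactor_succ_sub (n : ℕ) : logScaledFactor (n + 1) - logScaledFactor n
    = Real.log ((16 * (n : ℝ) ^ 3 + 60 * n ^ 2 + 72 * n + 28)
      / (16 * (n : ℝ) ^ 3 + 60 * n ^ 2 + 72 * n + 27)) := by
  have h : factorD (n + 1) = (2 * (n : ℝ) + 2) / (2 * n + 3) * factorD n := by
    have := factorD_succ n
    field_simp
    linarith
  have hf := factorD_pos n
  have e1 : logScaledFactor (n + 1) - logScaledFactor n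
      = Real.log (((2 * (n : ℝ) + 2) / (2 * n + 3)) ^ 2 * ((n + 7 / 4) / (n + 3 / 4))) := by
    rw [logScaledFactor, logScaledFactor, h, Real.log_mul (by positivity) hf.ne',
      Real.log_mul (by positivity) (by positivity), Real.log_pow,
      Real.log_div (x := (n : ℝ) + 7 / 4) (by positivity) (by positivity)]
    push_cast
    rw [show (n : ℝ) + 1 + 3 / 4 = n + 7 / 4 by ring]
    ring
  rw [e1]
  congr 1
  field_simp
  ring

theorem logScaledFactor_succ_sub_nonneg (n : ℕ) :
    0 ≤ logScaledFactor (n + 1) - logScaledFactor n := by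
  rw [logScaledFactor_succ_sub]
  apply Real.log_nonneg
  rw [one_le_div (by positivity)]
  linarith

theorem logScaledFactor_succ_sub_le (n : ℕ) :
    logScaledFactor (n + 1) - logScaledFactor n ≤ 1 / (16 * ((n : ℝ) + 1) ^ 3) := by
  rw [logScaledFactor_succ_sub]
  refine (Real.log_le_sub_one_of_pos (by positivity)).trans ?_
  rw [div_sub_one (by positivity), div_le_div_iff₀ (by positivity) (by positivity)]
  have : (0 : ℝ) ≤ n := n.cast_nonneg
  nlinarith [sq_nonneg (n : ℝ)]

theorem logScaledFactor_add_sub_nonneg (m k : ℕ) :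
    0 ≤ logScaledFactor (m + k) - logScaledFactor m := by
  induction k with
  | zero => simp
  | succ k ih =>
    have := logScaledFactor_succ_sub_nonneg (m + k)
    rw [← add_assoc]
    linarith

/-- Used with k = m and k = m + 1, where it gives the summable bound O(m⁻²). -/
theorem logScaledFactor_add_sub_le (m k : ℕ) :
    logScaledFactor (m + k) - logScaledFactor m ≤ k / (16 * ((m : ℝ) + 1) ^ 3) := by
  induction k with
  | zero => simp
  | succ k ih =>
    have h1 := logScaledFactor_succ_sub_le (m + k)
    have h2 : 1 / (16 * (((m + k : ℕ) : ℝ) + 1) ^ 3) ≤ 1 / (16 * ((m : ℝ) + 1) ^ 3) := by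
      gcongr
      simp
    rw [← add_assoc]
    push_cast
    rw [add_div]
    linarith

theorem DPlus_succ_eq_factorD (N : ℕ) : DPlus (N + 1) = DPlus N * (factorD N / 2 ^ N) := by
  rw [DPlus_succ, factorD]
  congr 1
  field_simp
  ring

/-- The logarithm of the ratio `D⁺_N / D_N` divided by `N ^ (1 / 8) / 2 ^ (N ^ 2 / 2)`. -/
noncomputable def logScaledRatio (N : ℕ) : ℝ :=
  Real.log (DPlus N / D N) + (N : ℝ) ^ 2 / 2 * Real.log 2 - Real.log N / 8

theorem log_ratio_two_mul_add_one (m : ℕ) : Real.log (DPlus (2 * m + 1) / D (2 * m + 1))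
    = Real.log (DPlus (2 * m) / D (2 * m)) - 2 * m * Real.log 2
      + Real.log (factorD (2 * m)) - Real.log (factorD m) := by
  have h1 := DPlus_pos (2 * m)
  have h2 := D_pos (2 * m)
  have h3 := factorD_pos (2 * m)
  have h4 := factorD_pos m
  rw [DPlus_succ_eq_factorD, D_two_mul_add_one, Real.log_div (by positivity) (by positivity),
    Real.log_div (by positivity) (by positivity), Real.log_mul (by positivity) (by positivity),
    Real.log_mul (by positivity) (by positivity), Real.log_div (by positivity) (by positivity),
    Real.log_pow]
  push_cast
  ring

theorem log_ratio_two_mul_add_two (m : ℕ) : Real.log (DPlus (2 * m + 2) / D (2 * m + 2))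
    = Real.log (DPlus (2 * m + 1) / D (2 * m + 1)) - (2 * m + 1) * Real.log 2
      + Real.log (factorD (2 * m + 1)) - Real.log (factorD m) := by
  have h1 := DPlus_pos (2 * m + 1)
  have h2 := D_pos (2 * m + 1)
  have h3 := factorD_pos (2 * m + 1)
  have h4 := factorD_pos m
  rw [DPlus_succ_eq_factorD, D_two_mul_add_two, Real.log_div (by positivity) (by positivity),
    Real.log_div (by positivity) (by positivity), Real.log_mul (by positivity) (by positivity),
    Real.log_mul (by positivity) (by positivity), Real.log_div (by positivity) (by positivity),
    Real.log_pow]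
  push_cast
  ring

/-- The quadratic exponent cancels all powers of 2 but one, and the remaining log 2 turns m + 3/4
into 2m + 3/2. -/
theorem logScaledRatio_even_sub {m : ℕ} (hm : m ≠ 0) :
    logScaledRatio (2 * m + 2) - logScaledRatio (2 * m)
      = ((logScaledFactor (2 * m) - logScaledFactor m)
        + (logScaledFactor (2 * m + 1) - logScaledFactor m)) / 2
        + Real.log ((2 * m + 3 / 2) ^ 2 / ((2 * m + 3 / 4) * (2 * m + 7 / 4))) / 2
        - Real.log (1 + 1 / m) / 8 := by
  have hm' : (0 : ℝ) < m := by positivity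
  rw [logScaledRatio, logScaledRatio, log_ratio_two_mul_add_two, log_ratio_two_mul_add_one,
    log_factorD m, log_factorD (2 * m), log_factorD (2 * m + 1),
    Real.log_div (x := (2 * (m : ℝ) + 3 / 2) ^ 2) (by positivity) (by positivity), Real.log_pow,
    Real.log_mul (x := 2 * (m : ℝ) + 3 / 4) (by positivity) (by positivity),
    show (1 : ℝ) + 1 / m = (m + 1) / m by field_simp,
    Real.log_div (x := (m : ℝ) + 1) (by positivity) (by positivity)]
  push_cast
  rw [show 2 * (m : ℝ) + 2 = 2 * (m + 1) by ring, show 2 * (m : ℝ) + 3 / 2 = 2 * (m + 3 / 4) by ring,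
    show 2 * (m : ℝ) + 1 + 3 / 4 = 2 * m + 7 / 4 by ring,
    Real.log_mul (x := 2) (y := (m : ℝ) + 1) (by norm_num) (by positivity),
    Real.log_mul (x := 2) (y := (m : ℝ)) (by norm_num) (by positivity),
    Real.log_mul (x := 2) (y := (m : ℝ) + 3 / 4) (by norm_num) (by positivity)]
  ring

/-- Half the logarithm of the quotient is 1/(8m) + O(m⁻²), and log(1 + 1/m)/8 cancels its main term;
this dictates the exponent 1/8. -/
theorem abs_logScaledRatio_even_sub_le {m : ℕ} (hm : m ≠ 0) :
    |logScaledRatio (2 * m + 2) - logScaledRatio (2 * m)| ≤ 1 / (m : ℝ) ^ 2 := by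
  have hm' : (0 : ℝ) < m := by positivity
  have hm1 : (1 : ℝ) ≤ m := by exact_mod_cast Nat.one_le_iff_ne_zero.2 hm
  have a1 := logScaledFactor_add_sub_nonneg m m
  have a2 := logScaledFactor_add_sub_nonneg m (m + 1)
  have b1 := logScaledFactor_add_sub_le m m
  have b2 := logScaledFactor_add_sub_le m (m + 1)
  rw [← add_assoc] at a2 b2
  rw [← two_mul] at a1 a2 b1 b2
  have b3 : (m : ℝ) / (16 * ((m : ℝ) + 1) ^ 3) + ((m + 1 : ℕ) : ℝ) / (16 * ((m : ℝ) + 1) ^ 3)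
      ≤ 1 / (8 * (m : ℝ) ^ 2) := by
    rw [← add_div, div_le_div_iff₀ (by positivity) (by positivity)]
    push_cast
    nlinarith [sq_nonneg (m : ℝ), mul_pos hm' hm', mul_pos (mul_pos hm' hm') hm']
  have c1 : Real.log (1 + 1 / (m : ℝ)) ≤ 1 / m :=
    (Real.log_le_sub_one_of_pos (by positivity)).trans_eq (by ring)
  have c2 : 1 / (m : ℝ) - 1 / (m : ℝ) ^ 2 ≤ Real.log (1 + 1 / m) := by
    refine le_trans ?_ (Real.one_sub_inv_le_log_of_pos (by positivity))
    have h : 1 - (1 + 1 / (m : ℝ))⁻¹ = 1 / (m + 1) := by field_simp; ring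
    rw [h, div_sub_div _ _ hm'.ne' (by positivity), div_le_div_iff₀ (by positivity) (by positivity)]
    nlinarith [mul_pos hm' hm', mul_pos (mul_pos hm' hm') hm']
  have d1 : Real.log ((2 * (m : ℝ) + 3 / 2) ^ 2 / ((2 * m + 3 / 4) * (2 * m + 7 / 4)))
      ≤ 1 / (4 * m) := by
    refine (Real.log_le_sub_one_of_pos (by positivity)).trans ?_
    rw [div_sub_one (by positivity), div_le_div_iff₀ (by positivity) (by positivity)]
    nlinarith
  have d2 : 1 / (4 * (m : ℝ)) - 1 / (m : ℝ) ^ 2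
      ≤ Real.log ((2 * (m : ℝ) + 3 / 2) ^ 2 / ((2 * m + 3 / 4) * (2 * m + 7 / 4))) := by
    refine le_trans ?_ (Real.one_sub_inv_le_log_of_pos (by positivity))
    rw [inv_div, one_sub_div (by positivity), div_sub_div _ _ (by positivity) (by positivity),
      div_le_div_iff₀ (by positivity) (by positivity)]
    nlinarith [mul_pos hm' hm', mul_pos (mul_pos hm' hm') hm', mul_pos (mul_pos (mul_pos hm' hm') hm') hm']
  rw [logScaledRatio_even_sub hm, abs_le]
  have e1 : 1 / (4 * (m : ℝ)) = 1 / m / 4 := by field_simp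
  have e2 : 1 / (8 * (m : ℝ) ^ 2) = 1 / (m : ℝ) ^ 2 / 8 := by field_simp
  have e3 : 0 < 1 / (m : ℝ) ^ 2 := by positivity
  rw [e1] at d1 d2
  rw [e2] at b3
  constructor <;> linarith

theorem logScaledRatio_odd_sub {m : ℕ} (hm : m ≠ 0) :
    logScaledRatio (2 * m + 1) - logScaledRatio (2 * m)
      = (logScaledFactor (2 * m) - logScaledFactor m) / 2
        + Real.log ((2 * m + 3 / 2) / (2 * m + 3 / 4)) / 2
        - Real.log (1 + 1 / (2 * m)) / 8 := by
  have hm' : (0 : ℝ) < m := by positivity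
  rw [logScaledRatio, logScaledRatio, log_ratio_two_mul_add_one,
    log_factorD m, log_factorD (2 * m),
    Real.log_div (x := 2 * (m : ℝ) + 3 / 2) (by positivity) (by positivity),
    show (1 : ℝ) + 1 / (2 * m) = (2 * m + 1) / (2 * m) by field_simp,
    Real.log_div (x := 2 * (m : ℝ) + 1) (by positivity) (by positivity)]
  push_cast
  rw [show 2 * (m : ℝ) + 3 / 2 = 2 * (m + 3 / 4) by ring,
    Real.log_mul (x := 2) (y := (m : ℝ) + 3 / 4) (by norm_num) (by positivity)]
  ring

theorem abs_logScaledRatio_odd_sub_le {m : ℕ} (hm : m ≠ 0) :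
    |logScaledRatio (2 * m + 1) - logScaledRatio (2 * m)| ≤ 1 / (m : ℝ) := by
  have hm' : (0 : ℝ) < m := by positivity
  have a1 := logScaledFactor_add_sub_nonneg m m
  have b1 := logScaledFactor_add_sub_le m m
  rw [← two_mul] at a1 b1
  have b3 : (m : ℝ) / (16 * ((m : ℝ) + 1) ^ 3) ≤ 1 / m := by
    rw [div_le_div_iff₀ (by positivity) (by positivity)]
    nlinarith [mul_pos hm' hm', mul_pos (mul_pos hm' hm') hm']
  have c1 : Real.log (1 + 1 / (2 * (m : ℝ))) ≤ 1 / m := by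
    refine (Real.log_le_sub_one_of_pos (by positivity)).trans ?_
    rw [add_sub_cancel_left, div_le_div_iff₀ (by positivity) (by positivity)]
    linarith
  have c2 : 0 ≤ Real.log (1 + 1 / (2 * (m : ℝ))) := Real.log_nonneg (by
    rw [le_add_iff_nonneg_right]
    positivity)
  have d1 : Real.log ((2 * (m : ℝ) + 3 / 2) / (2 * m + 3 / 4)) ≤ 1 / m := by
    refine (Real.log_le_sub_one_of_pos (by positivity)).trans ?_
    rw [div_sub_one (by positivity), div_le_div_iff₀ (by positivity) (by positivity)]
    nlinarith
  have d2 : 0 ≤ Real.log ((2 * (m : ℝ) + 3 / 2) / (2 * m + 3 / 4)) := Real.log_nonneg (by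
    rw [one_le_div (by positivity)]
    linarith)
  rw [logScaledRatio_odd_sub hm, abs_le]
  constructor <;> linarith

theorem tendsto_of_even_odd {X : Type*} [TopologicalSpace X] {u : ℕ → X} {a : X}
    (he : Tendsto (fun m => u (2 * m)) atTop (𝓝 a))
    (ho : Tendsto (fun m => u (2 * m + 1)) atTop (𝓝 a)) : Tendsto u atTop (𝓝 a) := by
  intro s hs
  obtain ⟨M, hM⟩ := eventually_atTop.1 (he hs)
  obtain ⟨M', hM'⟩ := eventually_atTop.1 (ho hs)
  refine eventually_atTop.2 ⟨2 * M + 2 * M', fun n hn => ?_⟩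
  obtain ⟨m, rfl | rfl⟩ := Nat.even_or_odd' n
  · exact hM m (by omega)
  · exact hM' m (by omega)

/-- Summable increments make the even subsequence Cauchy, and the odd terms differ from it by
O(1/m). -/
theorem exists_tendsto_logScaledRatio : ∃ c, Tendsto logScaledRatio atTop (𝓝 c) := by
  have hs : Summable fun m : ℕ => 1 / ((m : ℝ) + 1) ^ 2 := by
    have := (summable_nat_add_iff 1).2 (Real.summable_one_div_nat_pow.2 one_lt_two)
    simpa using this
  have hc : CauchySeq fun m => logScaledRatio (2 * (m + 1)) := by
    refine cauchySeq_of_dist_le_of_summable _ (fun m => ?_) hs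
    rw [dist_comm, Real.dist_eq]
    simpa [mul_add] using abs_logScaledRatio_even_sub_le m.succ_ne_zero
  obtain ⟨c, hc⟩ := cauchySeq_tendsto_of_complete hc
  have he : Tendsto (fun m => logScaledRatio (2 * m)) atTop (𝓝 c) :=
    (tendsto_add_atTop_iff_nat (f := fun m => logScaledRatio (2 * m)) 1).1 hc
  refine ⟨c, tendsto_of_even_odd he ?_⟩
  have hd : Tendsto (fun m => logScaledRatio (2 * m + 1) - logScaledRatio (2 * m)) atTop (𝓝 0) := by
    refine squeeze_zero_norm' ?_ tendsto_one_div_atTop_nhds_zero_nat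
    filter_upwards [eventually_ne_atTop 0] with m hm
    exact abs_logScaledRatio_odd_sub_le hm
  simpa using hd.add he

theorem ratio_eq_exp_logScaledRatio {N : ℕ} (hN : N ≠ 0) :
    DPlus N / D N = Real.exp (logScaledRatio N) * (N : ℝ) ^ (1 / 8 : ℝ)
      / (2 : ℝ) ^ ((N : ℝ) ^ 2 / 2) := by
  have h1 := div_pos (DPlus_pos N) (D_pos N)
  rw [Real.rpow_def_of_pos (by positivity), Real.rpow_def_of_pos (by positivity), ← Real.exp_add,
    ← Real.exp_sub, logScaledRatio]
  nth_rewrite 1 [← Real.exp_log h1]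
  congr 1
  ring

theorem ratio_isEquivalent {c : ℝ} (hc : Tendsto logScaledRatio atTop (𝓝 c)) :
    (fun N : ℕ => DPlus N / D N) ~[atTop]
      fun N : ℕ => Real.exp c * (N : ℝ) ^ (1 / 8 : ℝ) / (2 : ℝ) ^ ((N : ℝ) ^ 2 / 2) := by
  rw [isEquivalent_iff_exists_eq_mul]
  refine ⟨fun N => Real.exp (logScaledRatio N - c), ?_, ?_⟩
  · have := (Real.continuous_exp.tendsto 0).comp (by simpa using hc.sub_const c)
    simpa [Function.comp_def] using this
  · filter_upwards [eventually_ne_atTop 0] with N hN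
    simp only [Pi.mul_apply]
    rw [ratio_eq_exp_logScaledRatio hN, Real.exp_sub]
    field_simp

/-- Up to elementary factors this is the Stirling sequence at 2n divided by the square of the one at
n. -/
theorem tendsto_centralBinom_scaled :
    Tendsto (fun n : ℕ => ((2 * n).factorial : ℝ) / (n.factorial : ℝ) ^ 2 * √n / 4 ^ n)
      atTop (𝓝 (√Real.pi)⁻¹) := by
  have h1 := Stirling.tendsto_stirlingSeq_sqrt_pi
  have h2 : Tendsto (fun n : ℕ => Stirling.stirlingSeq (2 * n)) atTop (𝓝 √Real.pi) :=
    h1.comp (tendsto_id.const_mul_atTop' two_pos)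
  have hpi : √Real.pi ≠ 0 := by positivity
  have h3 := h2.div (h1.pow 2) (pow_ne_zero 2 hpi)
  have h4 : √Real.pi / √Real.pi ^ 2 = (√Real.pi)⁻¹ := by field_simp
  rw [h4] at h3
  refine h3.congr' ?_
  filter_upwards [eventually_ne_atTop 0] with n hn
  have hn' : (0 : ℝ) < n := by positivity
  have h5 : √(2 * ((2 * n : ℕ) : ℝ)) = 2 * √n := by
    rw [show 2 * ((2 * n : ℕ) : ℝ) = 2 ^ 2 * n by push_cast; ring, Real.sqrt_mul (by norm_num),
      Real.sqrt_sq (by norm_num)]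
  have h6 : √(2 * (n : ℝ)) ^ 2 = 2 * n := Real.sq_sqrt (by positivity)
  have h7 : √(n : ℝ) ^ 2 = n := Real.sq_sqrt hn'.le
  have h8 : (((2 * n : ℕ) : ℝ) / Real.exp 1) ^ (2 * n) = 4 ^ n * (((n : ℝ) / Real.exp 1) ^ n) ^ 2 := by
    push_cast
    rw [mul_div_assoc, mul_pow, pow_mul (2 : ℝ), pow_mul' _ 2 n]
    norm_num
  have h9 : (0 : ℝ) < ((n : ℝ) / Real.exp 1) ^ n := by positivity
  simp only [Pi.div_apply, Stirling.stirlingSeq]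
  rw [h5, h8, div_pow (n.factorial : ℝ), mul_pow √(2 * (n : ℝ)), h6]
  generalize ((n : ℝ) / Real.exp 1) ^ n = E at *
  field_simp
  exact h7.symm

theorem DMinus_ratio_eq {N : ℕ} (hN : N ≠ 0) : DMinus N / D (2 * N)
    = Real.exp (logScaledRatio (2 * N)) * (2 * (N : ℝ)) ^ (1 / 8 : ℝ)
      * (((2 * N).factorial : ℝ) / (N.factorial : ℝ) ^ 2 / 4 ^ N) := by
  have h := ratio_eq_exp_logScaledRatio (N := 2 * N) (by omega)
  -- Since (2N)²/2 = 2N(N-1) + 2N, the power of 2 in `DMinus` cancels the quadratic decay up to 4^N,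
  -- which is the growth rate of the central binomial coefficient.
  have h2 : (2 : ℝ) ^ (((2 * N : ℕ) : ℝ) ^ 2 / 2) = 2 ^ (2 * N * (N - 1)) * 4 ^ N := by
    rw [show (4 : ℝ) = 2 ^ 2 by norm_num, ← pow_mul, ← pow_add, ← Real.rpow_natCast (2 : ℝ)]
    congr 1
    obtain ⟨M, rfl⟩ := Nat.exists_eq_succ_of_ne_zero hN
    simp only [Nat.succ_eq_add_one, Nat.add_sub_cancel]
    push_cast
    ring
  rw [h2] at h
  push_cast at h
  rw [DMinus, mul_div_assoc, h]
  field_simp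

theorem DMinus_ratio_isEquivalent {c : ℝ} (hc : Tendsto logScaledRatio atTop (𝓝 c)) :
    (fun N : ℕ => DMinus N / D (2 * N)) ~[atTop] fun N : ℕ =>
      2 * Real.exp c / (√(2 * Real.pi) * (2 * (N : ℝ)) ^ (3 / 8 : ℝ)) := by
  rw [isEquivalent_iff_exists_eq_mul]
  have hpi : √Real.pi ≠ 0 := by positivity
  refine ⟨fun N => Real.exp (logScaledRatio (2 * N) - c) *
    (((2 * N).factorial : ℝ) / (N.factorial : ℝ) ^ 2 * √N / 4 ^ N * √Real.pi), ?_, ?_⟩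
  · have h1 : Tendsto (fun N : ℕ => logScaledRatio (2 * N) - c) atTop (𝓝 0) := by
      simpa using (hc.comp (tendsto_id.const_mul_atTop' two_pos)).sub_const c
    have h2 := ((Real.continuous_exp.tendsto 0).comp h1).mul
      (tendsto_centralBinom_scaled.mul_const √Real.pi)
    simpa [hpi] using h2
  · filter_upwards [eventually_ne_atTop 0] with N hN
    have hN' : (0 : ℝ) < N := by positivity
    simp only [Pi.mul_apply]
    -- The decay N^(-1/2) of the scaled binomial coefficient turns the growth exponent 1/8 into the
    -- decay exponent 3/8.
    have h1 : (2 * (N : ℝ)) ^ (1 / 8 : ℝ) * (2 * (N : ℝ)) ^ (3 / 8 : ℝ) = √2 * √N := by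
      rw [← Real.rpow_add (by positivity), ← Real.sqrt_mul (by norm_num), Real.sqrt_eq_rpow]
      norm_num
    have h2 : √2 ^ 2 = (2 : ℝ) := Real.sq_sqrt (by norm_num)
    have h3 : (2 * (N : ℝ)) ^ (3 / 8 : ℝ) ≠ 0 := by positivity
    rw [DMinus_ratio_eq hN, Real.exp_sub, Real.sqrt_mul (by norm_num)]
    field_simp
    linear_combination √2 * h1 + √N * h2

end Asymptotics

/-! ### Absence of real roots and positivity -/

section Positivity

open Polynomial

/-- In positive degree a monic polynomial tends to +∞, so a nonpositive value forces a zero further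
to the right. In degree zero the polynomial is the constant 1. -/
theorem mem_noRealRoots_iff_forall_pos {N : ℕ} (a : Fin (2 * N) → ℝ) :
    a ∈ noRealRoots (2 * N) ↔ ∀ x : ℝ, 0 < (monicPoly a).eval x := by
  refine ⟨fun h x => ?_, fun h x => (h x).ne'⟩
  by_contra! hx
  rcases Nat.eq_zero_or_pos N with rfl | hN
  · have := natDegree_monicPoly a
    rw [(monicPoly_monic a).natDegree_eq_zero.1 this] at hx
    simp at hx
    linarith
  have htop : Tendsto (fun t => (monicPoly a).eval t) atTop atTop := by
    refine tendsto_atTop_of_leadingCoeff_nonneg _ ?_ ?_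
    · rw [← natDegree_pos_iff_degree_pos, natDegree_monicPoly]
      omega
    · rw [(monicPoly_monic a).leadingCoeff]
      exact zero_le_one
  obtain ⟨y, hy, hxy⟩ := ((htop.eventually_gt_atTop 0).and (eventually_ge_atTop x)).exists
  obtain ⟨t, -, ht⟩ := intermediate_value_Icc hxy (monicPoly a).continuous.continuousOn ⟨hx, hy.le⟩
  exact h t ht

end Positivity

end RootRegion

theorem mainTheorem7 :
    (∀ N : ℕ, RootRegion.prob N (RootRegion.onlyRealRoots N)
      = RootRegion.DPlus N / RootRegion.D N) ∧
    (∀ N : ℕ, RootRegion.prob (2 * N) (RootRegion.noRealRoots (2 * N))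
      = RootRegion.DMinus N / RootRegion.D (2 * N)) ∧
    (∀ N : ℕ, ∀ a ∈ RootRegion.Omega (2 * N),
      a ∈ RootRegion.noRealRoots (2 * N) ↔ ∀ x : ℝ, 0 < (RootRegion.monicPoly a).eval x) ∧
    ∃ C : ℝ, 0 < C ∧
      (fun N : ℕ => RootRegion.prob N (RootRegion.onlyRealRoots N))
        ~[atTop] (fun N : ℕ => C * (N : ℝ) ^ (1 / 8 : ℝ) / (2 : ℝ) ^ ((N : ℝ) ^ 2 / 2)) ∧
      (fun N : ℕ => RootRegion.prob (2 * N) (RootRegion.noRealRoots (2 * N)))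
        ~[atTop] (fun N : ℕ =>
          2 * C / (Real.sqrt (2 * Real.pi) * (2 * (N : ℝ)) ^ (3 / 8 : ℝ))) := by
  obtain ⟨c, hc⟩ := RootRegion.exists_tendsto_logScaledRatio
  refine ⟨RootRegion.prob_onlyRealRoots, RootRegion.prob_noRealRoots,
    fun N a _ => RootRegion.mem_noRealRoots_iff_forall_pos a, Real.exp c, Real.exp_pos c, ?_, ?_⟩
  · simp only [RootRegion.prob_onlyRealRoots]
    exact RootRegion.ratio_isEquivalent hc
  · simp only [RootRegion.prob_noRealRoots]
    exact RootRegion.DMinus_ratio_isEquivalent hc
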